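/- **Setting.** Let $G$ be a (Hausdorff, second countable) Lie groupoid with unit space $G^0$, range and source maps $r,s$, $G^u=r^{-1}(u)$, $G_u=s^{-1}(u)$. Assume that $G^0$ is a proper $G$-space (the map $g\mapsto(r(g),s(g))$, $G\to G^0\times G^0$, is proper) and that it is $G$-compact (the orbit space $G^0/G$ is compact). Fix a left Haar system $\{\lambda^u\}_{u\in G^0}$, and let $\lambda_u$ be the image of $\lambda^u$ under inversion. Let $C^*_{red}(G)$ be the completion of the convolution algebra $C_c(G)$, with $(f_1*f_2)(g)=\int f_1(h)f_2(h^{-1}g)\,d\lambda^{r(g)}(h)$ and $f^*(g)=\overline{f(g^{-1})}$, for the norm $\sup_u\|\pi_u(f)\|$, where $\pi_u(f)\xi=f*\xi$ on $L^2(G_u,\lambda_u)$. Let $(X,p)$ be a $G$-manifold which is a smooth fibre bundle $p:X\to G^0$ with compact fibre $Z$, let $E\to X$ be a smooth $G$-equivariant complex vector bundle with a continuous $G$-isometric hermitian metric, and let $\{\mu^u\}_{u\in G^0}$ be a $G$-invariant family of regular Borel measures $\mu^u$ on the fibres $X^u=p^{-1}(u)$, each with support $X^u$, such that $u\mapsto\int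 f\,d\mu^u$ is continuous for each $f\in C_c(X)$ (for example the measures of a $G$-isometric metric along the fibres). Let $\mathfrak H$ be the bundle over $G^0$ with fibres the Hilbert spaces $\mathfrak H^u=L^2(X^u,E|_{X^u},\mu^u)$, the inner product $\langle\cdot,\cdot\rangle$ being conjugate linear in the first and linear in the second variable. Its topology is generated by the tubes $\{\xi\in\mathfrak H^u: u\in U,\ \|\xi-f|_{X^u}\|<\varepsilon\}$ with $f\in C_c(X,E)$, $U\subset G^0$ open, $\varepsilon>0$. An arrow $g$ acts by the unitary $L_g:\mathfrak H^{s(g)}\to\mathfrak H^{r(g)}$, $L_gf(x)=g[f(g^{-1}x)]$. A morphism of $\mathfrak H$ is a family $T=(T^u)$ of bounded operators $T^u$ on $\mathfrak H^u$ such that $T$ and $T^*=((T^u)^*)$ are continuous maps $\mathfrak H\to\mathfrak H$. It is equivariant if $L_gT^{s(g)}=T^{r(g)}L_g$ for all $g\in G$. $\mathbf B_G(\mathfrak H)$ is the $C^*$-algebra of equivariant morphisms with $\|T\|=\sup_u\|T^u\|<\infty$, and $\mathbf K_G(\mathfrak H)$ consists of those $T\in\mathbf B_G(\mathfrak H)$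 such that for every compact $A\subset G^0$ the set $\{T^u\xi: u\in A,\ \xi\in\mathfrak H^u,\ \|\xi\|\le1\}$ has compact closure in $\mathfrak H$. For $e_1,e_2\in C_c(X,E)$, $T(e_1,e_2)$ is given by $$T(e_1,e_2)^u\xi=\int_{G^u}\langle L_ge_2,\xi\rangle\,L_ge_1\,d\lambda^u(g).$$ On the space $\Gamma_c(\mathfrak H)$ of continuous compactly supported sections of $\mathfrak H$ put $$\langle e_1,e_2\rangle(g)=\langle e_1(r(g)),L_ge_2(s(g))\rangle,\qquad (ef)(u)=\int_{G^u}f(g^{-1})\,L_ge(s(g))\,d\lambda^u(g)\qquad(f\in C_c(G)).$$ **Theorem 5.7.** With these operations $\Gamma_c(\mathfrak H)$ is a pre-Hilbert module over $C_c(G)\subset C^*_{red}(G)$, so that it has a completion $\Gamma(\mathfrak H)$, a Hilbert $C^*_{red}(G)$-module. Let $\mathbf B(\Gamma(\mathfrak H))$ be the $C^*$-algebra of adjointable operators on $\Gamma(\mathfrak H)$, and $\mathbf K(\Gamma(\mathfrak H))$ the closed linear span of the operators $\theta_{x,y}:z\mapsto x\langle y,z\rangle$, $x,y\in\Gamma(\mathfrak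 H)$. There is an injective unital $*$-homomorphism $$\Phi:\mathbf B_G(\mathfrak H)\to\mathbf B(\Gamma(\mathfrak H)),\qquad \Phi(T)(f)(u)=T^uf(u)\quad(T\in\mathbf B_G(\mathfrak H),\ f\in\Gamma_c(\mathfrak H),\ u\in G^0).$$ It is isometric and maps $\mathbf K_G(\mathfrak H)$ onto $\mathbf K(\Gamma(\mathfrak H))$. Moreover, for all $e_1,e_2\in C_c(X,E)$, $T(e_1,e_2)$ belongs to $\mathbf K_G(\mathfrak H)$ and $\Phi(T(e_1,e_2))=\theta_{e_1,e_2}$. -/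

import Mathlib

open scoped Manifold ContDiff ENNReal Topology CompactlySupported
open MeasureTheory Bundle Set

set_option linter.unusedSectionVars false

universe uM uG uX uZ uF uE uV

noncomputable section

namespace EquivariantHilbert

/-- The fibre of a map `q : Y → M` over the point `u`. -/
abbrev Fib {Y M : Type*} (q : Y → M) (u : M) : Type _ := {y : Y // q y = u}

/-! ### Lie groupoids -/

/-- A Lie groupoid with manifold of arrows `G` and manifold of units `M`.  The unit space is
regarded as a submanifold of `G` through `unit`.  The product `mul g h` is only meaningful for
composable pairs, `s g = r h`; its values at other pairs play no role. -/
structure LieGroupoid (m k : ℕ) (M : Type uM) (G : Type uG)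
    [TopologicalSpace M] [ChartedSpace (EuclideanSpace ℝ (Fin m)) M]
    [TopologicalSpace G] [ChartedSpace (EuclideanSpace ℝ (Fin k)) G] where
  r : G → M
  s : G → M
  unit : M → G
  inv : G → G
  mul : G → G → G
  r_unit : ∀ u, r (unit u) = u
  s_unit : ∀ u, s (unit u) = u
  r_inv : ∀ g, r (inv g) = s g
  s_inv : ∀ g, s (inv g) = r g
  r_mul : ∀ g h, s g = r h → r (mul g h) = r g
  s_mul : ∀ g h, s g = r h → s (mul g h) = s h
  mul_assoc : ∀ a b c, s a = r b → s b = r c → mul (mul a b) c = mul a (mul b c)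
  unit_mul : ∀ g, mul (unit (r g)) g = g
  mul_unit : ∀ g, mul g (unit (s g)) = g
  inv_mul : ∀ g, mul (inv g) g = unit (s g)
  mul_inv : ∀ g, mul g (inv g) = unit (r g)
  submersion_r : Manifold.IsSubmersion (𝓡 k) (𝓡 m) ∞ r
  submersion_s : Manifold.IsSubmersion (𝓡 k) (𝓡 m) ∞ s
  smooth_unit : ContMDiff (𝓡 m) (𝓡 k) ∞ unit
  smooth_inv : ContMDiff (𝓡 k) (𝓡 k) ∞ inv
  smooth_mul : ContMDiffOn ((𝓡 k).prod (𝓡 k)) (𝓡 k) ∞ (fun q : G × G => mul q.1 q.2)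
    {q | s q.1 = r q.2}

/-- A continuous family of measures with full support along the fibres of `q`: each `ν u` is a
regular Borel measure on the fibre over `u`, its support is the whole fibre, and the fibre
integrals of a continuous function with compact support depend continuously on `u`. -/
structure IsContinuousFibreSystem {Y : Type*} {M : Type*} [TopologicalSpace Y] [MeasurableSpace Y]
    [TopologicalSpace M] (q : Y → M) (ν : ∀ u, Measure (Fib q u)) : Prop where
  regular : ∀ u, (ν u).Regular
  full_support : ∀ u, (ν u).IsOpenPosMeasure
  continuous_integral : ∀ f : Y → ℂ, Continuous f → HasCompactSupport f →
    Continuous fun u => ∫ y : Fib q u, f y ∂(ν u)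

section Groupoid

variable {m k : ℕ} {M : Type uM} {G : Type uG}
  [TopologicalSpace M] [ChartedSpace (EuclideanSpace ℝ (Fin m)) M]
  [TopologicalSpace G] [ChartedSpace (EuclideanSpace ℝ (Fin k)) G]

/-- The unit space is a proper `G`-space: the map `(g, u) ↦ (g • u, u)`, that is
`g ↦ (r g, s g)`, is proper. -/
def LieGroupoid.IsProper (𝒢 : LieGroupoid m k M G) : Prop :=
  ∀ C : Set (M × M), IsCompact C → IsCompact {g : G | (𝒢.r g, 𝒢.s g) ∈ C}

/-- The unit space is `G`-compact: its orbit space, with the quotient topology, is compact. -/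
def LieGroupoid.IsGCompact (𝒢 : LieGroupoid m k M G) : Prop :=
  CompactSpace (Quot fun u v : M => ∃ g : G, 𝒢.s g = u ∧ 𝒢.r g = v)

/-- A left Haar system on a Lie groupoid. -/
structure HaarSystem [MeasurableSpace G] (𝒢 : LieGroupoid m k M G) where
  /-- the measure `λ^u` on `G^u`, the set of arrows with range `u` -/
  meas : ∀ u, Measure (Fib 𝒢.r u)
  isContinuous : IsContinuousFibreSystem 𝒢.r meas
  left_invariant : ∀ (g : G) (f : G → ℂ), Continuous f → HasCompactSupport f →
    ∫ h : Fib 𝒢.r (𝒢.s g), f (𝒢.mul g h.1) ∂(meas (𝒢.s g)) =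
      ∫ h : Fib 𝒢.r (𝒢.r g), f h.1 ∂(meas (𝒢.r g))

variable [MeasurableSpace G] {𝒢 : LieGroupoid m k M G}

/-! ### The reduced C⋆-algebra -/

/-- The measure `λ_u` on `G_u`, the set of arrows with source `u`: the image of `λ^u` under
inversion. -/
def HaarSystem.measSource (lam : HaarSystem 𝒢) (u : M) : Measure (Fib 𝒢.s u) :=
  (lam.meas u).map fun g => ⟨𝒢.inv g.1, (𝒢.s_inv g.1).trans g.2⟩

/-- The convolution product `(f₁ * f₂)(g) = ∫ f₁(h) f₂(h⁻¹ g) dλ^{r(g)}(h)`. -/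
def HaarSystem.conv (lam : HaarSystem 𝒢) (f₁ f₂ : G → ℂ) (g : G) : ℂ :=
  ∫ h : Fib 𝒢.r (𝒢.r g), f₁ h.1 * f₂ (𝒢.mul (𝒢.inv h.1) g) ∂(lam.meas (𝒢.r g))

/-- The C⋆-algebra of all uniformly bounded families, indexed by the units `u`, of bounded operators
on the Hilbert spaces `L²(G_u, λ_u)`, with the supremum norm. -/
def HaarSystem.RegularProduct (lam : HaarSystem 𝒢) : Type _ :=
  lp (fun u : M => Lp ℂ 2 (lam.measSource u) →L[ℂ] Lp ℂ 2 (lam.measSource u)) ∞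

instance (lam : HaarSystem 𝒢) : NonUnitalCStarAlgebra lam.RegularProduct :=
  inferInstanceAs (NonUnitalCStarAlgebra
    (lp (fun u : M => Lp ℂ 2 (lam.measSource u) →L[ℂ] Lp ℂ 2 (lam.measSource u)) ∞))

/-- The operator at the unit `u` of an element of the product. -/
def HaarSystem.RegularProduct.at {lam : HaarSystem 𝒢} (a : lam.RegularProduct) (u : M) :
    Lp ℂ 2 (lam.measSource u) →L[ℂ] Lp ℂ 2 (lam.measSource u) :=
  a.1 u

/-- `lam.IsRegularRep f a` says that `a` is the family `(π_u(f))_u` of (left) regular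
representation operators of `f ∈ C_c(G)`: for every unit `u` the operator `a u` on `L²(G_u, λ_u)`
maps (the class of) `ξ ∈ C_c(G)` to (the class of) `f * ξ`.  Such `ξ` being dense in
`L²(G_u, λ_u)`, this determines `a`. -/
def HaarSystem.IsRegularRep (lam : HaarSystem 𝒢) (f : C_c(G, ℂ)) (a : lam.RegularProduct) : Prop :=
  ∀ (u : M) (ξ : C_c(G, ℂ)) (η : Lp ℂ 2 (lam.measSource u)),
    (η : Fib 𝒢.s u → ℂ) =ᵐ[lam.measSource u] (fun g => ξ g.1) →
    (a.at u η : Fib 𝒢.s u → ℂ) =ᵐ[lam.measSource u] (fun g => lam.conv f ξ g.1)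

/-- The reduced C⋆-algebra of the groupoid: the completion of `C_c(G)` for the norm
`‖f‖ = sup_u ‖π_u(f)‖`, realised as the norm closure of the image of `C_c(G)` under
`f ↦ (π_u(f))_u`. -/
def HaarSystem.redAlgebra (lam : HaarSystem 𝒢) : NonUnitalStarSubalgebra ℂ lam.RegularProduct :=
  (NonUnitalStarAlgebra.adjoin ℂ {a | ∃ f : C_c(G, ℂ), lam.IsRegularRep f a}).topologicalClosure

instance (lam : HaarSystem 𝒢) : IsClosed (lam.redAlgebra : Set lam.RegularProduct) :=
  NonUnitalStarSubalgebra.isClosed_topologicalClosure _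

/-- The reduced C⋆-algebra `C⋆_red(G)` as a type. -/
abbrev HaarSystem.CRed (lam : HaarSystem 𝒢) : Type _ := lam.redAlgebra

instance (lam : HaarSystem 𝒢) : NonUnitalCStarAlgebra lam.CRed := inferInstance
end Groupoid

/-! ### Hilbert C⋆-modules -/

/-- A (right) Hilbert `A`-module structure on the Banach space `E`: the inner product is conjugate
linear in the first and linear in the second variable.  Positivity is expressed in the form
`⟪x, x⟫ = b⋆ b`. -/
class HilbertModule (A : Type*) (E : Type*) [NonUnitalCStarAlgebra A] [NormedAddCommGroup E]
    [NormedSpace ℂ E] [CompleteSpace E] where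
  /-- the right action of `A` -/
  ract : E →ₗ[ℂ] A →ₗ[ℂ] E
  /-- the `A`-valued inner product -/
  ip : E → E → A
  ract_mul : ∀ x a b, ract x (a * b) = ract (ract x a) b
  ip_add_right : ∀ x y z, ip x (y + z) = ip x y + ip x z
  ip_smul_right : ∀ (c : ℂ) x y, ip x (c • y) = c • ip x y
  ip_ract_right : ∀ x y a, ip x (ract y a) = ip x y * a
  star_ip : ∀ x y, star (ip x y) = ip y x
  ip_self_nonneg : ∀ x, ∃ b : A, ip x x = star b * b
  norm_sq_eq : ∀ x, ‖x‖ ^ 2 = ‖ip x x‖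

namespace HilbertModule

variable {A : Type*} {E : Type*} [NonUnitalCStarAlgebra A] [NormedAddCommGroup E]
    [NormedSpace ℂ E] [CompleteSpace E] [HilbertModule A E]

theorem ext_ip {y z : E} (h : ∀ x : E, (ip x y : A) = ip x z) : y = z := by
  have h0 : (ip (y - z) (y - z) : A) = 0 := by
    have h1 : (ip (y - z) y : A) = ip (y - z) ((y - z) + z) := by rw [sub_add_cancel]
    rw [ip_add_right, h (y - z)] at h1
    simpa using h1
  have h2 := norm_sq_eq (A := A) (y - z)
  rw [h0, norm_zero] at h2
  have : ‖y - z‖ = 0 := by simpa using h2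
  exact sub_eq_zero.mp (norm_eq_zero.mp this)

theorem ip_add_left (x y z : E) : (ip (x + y) z : A) = ip x z + ip y z := by
  rw [← star_ip, ip_add_right, star_add, star_ip, star_ip]

theorem ip_smul_left (c : ℂ) (x y : E) : (ip (c • x) y : A) = star c • ip x y := by
  rw [← star_ip, ip_smul_right, star_smul, star_ip]

variable (A E) in
/-- The algebra `B(E)` of bounded module maps: the operators on `E` that have an adjoint with
respect to the `A`-valued inner product. -/
def adjointable : Subalgebra ℂ (E →L[ℂ] E) where
  carrier := {T | ∃ S : E →L[ℂ] E, ∀ x y, (ip (T x) y : A) = ip x (S y)}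
  mul_mem' := by
    rintro T T' ⟨S, hS⟩ ⟨S', hS'⟩
    exact ⟨S' * S, fun x y => by simp [hS, hS']⟩
  add_mem' := by
    rintro T T' ⟨S, hS⟩ ⟨S', hS'⟩
    exact ⟨S + S', fun x y => by simp [ip_add_left, ip_add_right, hS, hS']⟩
  algebraMap_mem' c := ⟨star c • 1, fun x y => by
    simp [Algebra.algebraMap_eq_smul_one, ip_smul_left, ip_smul_right]⟩

/-- The adjoint of an adjointable operator. -/
instance : Star (adjointable A E) where
  star T := ⟨T.2.choose, T.1, fun x y => by
    rw [← star_ip, ← T.2.choose_spec y x, star_ip]⟩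

theorem ip_star_right (T : adjointable A E) (x y : E) :
    (ip (T.1 x) y : A) = ip x ((star T).1 y) := T.2.choose_spec x y

theorem eq_star_of_ip {T S : adjointable A E} (h : ∀ x y, (ip (T.1 x) y : A) = ip x (S.1 y)) :
    star T = S := by
  apply Subtype.ext
  ext y
  exact ext_ip (A := A) fun x => by rw [← ip_star_right, h]

instance : StarRing (adjointable A E) where
  star_involutive T := eq_star_of_ip fun x y => by
    rw [← star_ip, ← ip_star_right, star_ip]
  star_mul T S := eq_star_of_ip fun x y => by
    simp [ip_star_right]
  star_add T S := eq_star_of_ip fun x y => by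
    simp [ip_star_right, ip_add_left, ip_add_right]

instance : StarModule ℂ (adjointable A E) where
  star_smul c T := eq_star_of_ip fun x y => by
    simp [ip_star_right, ip_smul_left, ip_smul_right]

variable (A E) in
/-- The compact module maps `K(E)`: the closed linear span in `B(E)` of the rank one operators
`θ_{x,y}`, where `θ_{x,y}(z) = x⟪y, z⟫`. -/
def compacts : Set (adjointable A E) :=
  closure (Submodule.span ℂ
    {T : adjointable A E | ∃ x y : E, ∀ z : E, T.1 z = ract x (ip y z : A)} : Set (adjointable A E))

end HilbertModule

/-! ### Fibre bundles with a groupoid action -/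

section Bundles

variable {m k d z : ℕ} {M : Type uM} {G : Type uG} {X : Type uX} {Z : Type uZ}
  [TopologicalSpace M] [ChartedSpace (EuclideanSpace ℝ (Fin m)) M]
  [TopologicalSpace G] [ChartedSpace (EuclideanSpace ℝ (Fin k)) G]
  [TopologicalSpace X] [ChartedSpace (EuclideanSpace ℝ (Fin d)) X]
  [TopologicalSpace Z] [ChartedSpace (EuclideanSpace ℝ (Fin z)) Z]

/-- A `G`-manifold `(X, p)` that is a smooth fibre bundle over the unit space with fibre `Z`.
The product `act g x` is only meaningful if `s g = p x`. -/
structure GFibreBundle (𝒢 : LieGroupoid m k M G) (d z : ℕ) (X : Type uX) (Z : Type uZ)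
    [TopologicalSpace X] [ChartedSpace (EuclideanSpace ℝ (Fin d)) X]
    [TopologicalSpace Z] [ChartedSpace (EuclideanSpace ℝ (Fin z)) Z] where
  p : X → M
  act : G → X → X
  surjective_p : Function.Surjective p
  submersion_p : Manifold.IsSubmersion (𝓡 d) (𝓡 m) ∞ p
  p_act : ∀ g x, 𝒢.s g = p x → p (act g x) = 𝒢.r g
  act_act : ∀ h g x, 𝒢.s h = 𝒢.r g → 𝒢.s g = p x → act h (act g x) = act (𝒢.mul h g) x
  inv_act : ∀ g x, 𝒢.s g = p x → act (𝒢.inv g) (act g x) = x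
  smooth_act : ContMDiffOn ((𝓡 k).prod (𝓡 d)) (𝓡 d) ∞ (fun q : G × X => act q.1 q.2)
    {q | 𝒢.s q.1 = p q.2}
  /-- near each unit, `X` is diffeomorphic over the unit space to a product with `Z` -/
  locally_trivial : ∀ u : M, ∃ U : Set M, IsOpen U ∧ u ∈ U ∧
    ∃ τ : OpenPartialHomeomorph X (M × Z), τ.source = p ⁻¹' U ∧ τ.target = U ×ˢ univ ∧
      (∀ x ∈ τ.source, (τ x).1 = p x) ∧
      ContMDiffOn (𝓡 d) ((𝓡 m).prod (𝓡 z)) ∞ τ τ.source ∧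
      ContMDiffOn ((𝓡 m).prod (𝓡 z)) (𝓡 d) ∞ τ.symm τ.target

variable {𝒢 : LieGroupoid m k M G}

/-- The diffeomorphism `ℓ_g : X^u → X^v`, `x ↦ g x`, of an arrow `g` from `u` to `v`. -/
def GFibreBundle.actFib (𝒳 : GFibreBundle 𝒢 d z X Z) (g : G) {u v : M} (hs : 𝒢.s g = u)
    (hr : 𝒢.r g = v) (x : Fib 𝒳.p u) : Fib 𝒳.p v :=
  ⟨𝒳.act g x.1, (𝒳.p_act g x.1 (hs.trans x.2.symm)).trans hr⟩

/-- A `G`-invariant continuous family of measures `μ^u` with full support on the fibres `X^u`. -/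
structure InvariantMeasures [MeasurableSpace X] (𝒳 : GFibreBundle 𝒢 d z X Z) where
  meas : ∀ u, Measure (Fib 𝒳.p u)
  isContinuous : IsContinuousFibreSystem 𝒳.p meas
  invariant : ∀ (g : G) (f : Fib 𝒳.p (𝒢.r g) → ℂ), Continuous f → HasCompactSupport f →
    ∫ x, f (𝒳.actFib g rfl rfl x) ∂(meas (𝒢.s g)) = ∫ y, f y ∂(meas (𝒢.r g))

variable {F : Type uF} [NormedAddCommGroup F] [NormedSpace ℂ F]
  {E : X → Type uE} [∀ x, NormedAddCommGroup (E x)] [∀ x, InnerProductSpace ℂ (E x)]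
  [TopologicalSpace (TotalSpace F E)] [FiberBundle F E]

/-- The structure of a `G`-equivariant hermitian bundle on a smooth complex vector bundle `E` over
the `G`-manifold `X`: the fibrewise hermitian metrics (carried by the instances on the fibres
`E x`) vary continuously, and an arrow `g` acts by linear isometries `E x → E (g x)`, compatibly
with products and inverses and smoothly on the total space.
In `eact g x y`, the point `y` has to be `g x`. -/
structure GHermitianBundle (𝒳 : GFibreBundle 𝒢 d z X Z) (F : Type uF) [NormedAddCommGroup F]
    [NormedSpace ℂ F] (E : X → Type uE) [∀ x, NormedAddCommGroup (E x)]
    [∀ x, InnerProductSpace ℂ (E x)] [TopologicalSpace (TotalSpace F E)] [FiberBundle F E] where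
  continuous_metric : Continuous fun v : TotalSpace F E => ‖v.2‖
  eact : ∀ (g : G) (x y : X), 𝒢.s g = 𝒳.p x → 𝒳.act g x = y → E x →ₗᵢ[ℂ] E y
  eact_eact : ∀ (h g : G) (x y w : X) (hg : 𝒢.s g = 𝒳.p x) (hx : 𝒳.act g x = y)
    (hh : 𝒢.s h = 𝒳.p y) (hy : 𝒳.act h y = w) (hhg : 𝒢.s (𝒢.mul h g) = 𝒳.p x)
    (hw : 𝒳.act (𝒢.mul h g) x = w) (v : E x),
    eact h y w hh hy (eact g x y hg hx v) = eact (𝒢.mul h g) x w hhg hw v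
  eact_inv : ∀ (g : G) (x y : X) (hg : 𝒢.s g = 𝒳.p x) (hx : 𝒳.act g x = y)
    (hg' : 𝒢.s (𝒢.inv g) = 𝒳.p y) (hy : 𝒳.act (𝒢.inv g) y = x) (v : E x),
    eact (𝒢.inv g) y x hg' hy (eact g x y hg hx v) = v
  smooth_eact : ∃ Ψ : G × TotalSpace F E → TotalSpace F E,
    (∀ (g : G) (x : X) (hg : 𝒢.s g = 𝒳.p x) (v : E x),
      Ψ (g, ⟨x, v⟩) = ⟨𝒳.act g x, eact g x (𝒳.act g x) hg rfl v⟩) ∧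
    ContMDiffOn ((𝓡 k).prod ((𝓡 d).prod 𝓘(ℝ, F))) ((𝓡 d).prod 𝓘(ℝ, F)) ∞ Ψ
      {q | 𝒢.s q.1 = 𝒳.p q.2.proj}

/-! ### Continuous sections -/

section Sections

variable [VectorBundle ℂ F E]

theorem continuous_section_add {Y : Type*} [TopologicalSpace Y] {b : Y → X} {f h : ∀ y, E (b y)}
    (hf : Continuous fun y => (⟨b y, f y⟩ : TotalSpace F E))
    (hh : Continuous fun y => (⟨b y, h y⟩ : TotalSpace F E)) :
    Continuous fun y => (⟨b y, f y + h y⟩ : TotalSpace F E) := by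
  rw [continuous_iff_continuousAt] at *
  intro y
  have hf := (FiberBundle.continuousAt_totalSpace F _).1 (hf y)
  have hh := (FiberBundle.continuousAt_totalSpace F _).1 (hh y)
  refine (FiberBundle.continuousAt_totalSpace F _).2 ⟨hf.1, ?_⟩
  refine (hf.2.add hh.2).congr ?_
  have hb : ∀ᶠ y' in 𝓝 y, b y' ∈ (trivializationAt F E (b y)).baseSet :=
    hf.1.eventually ((trivializationAt F E (b y)).open_baseSet.mem_nhds
      (FiberBundle.mem_baseSet_trivializationAt' (b y)))
  filter_upwards [hb] with y' hy'
  have := ((trivializationAt F E (b y)).linear ℂ hy').map_add (f y') (h y')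
  exact this.symm

theorem continuous_section_smul {Y : Type*} [TopologicalSpace Y] {b : Y → X} {c : Y → ℂ}
    {f : ∀ y, E (b y)} (hc : Continuous c)
    (hf : Continuous fun y => (⟨b y, f y⟩ : TotalSpace F E)) :
    Continuous fun y => (⟨b y, c y • f y⟩ : TotalSpace F E) := by
  rw [continuous_iff_continuousAt] at *
  intro y
  have hf := (FiberBundle.continuousAt_totalSpace F _).1 (hf y)
  refine (FiberBundle.continuousAt_totalSpace F _).2 ⟨hf.1, ?_⟩
  refine ((hc y).smul hf.2).congr ?_
  have hb : ∀ᶠ y' in 𝓝 y, b y' ∈ (trivializationAt F E (b y)).baseSet :=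
    hf.1.eventually ((trivializationAt F E (b y)).open_baseSet.mem_nhds
      (FiberBundle.mem_baseSet_trivializationAt' (b y)))
  filter_upwards [hb] with y' hy'
  have := ((trivializationAt F E (b y)).linear ℂ hy').map_smul (c y') (f y')
  exact this.symm

theorem continuous_section_zero {Y : Type*} [TopologicalSpace Y] {b : Y → X} (hb : Continuous b) :
    Continuous fun y => (⟨b y, 0⟩ : TotalSpace F E) := by
  rw [continuous_iff_continuousAt]
  intro y
  refine (FiberBundle.continuousAt_totalSpace F _).2 ⟨hb.continuousAt, ?_⟩
  refine (continuousAt_const (y := (0 : F))).congr ?_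
  have hb : ∀ᶠ y' in 𝓝 y, b y' ∈ (trivializationAt F E (b y)).baseSet :=
    hb.continuousAt.eventually ((trivializationAt F E (b y)).open_baseSet.mem_nhds
      (FiberBundle.mem_baseSet_trivializationAt' (b y)))
  filter_upwards [hb] with y' hy'
  have := ((trivializationAt F E (b y)).linear ℂ hy').map_smul 0 (0 : E (b y'))
  simpa using this.symm

theorem GHermitianBundle.continuous_norm {𝒳 : GFibreBundle 𝒢 d z X Z}
    (ℰ : GHermitianBundle 𝒳 F E) {Y : Type*} [TopologicalSpace Y] {b : Y → X} {f : ∀ y, E (b y)}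
    (hf : Continuous fun y => (⟨b y, f y⟩ : TotalSpace F E)) : Continuous fun y => ‖f y‖ :=
  ℰ.continuous_metric.comp hf

theorem GHermitianBundle.continuous_inner {𝒳 : GFibreBundle 𝒢 d z X Z}
    (ℰ : GHermitianBundle 𝒳 F E) {Y : Type*} [TopologicalSpace Y] {b : Y → X} {f h : ∀ y, E (b y)}
    (hf : Continuous fun y => (⟨b y, f y⟩ : TotalSpace F E))
    (hh : Continuous fun y => (⟨b y, h y⟩ : TotalSpace F E)) :
    Continuous fun y => (inner ℂ (f y) (h y) : ℂ) := by
  simp_rw [inner_eq_sum_norm_sq_div_four (𝕜 := ℂ)]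
  have hI := continuous_section_smul (c := fun _ => (RCLike.I : ℂ)) continuous_const hh
  have hneg : ∀ {e : ∀ y, E (b y)}, (Continuous fun y => (⟨b y, e y⟩ : TotalSpace F E)) →
      Continuous fun y => (⟨b y, f y - e y⟩ : TotalSpace F E) := by
    intro e he
    have := continuous_section_add hf
      (continuous_section_smul (c := fun _ => (-1 : ℂ)) continuous_const he)
    simpa [sub_eq_add_neg] using this
  have h1 := RCLike.continuous_ofReal (K := ℂ) |>.comp
    (ℰ.continuous_norm (continuous_section_add hf hh))
  have h2 := RCLike.continuous_ofReal (K := ℂ) |>.comp (ℰ.continuous_norm (hneg hh))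
  have h3 := RCLike.continuous_ofReal (K := ℂ) |>.comp (ℰ.continuous_norm (hneg hI))
  have h4 := RCLike.continuous_ofReal (K := ℂ) |>.comp
    (ℰ.continuous_norm (continuous_section_add hf hI))
  simp only [Function.comp_def] at h1 h2 h3 h4
  fun_prop

/-- The space `C(X^u, E)` of continuous sections of `E` over the fibre `X^u`. -/
def GHermitianBundle.contSec {𝒳 : GFibreBundle 𝒢 d z X Z} (_ : GHermitianBundle 𝒳 F E) (u : M) :
    Submodule ℂ (∀ x : Fib 𝒳.p u, E x.1) where
  carrier := {f : ∀ x : Fib 𝒳.p u, E x.1 | Continuous fun x => (⟨x.1, f x⟩ : TotalSpace F E)}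
  add_mem' {f h} hf hh := by exact continuous_section_add (b := Subtype.val) (f := f) (h := h) hf hh
  zero_mem' := by exact continuous_section_zero continuous_subtype_val
  smul_mem' c f hf := by
    exact continuous_section_smul (b := Subtype.val) (f := f) continuous_const hf

/-- The space `C_c(X, E)` of continuous sections of `E` over `X` with compact support. -/
def GHermitianBundle.ccSec {𝒳 : GFibreBundle 𝒢 d z X Z} (_ : GHermitianBundle 𝒳 F E) :
    Submodule ℂ (∀ x : X, E x) where
  carrier := {f | (Continuous fun x => (⟨x, f x⟩ : TotalSpace F E)) ∧
    ∃ K : Set X, IsCompact K ∧ ∀ x ∉ K, f x = 0}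
  add_mem' := by
    rintro f h ⟨hf, K, hK, hfK⟩ ⟨hh, L, hL, hhL⟩
    refine ⟨continuous_section_add hf hh, K ∪ L, hK.union hL, fun x hx => ?_⟩
    rw [Pi.add_apply, hfK x fun h => hx (Or.inl h), hhL x fun h => hx (Or.inr h), add_zero]
  zero_mem' := ⟨continuous_section_zero continuous_id, ∅, isCompact_empty, fun _ _ => rfl⟩
  smul_mem' := by
    rintro c f ⟨hf, K, hK, hfK⟩
    refine ⟨continuous_section_smul continuous_const hf, K, hK, fun x hx => ?_⟩
    rw [Pi.smul_apply, hfK x hx, smul_zero]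

instance GFibreBundle.compactSpace_fib [CompactSpace Z] (𝒳 : GFibreBundle 𝒢 d z X Z) (u : M) :
    CompactSpace (Fib 𝒳.p u) := by
  obtain ⟨U, -, hu, τ, hsrc, htgt, hfst, -, -⟩ := 𝒳.locally_trivial u
  refine isCompact_iff_compactSpace (s := {y : X | 𝒳.p y = u}).1 ?_
  have hK : IsCompact (({u} : Set M) ×ˢ (univ : Set Z)) := isCompact_singleton.prod isCompact_univ
  have hsub : ({u} : Set M) ×ˢ (univ : Set Z) ⊆ τ.target := by
    rw [htgt]
    rintro ⟨a, b⟩ ⟨ha, -⟩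
    exact ⟨by rw [mem_singleton_iff.1 ha]; exact hu, mem_univ _⟩
  have := hK.image_of_continuousOn (τ.continuousOn_symm.mono hsub)
  convert this using 1
  ext x
  constructor
  · intro hx
    have hxs : x ∈ τ.source := by rw [hsrc]; simpa [hx.symm] using (show 𝒳.p x ∈ U from hx ▸ hu)
    exact ⟨τ x, ⟨by rw [mem_singleton_iff, hfst x hxs]; exact hx, mem_univ _⟩, τ.left_inv hxs⟩
  · rintro ⟨⟨a, b⟩, hab, rfl⟩
    have hs := τ.map_target (hsub hab)
    change 𝒳.p _ = u
    rw [← hfst _ hs, τ.right_inv (hsub hab)]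
    exact mem_singleton_iff.1 hab.1

/-! ### The Hilbert bundle -/

variable [CompactSpace Z] [MeasurableSpace X] [BorelSpace X] {𝒳 : GFibreBundle 𝒢 d z X Z}

/-- `C(X^u, E)`, to be equipped with the `L²` inner product `∫ ⟪f x, h x⟫ dμ^u(x)`. -/
def PreL2 (ℰ : GHermitianBundle 𝒳 F E) (_ : InvariantMeasures 𝒳) (u : M) : Type _ := ℰ.contSec u

namespace PreL2

variable {ℰ : GHermitianBundle 𝒳 F E} {μ : InvariantMeasures 𝒳} {u : M}

instance : AddCommGroup (PreL2 ℰ μ u) := inferInstanceAs (AddCommGroup (ℰ.contSec u))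
instance : Module ℂ (PreL2 ℰ μ u) := inferInstanceAs (Module ℂ (ℰ.contSec u))

/-- The section underlying an element of `PreL2`. -/
def val (f : PreL2 ℰ μ u) (x : Fib 𝒳.p u) : E x.1 := (show ℰ.contSec u from f).1 x

/-- The element of `PreL2` given by a continuous section. -/
def mk (ℰ : GHermitianBundle 𝒳 F E) (μ : InvariantMeasures 𝒳) {u : M}
    (f : ∀ x : Fib 𝒳.p u, E x.1) (hf : Continuous fun x => (⟨x.1, f x⟩ : TotalSpace F E)) :
    PreL2 ℰ μ u := (⟨f, hf⟩ : ℰ.contSec u)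

theorem continuous_val (f : PreL2 ℰ μ u) :
    Continuous fun x => (⟨x.1, f.val x⟩ : TotalSpace F E) := (show ℰ.contSec u from f).2

theorem val_mk (f : ∀ x : Fib 𝒳.p u, E x.1)
    (hf : Continuous fun x => (⟨x.1, f x⟩ : TotalSpace F E)) : (mk ℰ μ f hf).val = f := rfl

theorem val_ext {f h : PreL2 ℰ μ u} (H : ∀ x, f.val x = h.val x) : f = h :=
  Subtype.ext (funext H)

theorem val_add (f h : PreL2 ℰ μ u) (x : Fib 𝒳.p u) : (f + h).val x = f.val x + h.val x := rfl

theorem val_sub (f h : PreL2 ℰ μ u) (x : Fib 𝒳.p u) : (f - h).val x = f.val x - h.val x := rfl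

theorem val_smul (c : ℂ) (f : PreL2 ℰ μ u) (x : Fib 𝒳.p u) : (c • f).val x = c • f.val x := rfl

theorem continuous_inner (f h : PreL2 ℰ μ u) :
    Continuous fun x => (inner ℂ (f.val x) (h.val x) : ℂ) :=
  ℰ.continuous_inner f.continuous_val h.continuous_val

theorem integrable_inner (f h : PreL2 ℰ μ u) :
    Integrable (fun x => (inner ℂ (f.val x) (h.val x) : ℂ)) (μ.meas u) := by
  have := μ.isContinuous.regular u
  exact (continuous_inner f h).integrable_of_hasCompactSupport
    (HasCompactSupport.of_compactSpace _)

instance core : PreInnerProductSpace.Core ℂ (PreL2 ℰ μ u) where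
  inner f h := ∫ x, (inner ℂ (f.val x) (h.val x) : ℂ) ∂(μ.meas u)
  conj_inner_symm f h := by
    rw [← integral_conj]
    simp
  re_inner_nonneg f := by
    have h := integral_re (integrable_inner f f)
    change 0 ≤ RCLike.re (∫ x, (inner ℂ (f.val x) (f.val x) : ℂ) ∂(μ.meas u))
    rw [← h]
    exact integral_nonneg fun x => inner_self_nonneg
  add_left f g h := by
    rw [← integral_add (integrable_inner f h) (integrable_inner g h)]
    exact integral_congr_ae (ae_of_all _ fun x => inner_add_left _ _ _)
  smul_left f h c := by
    rw [← integral_const_mul]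
    exact integral_congr_ae (ae_of_all _ fun x => inner_smul_left _ _ _)

instance : SeminormedAddCommGroup (PreL2 ℰ μ u) :=
  InnerProductSpace.Core.toSeminormedAddCommGroup (𝕜 := ℂ)

instance : InnerProductSpace ℂ (PreL2 ℰ μ u) := InnerProductSpace.ofCore core

theorem inner_def (f h : PreL2 ℰ μ u) :
    (inner ℂ f h : ℂ) = ∫ x, (inner ℂ (f.val x) (h.val x) : ℂ) ∂(μ.meas u) := rfl

theorem norm_sq_eq (f : PreL2 ℰ μ u) :
    ((‖f‖ ^ 2 : ℝ) : ℂ) = ∫ x, ((‖f.val x‖ ^ 2 : ℝ) : ℂ) ∂(μ.meas u) := by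
  have h := inner_self_eq_norm_sq_to_K (𝕜 := ℂ) f
  rw [inner_def] at h
  push_cast
  rw [show ((‖f‖ : ℂ)) ^ 2 = ((‖f‖ : ℝ) : ℂ) ^ 2 from rfl]
  refine h.symm.trans (integral_congr_ae (ae_of_all _ fun x => ?_))
  exact inner_self_eq_norm_sq_to_K (𝕜 := ℂ) _

end PreL2

theorem LieGroupoid.inv_inv (𝒢 : LieGroupoid m k M G) (g : G) : 𝒢.inv (𝒢.inv g) = g := by
  have h1 := 𝒢.mul_assoc (𝒢.inv (𝒢.inv g)) (𝒢.inv g) g (by rw [𝒢.s_inv]) (by rw [𝒢.s_inv])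
  rw [𝒢.inv_mul, 𝒢.inv_mul, 𝒢.s_inv, 𝒢.unit_mul] at h1
  have h2 := 𝒢.mul_unit (𝒢.inv (𝒢.inv g))
  rw [𝒢.s_inv, 𝒢.r_inv] at h2
  exact h2.symm.trans h1.symm

theorem GFibreBundle.unit_act (𝒳 : GFibreBundle 𝒢 d z X Z) (x : X) :
    𝒳.act (𝒢.unit (𝒳.p x)) x = x := by
  have h0 : 𝒢.s (𝒢.unit (𝒳.p x)) = 𝒳.p x := 𝒢.s_unit _
  have h1 : 𝒳.p (𝒳.act (𝒢.unit (𝒳.p x)) x) = 𝒳.p x := by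
    rw [𝒳.p_act _ _ h0, 𝒢.r_unit]
  have h2 : 𝒳.act (𝒢.unit (𝒳.p x)) (𝒳.act (𝒢.unit (𝒳.p x)) x) = 𝒳.act (𝒢.unit (𝒳.p x)) x := by
    rw [𝒳.act_act _ _ _ (by rw [𝒢.s_unit, 𝒢.r_unit]) h0]
    congr 1
    conv_lhs => rw [← 𝒢.r_unit (𝒳.p x)]
    rw [𝒢.r_unit]
    nth_rewrite 1 [← 𝒢.r_unit (𝒳.p x)]
    exact 𝒢.unit_mul _
  have h3 := 𝒳.inv_act (𝒢.unit (𝒳.p x)) (𝒳.act (𝒢.unit (𝒳.p x)) x) (h0.trans h1.symm)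
  rw [h2, 𝒳.inv_act _ _ h0] at h3
  exact h3.symm

theorem GFibreBundle.act_inv_act (𝒳 : GFibreBundle 𝒢 d z X Z) (g : G) (x : X)
    (h : 𝒢.r g = 𝒳.p x) : 𝒳.act g (𝒳.act (𝒢.inv g) x) = x := by
  rw [𝒳.act_act _ _ _ (𝒢.r_inv g).symm ((𝒢.s_inv g).trans h), 𝒢.mul_inv, h, 𝒳.unit_act]

variable {ℰ : GHermitianBundle 𝒳 F E} {μ : InvariantMeasures 𝒳}

theorem PreL2.s_eq (𝒳 : GFibreBundle 𝒢 d z X Z) {u v : M} (g : G) (hs : 𝒢.s g = u)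
    (hr : 𝒢.r g = v) (y : Fib 𝒳.p v) :
    𝒢.s g = 𝒳.p (𝒳.actFib (𝒢.inv g) ((𝒢.s_inv g).trans hr) ((𝒢.r_inv g).trans hs) y).1 :=
  hs.trans (𝒳.actFib (𝒢.inv g) ((𝒢.s_inv g).trans hr) ((𝒢.r_inv g).trans hs) y).2.symm

theorem PreL2.act_eq (𝒳 : GFibreBundle 𝒢 d z X Z) {u v : M} (g : G) (hs : 𝒢.s g = u)
    (hr : 𝒢.r g = v) (y : Fib 𝒳.p v) :
    𝒳.act g (𝒳.actFib (𝒢.inv g) ((𝒢.s_inv g).trans hr) ((𝒢.r_inv g).trans hs) y).1 = y.1 :=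
  𝒳.act_inv_act g y.1 (hr.trans y.2.symm)

/-- The translate `L_g f (y) = g (f (g⁻¹ y))` of a section `f` over `X^u` by an arrow `g` from `u`
to `v`. -/
def PreL2.translFun {u v : M} (g : G) (hs : 𝒢.s g = u) (hr : 𝒢.r g = v) (f : PreL2 ℰ μ u)
    (y : Fib 𝒳.p v) : E y.1 :=
  ℰ.eact g _ y.1 (PreL2.s_eq 𝒳 g hs hr y) (PreL2.act_eq 𝒳 g hs hr y)
    (f.val (𝒳.actFib (𝒢.inv g) ((𝒢.s_inv g).trans hr) ((𝒢.r_inv g).trans hs) y))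

theorem GFibreBundle.continuous_actFib (𝒳 : GFibreBundle 𝒢 d z X Z) (g : G) {u v : M}
    (hs : 𝒢.s g = u) (hr : 𝒢.r g = v) : Continuous (𝒳.actFib g hs hr) := by
  refine Continuous.subtype_mk ?_ _
  have := 𝒳.smooth_act.continuousOn.comp_continuous
    (f := fun x : Fib 𝒳.p u => (g, x.1)) (by fun_prop) (fun x => hs.trans x.2.symm)
  exact this

theorem PreL2.continuous_translFun {u v : M} (g : G) (hs : 𝒢.s g = u) (hr : 𝒢.r g = v)
    (f : PreL2 ℰ μ u) :
    Continuous fun y => (⟨y.1, translFun g hs hr f y⟩ : TotalSpace F E) := by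
  obtain ⟨Ψ, hΨ, hc⟩ := ℰ.smooth_eact
  have hf : Continuous fun x : Fib 𝒳.p u => (⟨x.1, f.val x⟩ : TotalSpace F E) := f.continuous_val
  have ha := 𝒳.continuous_actFib (𝒢.inv g) ((𝒢.s_inv g).trans hr) ((𝒢.r_inv g).trans hs)
  have := hc.continuousOn.comp_continuous
    (f := fun y : Fib 𝒳.p v => (g, (⟨_, f.val (𝒳.actFib (𝒢.inv g) ((𝒢.s_inv g).trans hr)
      ((𝒢.r_inv g).trans hs) y)⟩ : TotalSpace F E)))
    (continuous_const.prodMk (hf.comp ha)) (fun y => PreL2.s_eq 𝒳 g hs hr y)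
  refine this.congr fun y => ?_
  refine (hΨ g _ (PreL2.s_eq 𝒳 g hs hr y) _).trans ?_
  have key : ∀ (x y' : X) (h1 : 𝒢.s g = 𝒳.p x) (h2 : 𝒳.act g x = y') (v : E x),
      (⟨𝒳.act g x, ℰ.eact g x (𝒳.act g x) h1 rfl v⟩ : TotalSpace F E) =
        ⟨y', ℰ.eact g x y' h1 h2 v⟩ := by
    rintro x _ h1 rfl v
    rfl
  exact key _ _ _ (PreL2.act_eq 𝒳 g hs hr y) _

/-- Translation by an arrow `g` from `u` to `v`, on continuous sections. -/
def PreL2.transl {u v : M} (g : G) (hs : 𝒢.s g = u) (hr : 𝒢.r g = v) :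
    PreL2 ℰ μ u →ₗ[ℂ] PreL2 ℰ μ v where
  toFun f := mk ℰ μ (translFun g hs hr f) (continuous_translFun g hs hr f)
  map_add' _ _ := val_ext fun _ => map_add _ _ _
  map_smul' _ _ := val_ext fun _ => map_smul _ _ _

theorem PreL2.transl_actFib {u v : M} (g : G) (hs : 𝒢.s g = u) (hr : 𝒢.r g = v) (f : PreL2 ℰ μ u)
    (x : Fib 𝒳.p u) : ‖(transl g hs hr f).val (𝒳.actFib g hs hr x)‖ = ‖f.val x‖ := by
  change ‖ℰ.eact g _ _ _ _ _‖ = _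
  rw [LinearIsometry.norm_map]
  have h : ∀ x' : Fib 𝒳.p u, x' = x → ‖f.val x'‖ = ‖f.val x‖ := by
    rintro _ rfl
    rfl
  exact h _ (Subtype.ext (𝒳.inv_act g x.1 (hs.trans x.2.symm)))

theorem PreL2.norm_transl {u v : M} (g : G) (hs : 𝒢.s g = u) (hr : 𝒢.r g = v) (f : PreL2 ℰ μ u) :
    ‖transl g hs hr f‖ = ‖f‖ := by
  subst hs hr
  have h : ((‖transl g rfl rfl f‖ ^ 2 : ℝ) : ℂ) = ((‖f‖ ^ 2 : ℝ) : ℂ) := by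
    rw [norm_sq_eq, norm_sq_eq,
      ← μ.invariant g (fun y => ((‖(transl g rfl rfl f).val y‖ ^ 2 : ℝ) : ℂ))]
    · simp_rw [transl_actFib]
    · have h1 := ℰ.continuous_norm (transl g rfl rfl f).continuous_val
      exact Complex.continuous_ofReal.comp (h1.pow 2)
    · exact HasCompactSupport.of_compactSpace _
  have h' := Complex.ofReal_injective h
  exact (pow_left_inj₀ (norm_nonneg _) (norm_nonneg _) two_ne_zero).1 h'

theorem PreL2.transl_transl {u v : M} (g : G) (hs : 𝒢.s g = u) (hr : 𝒢.r g = v) (f : PreL2 ℰ μ u) :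
    transl (𝒢.inv g) ((𝒢.s_inv g).trans hr) ((𝒢.r_inv g).trans hs) (transl g hs hr f) = f := by
  refine val_ext fun x => ?_
  have key : ∀ (w : X) (hwv : 𝒳.p w = v)
      (h1 : 𝒢.s (𝒢.inv g) = 𝒳.p w) (h2 : 𝒳.act (𝒢.inv g) w = x.1),
      ℰ.eact (𝒢.inv g) w x.1 h1 h2 (translFun g hs hr f ⟨w, hwv⟩) = f.val x := by
    intro w hwv h1 h2
    have hx : 𝒳.actFib (𝒢.inv g) ((𝒢.s_inv g).trans hr) ((𝒢.r_inv g).trans hs) ⟨w, hwv⟩ = x :=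
      Subtype.ext h2
    have : ∀ (x' : Fib 𝒳.p u) (hx' : x' = x) (h3 : 𝒢.s g = 𝒳.p x'.1) (h4 : 𝒳.act g x'.1 = w),
        ℰ.eact (𝒢.inv g) w x.1 h1 h2 (ℰ.eact g x'.1 w h3 h4 (f.val x')) = f.val x := by
      rintro _ rfl h3 h4
      exact ℰ.eact_inv _ _ _ _ _ _ _ _
    exact this _ hx _ _
  exact key _ _ _ _

/-- The Hilbert space `𝔥^u = L²(X^u, E, μ^u)`: the completion of the continuous sections of `E` over
the compact fibre `X^u` for the `L²` inner product. -/
abbrev L2Fibre (ℰ : GHermitianBundle 𝒳 F E) (μ : InvariantMeasures 𝒳) (u : M) : Type _ :=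
  UniformSpace.Completion (PreL2 ℰ μ u)

/-- The unitary `L_g : 𝔥^u → 𝔥^v` of an arrow `g` from `u` to `v`. -/
def L2Fibre.transl (ℰ : GHermitianBundle 𝒳 F E) (μ : InvariantMeasures 𝒳) {u v : M} (g : G)
    (hs : 𝒢.s g = u) (hr : 𝒢.r g = v) : L2Fibre ℰ μ u →L[ℂ] L2Fibre ℰ μ v :=
  (UniformSpace.Completion.toComplL.comp
    (LinearIsometry.toContinuousLinearMap
      ⟨PreL2.transl (ℰ := ℰ) (μ := μ) g hs hr, PreL2.norm_transl g hs hr⟩)).extend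
    (UniformSpace.Completion.toComplL (𝕜 := ℂ))

theorem L2Fibre.transl_coe {u v : M} (g : G) (hs : 𝒢.s g = u) (hr : 𝒢.r g = v) (f : PreL2 ℰ μ u) :
    L2Fibre.transl ℰ μ g hs hr (f : L2Fibre ℰ μ u) = (PreL2.transl g hs hr f : PreL2 ℰ μ v) :=
  ContinuousLinearMap.extend_eq _ UniformSpace.Completion.denseRange_coe
    (UniformSpace.Completion.isUniformInducing_coe _) f

theorem L2Fibre.norm_transl {u v : M} (g : G) (hs : 𝒢.s g = u) (hr : 𝒢.r g = v)
    (ξ : L2Fibre ℰ μ u) : ‖L2Fibre.transl ℰ μ g hs hr ξ‖ = ‖ξ‖ := by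
  induction ξ using UniformSpace.Completion.induction_on with
  | hp => exact isClosed_eq (by fun_prop) (by fun_prop)
  | ih f =>
    rw [transl_coe, UniformSpace.Completion.norm_coe, UniformSpace.Completion.norm_coe,
      PreL2.norm_transl]

theorem L2Fibre.transl_transl {u v : M} (g : G) (hs : 𝒢.s g = u) (hr : 𝒢.r g = v)
    (ξ : L2Fibre ℰ μ u) : L2Fibre.transl ℰ μ (𝒢.inv g) ((𝒢.s_inv g).trans hr)
      ((𝒢.r_inv g).trans hs) (L2Fibre.transl ℰ μ g hs hr ξ) = ξ := by
  induction ξ using UniformSpace.Completion.induction_on with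
  | hp => exact isClosed_eq (by fun_prop) (by fun_prop)
  | ih f => rw [transl_coe, transl_coe, PreL2.transl_transl]

theorem L2Fibre.inner_transl {u v : M} (g : G) (hs : 𝒢.s g = u) (hr : 𝒢.r g = v)
    (ξ η : L2Fibre ℰ μ u) :
    (inner ℂ (L2Fibre.transl ℰ μ g hs hr ξ) (L2Fibre.transl ℰ μ g hs hr η) : ℂ) = inner ℂ ξ η :=
  LinearIsometry.inner_map_map
    (⟨(L2Fibre.transl ℰ μ g hs hr).toLinearMap, L2Fibre.norm_transl g hs hr⟩ :
      L2Fibre ℰ μ u →ₗᵢ[ℂ] L2Fibre ℰ μ v) ξ η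

/-! ### Sections with compact support are dense in the fibres -/

section Density

variable [T2Space X] [SecondCountableTopology X] [FiniteDimensional ℂ F]

theorem continuous_localSection (e : Trivialization F (TotalSpace.proj : TotalSpace F E → X))
    [MemTrivializationAtlas e] (χ : C(X, ℝ)) (hχ : tsupport χ ⊆ e.baseSet) (H : C(X, F)) :
    Continuous fun x => (⟨x, (χ x : ℂ) • e.symmL ℂ x (H x)⟩ : TotalSpace F E) := by
  rw [continuous_iff_continuousAt]
  intro x
  by_cases hx : x ∈ e.baseSet
  · have h0 : Continuous fun y : e.baseSet => (⟨y.1, e.symmL ℂ y.1 (H y.1)⟩ : TotalSpace F E) := by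
      have h1 := e.continuousOn_symm.comp_continuous (f := fun y : e.baseSet => (y.1, H y.1))
        (by fun_prop) fun y => ⟨y.2, mem_univ _⟩
      refine h1.congr fun y => ?_
      rw [Trivialization.symmL_apply _ y.2]
      rfl
    have h2 := continuous_section_smul (c := fun y : e.baseSet => (χ y.1 : ℂ)) (by fun_prop) h0
    have h3 : ContinuousOn (fun x => (⟨x, (χ x : ℂ) • e.symmL ℂ x (H x)⟩ : TotalSpace F E))
        e.baseSet := continuousOn_iff_continuous_domRestrict.2 h2
    exact h3.continuousAt (e.open_baseSet.mem_nhds hx)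
  · have hx' : x ∉ tsupport χ := fun h => hx (hχ h)
    have h0 : ∀ᶠ y in 𝓝 x, y ∉ tsupport χ := (isClosed_tsupport χ).isOpen_compl.mem_nhds hx'
    refine (continuous_section_zero (F := F) (E := E) continuous_id).continuousAt.congr ?_
    filter_upwards [h0] with y hy
    have : χ y = 0 := image_eq_zero_of_notMem_tsupport hy
    simp [this]

/-- The restriction of a section with compact support to a fibre. -/
def GHermitianBundle.restr (ℰ : GHermitianBundle 𝒳 F E) (μ : InvariantMeasures 𝒳) (f : ℰ.ccSec)
    (u : M) : PreL2 ℰ μ u :=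
  PreL2.mk ℰ μ (fun x => f.1 x.1) (f.2.1.comp continuous_subtype_val)

/-- A continuous section of `E` over the compact fibre `X^u` extends to a section over `X` with
compact support. -/
theorem GHermitianBundle.exists_restr_eq [T2Space M] {u : M} (f : PreL2 ℰ μ u) :
    ∃ h : ℰ.ccSec, ℰ.restr μ h u = f := by
  classical
  have : LocallyCompactSpace X := ChartedSpace.locallyCompactSpace (EuclideanSpace ℝ (Fin d)) X
  have : NormalSpace X := inferInstance
  have hp : Continuous 𝒳.p := 𝒳.submersion_p.contMDiff.continuous
  have hcl : IsClosed {x : X | 𝒳.p x = u} := isClosed_singleton.preimage hp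
  have hcpt : IsCompact {x : X | 𝒳.p x = u} :=
    isCompact_iff_compactSpace.2 (𝒳.compactSpace_fib u)
  obtain ⟨t, ht⟩ := hcpt.elim_finite_subcover (fun i : X => (trivializationAt F E i).baseSet)
    (fun i => (trivializationAt F E i).open_baseSet)
    (fun x _ => mem_iUnion.2 ⟨x, FiberBundle.mem_baseSet_trivializationAt' x⟩)
  obtain ⟨χ, hχ, hχc⟩ := PartitionOfUnity.exists_isSubordinate_of_locallyFinite_t2space hcpt
    (fun i : t => (trivializationAt F E i.1).baseSet)
    (fun i => (trivializationAt F E i.1).open_baseSet) (locallyFinite_of_finite _)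
    (by simpa [iUnion_subtype] using ht)
  let g : t → C(X, ℝ) := fun i => ⟨fun x => √(χ i x), by fun_prop⟩
  have hgs : ∀ i, tsupport (g i) ⊆ tsupport (χ i) := fun i =>
    closure_mono fun x hx hx0 => hx (by simp [g, hx0])
  have hg : ∀ i, tsupport (g i) ⊆ (trivializationAt F E i.1).baseSet := fun i =>
    (hgs i).trans (hχ i)
  have hsq : ∀ i x, ((g i x : ℝ) : ℂ) * (g i x : ℝ) = ((χ i x : ℝ) : ℂ) := fun i x => by
    rw [← Complex.ofReal_mul]
    congr 1
    exact Real.mul_self_sqrt (χ.nonneg i x)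
  have hloc : ∀ i, Continuous fun x : Fib 𝒳.p u =>
      (g i x.1 : ℂ) • (trivializationAt F E i.1).continuousLinearMapAt ℂ x.1 (f.val x) := by
    intro i
    rw [continuous_iff_continuousAt]
    intro x
    by_cases hx : x.1 ∈ (trivializationAt F E i.1).baseSet
    · have h1 : ContinuousAt (fun x : Fib 𝒳.p u =>
          ((trivializationAt F E i.1) (⟨x.1, f.val x⟩ : TotalSpace F E)).2) x := by
        have h2 := ((trivializationAt F E i.1).continuousAt (x := (⟨x.1, f.val x⟩ : TotalSpace F E))
          ((trivializationAt F E i.1).mem_source.2 hx)).snd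
        exact ContinuousAt.comp (f := fun x : Fib 𝒳.p u => (⟨x.1, f.val x⟩ : TotalSpace F E))
          h2 f.continuous_val.continuousAt
      have h3 : ContinuousAt (fun x : Fib 𝒳.p u => (g i x.1 : ℂ)) x := by fun_prop
      refine (h3.smul h1).congr ?_
      have : ∀ᶠ y : Fib 𝒳.p u in 𝓝 x, y.1 ∈ (trivializationAt F E i.1).baseSet :=
        continuous_subtype_val.continuousAt.eventually
          ((trivializationAt F E i.1).open_baseSet.mem_nhds hx)
      filter_upwards [this] with y hy
      rw [Trivialization.continuousLinearMapAt_apply, Trivialization.linearMapAt_apply, if_pos hy]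
      rfl
    · have hx' : x.1 ∉ tsupport (g i) := fun h => hx (hg i h)
      have h0 : ∀ᶠ y : Fib 𝒳.p u in 𝓝 x, y.1 ∉ tsupport (g i) :=
        continuous_subtype_val.continuousAt.eventually
          ((isClosed_tsupport (g i)).isOpen_compl.mem_nhds hx')
      refine (continuousAt_const (y := (0 : F))).congr ?_
      filter_upwards [h0] with y hy
      rw [image_eq_zero_of_notMem_tsupport hy]
      simp
  have hext : ∀ i, ∃ H : C(X, F), ∀ x : Fib 𝒳.p u, H x.1 =
      (g i x.1 : ℂ) • (trivializationAt F E i.1).continuousLinearMapAt ℂ x.1 (f.val x) := by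
    intro i
    obtain ⟨H, hH⟩ := ContinuousMap.exists_extension' (Y := F)
      (e := (Subtype.val : Fib 𝒳.p u → X)) hcl.isClosedEmbedding_subtypeVal ⟨_, hloc i⟩
    exact ⟨H, fun x => congrFun hH x⟩
  choose H hH using hext
  let sec : t → ℰ.ccSec := fun i =>
    ⟨fun x => (g i x : ℂ) • (trivializationAt F E i.1).symmL ℂ x (H i x),
      continuous_localSection _ (g i) (hg i) (H i), tsupport (χ i), hχc i, fun x hx => by
        have h0 : g i x = 0 := image_eq_zero_of_notMem_tsupport fun h => hx (hgs i h)
        simp [h0]⟩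
  refine ⟨∑ i, sec i, PreL2.val_ext fun x => ?_⟩
  have hval : (ℰ.restr μ (∑ i, sec i) u).val x = ∑ i, (sec i).1 x.1 := by
    change ((∑ i, sec i : ℰ.ccSec) : ∀ x : X, E x) x.1 = _
    rw [Submodule.coe_sum, Finset.sum_apply]
  rw [hval]
  have hterm : ∀ i, (sec i).1 x.1 = ((χ i x.1 : ℝ) : ℂ) • f.val x := by
    intro i
    change (g i x.1 : ℂ) • (trivializationAt F E i.1).symmL ℂ x.1 (H i x.1) = _
    rw [hH i x, map_smul, smul_smul, hsq]
    by_cases hx : x.1 ∈ (trivializationAt F E i.1).baseSet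
    · rw [Trivialization.symmL_continuousLinearMapAt _ hx]
    · have : χ i x.1 = 0 := image_eq_zero_of_notMem_tsupport fun h => hx (hχ i h)
      simp [this]
  simp_rw [hterm]
  rw [← Finset.sum_smul, ← Complex.ofReal_sum, ← finsum_eq_sum_of_fintype,
    χ.sum_eq_one (show x.1 ∈ {x : X | 𝒳.p x = u} from x.2), Complex.ofReal_one, one_smul]

/-- The section `u ↦ f|_{X^u}` of `𝔥` defined by a section `f` of `E` with compact support. -/
def GHermitianBundle.field (ℰ : GHermitianBundle 𝒳 F E) (μ : InvariantMeasures 𝒳) (f : ℰ.ccSec)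
    (u : M) : L2Fibre ℰ μ u := (ℰ.restr μ f u : PreL2 ℰ μ u)

theorem GHermitianBundle.field_sub (f h : ℰ.ccSec) (u : M) :
    ℰ.field μ (f - h) u = ℰ.field μ f u - ℰ.field μ h u :=
  UniformSpace.Completion.coe_sub (ℰ.restr μ f u) (ℰ.restr μ h u)

theorem GHermitianBundle.field_add (f h : ℰ.ccSec) (u : M) :
    ℰ.field μ (f + h) u = ℰ.field μ f u + ℰ.field μ h u :=
  UniformSpace.Completion.coe_add (ℰ.restr μ f u) (ℰ.restr μ h u)

theorem GHermitianBundle.field_smul (c : ℂ) (f : ℰ.ccSec) (u : M) :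
    ℰ.field μ (c • f) u = c • ℰ.field μ f u :=
  UniformSpace.Completion.coe_smul c (ℰ.restr μ f u)

theorem GHermitianBundle.exists_field_near [T2Space M] {u : M} (ξ : L2Fibre ℰ μ u) {ε : ℝ}
    (hε : 0 < ε) : ∃ f : ℰ.ccSec, ‖ξ - ℰ.field μ f u‖ < ε := by
  obtain ⟨f, hf⟩ := UniformSpace.Completion.denseRange_coe.exists_dist_lt ξ hε
  obtain ⟨h, rfl⟩ := ℰ.exists_restr_eq f
  exact ⟨h, by rwa [← dist_eq_norm]⟩

theorem GHermitianBundle.continuous_norm_field (f : ℰ.ccSec) :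
    Continuous fun u => ‖ℰ.field μ f u‖ := by
  have hF : Continuous fun x => ((‖f.1 x‖ ^ 2 : ℝ) : ℂ) :=
    Complex.continuous_ofReal.comp ((ℰ.continuous_norm (b := id) f.2.1).pow 2)
  have hc : HasCompactSupport fun x => ((‖f.1 x‖ ^ 2 : ℝ) : ℂ) := by
    obtain ⟨K, hK, hfK⟩ := f.2.2
    refine HasCompactSupport.intro hK fun x hx => ?_
    simp [hfK x hx]
  have h := μ.isContinuous.continuous_integral _ hF hc
  have h1 : ∀ u, ∫ x : Fib 𝒳.p u, ((‖f.1 x.1‖ ^ 2 : ℝ) : ℂ) ∂(μ.meas u) =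
      ((‖ℰ.field μ f u‖ ^ 2 : ℝ) : ℂ) := fun u => by
    rw [field, UniformSpace.Completion.norm_coe, PreL2.norm_sq_eq]
    rfl
  simp_rw [h1] at h
  have h2 := (Complex.continuous_re.comp h).sqrt
  refine h2.congr fun u => ?_
  simp only [Function.comp, Complex.ofReal_re]
  exact Real.sqrt_sq (norm_nonneg _)

/-! ### The topology of the Hilbert bundle -/

/-- The total space of the Hilbert bundle `𝔥`. -/
structure L2Bundle (ℰ : GHermitianBundle 𝒳 F E) (μ : InvariantMeasures 𝒳) where
  base : M
  vec : L2Fibre ℰ μ base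

/-- The topology of the total space of `𝔥`: it is generated by the tubes
`{ξ ∈ 𝔥^u | u ∈ U, ‖ξ - f|_{X^u}‖ < ε}` of radius `ε` around the sections `f ∈ C_c(X, E)` over open
sets `U` of units. -/
instance (ℰ : GHermitianBundle 𝒳 F E) (μ : InvariantMeasures 𝒳) :
    TopologicalSpace (L2Bundle ℰ μ) :=
  TopologicalSpace.generateFrom {S | ∃ (f : ℰ.ccSec) (U : Set M) (ε : ℝ), IsOpen U ∧
    S = {ξ | ξ.base ∈ U ∧ ‖ξ.vec - ℰ.field μ f ξ.base‖ < ε}}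

namespace L2Bundle

variable [T2Space M]

theorem isOpen_tube (f : ℰ.ccSec) {U : Set M} (hU : IsOpen U) (ε : ℝ) :
    IsOpen {ξ : L2Bundle ℰ μ | ξ.base ∈ U ∧ ‖ξ.vec - ℰ.field μ f ξ.base‖ < ε} :=
  TopologicalSpace.isOpen_generateFrom_of_mem ⟨f, U, ε, hU, rfl⟩

theorem continuous_base : Continuous (base : L2Bundle ℰ μ → M) := by
  refine continuous_def.2 fun U hU => ?_
  have : base ⁻¹' U = ⋃ n : ℕ, {ξ : L2Bundle ℰ μ | ξ.base ∈ U ∧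
      ‖ξ.vec - ℰ.field μ 0 ξ.base‖ < n} := by
    ext ξ
    simp only [mem_preimage, mem_iUnion, mem_ofPred_eq, exists_and_left, iff_self_and]
    exact fun _ => exists_nat_gt _
  rw [this]
  exact isOpen_iUnion fun n => isOpen_tube 0 hU n

theorem continuous_of_approx {Y : Type*} [TopologicalSpace Y] {b : Y → M}
    {v : ∀ y, L2Fibre ℰ μ (b y)} (hb : Continuous b)
    (h : ∀ y₀, ∀ ε > 0, ∃ f : ℰ.ccSec, ∀ᶠ y in 𝓝 y₀, ‖v y - ℰ.field μ f (b y)‖ < ε) :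
    Continuous fun y => (⟨b y, v y⟩ : L2Bundle ℰ μ) := by
  refine continuous_generateFrom_iff.2 ?_
  rintro _ ⟨f, U, ε, hU, rfl⟩
  refine isOpen_iff_mem_nhds.2 fun y₀ ⟨hy₀, hlt⟩ => ?_
  simp only at hy₀ hlt
  obtain ⟨e, he⟩ := h y₀ ((ε - ‖v y₀ - ℰ.field μ f (b y₀)‖) / 3) (by linarith)
  have hc : Continuous fun y => ‖ℰ.field μ (e - f) (b y)‖ :=
    (ℰ.continuous_norm_field (e - f)).comp hb
  have h0 := he.self_of_nhds
  have h1 : ‖ℰ.field μ (e - f) (b y₀)‖ <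
      ‖v y₀ - ℰ.field μ f (b y₀)‖ + (ε - ‖v y₀ - ℰ.field μ f (b y₀)‖) / 3 * 2 := by
    rw [ℰ.field_sub]
    have := norm_add_le (ℰ.field μ e (b y₀) - v y₀) (v y₀ - ℰ.field μ f (b y₀))
    rw [sub_add_sub_cancel, norm_sub_rev _ (v y₀)] at this
    linarith
  filter_upwards [he, hc.continuousAt.eventually_lt continuousAt_const h1,
    hb.continuousAt.eventually (hU.mem_nhds hy₀)] with y h2 h3 h4
  refine ⟨h4, ?_⟩
  change ‖v y - ℰ.field μ f (b y)‖ < ε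
  have := norm_add_le (v y - ℰ.field μ e (b y)) (ℰ.field μ e (b y) - ℰ.field μ f (b y))
  rw [sub_add_sub_cancel, ← ℰ.field_sub] at this
  linarith

theorem exists_approx {Y : Type*} [TopologicalSpace Y] {b : Y → M}
    {v : ∀ y, L2Fibre ℰ μ (b y)} (h : Continuous fun y => (⟨b y, v y⟩ : L2Bundle ℰ μ))
    (y₀ : Y) {ε : ℝ} (hε : 0 < ε) :
    ∃ f : ℰ.ccSec, ∀ᶠ y in 𝓝 y₀, ‖v y - ℰ.field μ f (b y)‖ < ε := by
  obtain ⟨f, hf⟩ := ℰ.exists_field_near (v y₀) hε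
  refine ⟨f, ?_⟩
  have ho := (isOpen_tube (ℰ := ℰ) (μ := μ) f isOpen_univ ε).preimage h
  exact Filter.mem_of_superset (ho.mem_nhds (x := y₀) ⟨mem_univ (b y₀), hf⟩) fun y hy => hy.2

theorem continuous_field (f : ℰ.ccSec) :
    Continuous fun u => (⟨u, ℰ.field μ f u⟩ : L2Bundle ℰ μ) :=
  continuous_of_approx continuous_id fun u ε hε =>
    ⟨f, Filter.Eventually.of_forall fun u => by simpa using hε⟩

theorem continuous_add {Y : Type*} [TopologicalSpace Y] {b : Y → M}
    {v w : ∀ y, L2Fibre ℰ μ (b y)} (hv : Continuous fun y => (⟨b y, v y⟩ : L2Bundle ℰ μ))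
    (hw : Continuous fun y => (⟨b y, w y⟩ : L2Bundle ℰ μ)) :
    Continuous fun y => (⟨b y, v y + w y⟩ : L2Bundle ℰ μ) := by
  refine continuous_of_approx (continuous_base.comp hv) fun y₀ ε hε => ?_
  obtain ⟨f, hf⟩ := exists_approx hv y₀ (half_pos hε)
  obtain ⟨h, hh⟩ := exists_approx hw y₀ (half_pos hε)
  refine ⟨f + h, ?_⟩
  filter_upwards [hf, hh] with y h1 h2
  rw [ℰ.field_add, add_sub_add_comm]
  exact (norm_add_le _ _).trans_lt (by linarith)

theorem continuous_smul (c : ℂ) {Y : Type*} [TopologicalSpace Y] {b : Y → M}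
    {v : ∀ y, L2Fibre ℰ μ (b y)} (hv : Continuous fun y => (⟨b y, v y⟩ : L2Bundle ℰ μ)) :
    Continuous fun y => (⟨b y, c • v y⟩ : L2Bundle ℰ μ) := by
  refine continuous_of_approx (continuous_base.comp hv) fun y₀ ε hε => ?_
  have hc : 0 < ‖c‖ + 1 := by positivity
  obtain ⟨f, hf⟩ := exists_approx hv y₀ (div_pos hε hc)
  refine ⟨c • f, ?_⟩
  filter_upwards [hf] with y h1
  rw [ℰ.field_smul, ← smul_sub, norm_smul]
  rw [lt_div_iff₀ hc] at h1
  have := norm_nonneg (v y - ℰ.field μ f (b y))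
  nlinarith

theorem continuous_zero : Continuous fun u => (⟨u, 0⟩ : L2Bundle ℰ μ) :=
  continuous_of_approx continuous_id fun u ε hε =>
    ⟨0, Filter.Eventually.of_forall fun u => by
      have h := ℰ.field_smul (μ := μ) 0 0 u
      rw [zero_smul, zero_smul] at h
      simp only [h, sub_zero, norm_zero]
      exact hε⟩

end L2Bundle

/-! ### Sections and morphisms of the Hilbert bundle -/

variable [T2Space M]

/-- The space `Γ_c(𝔥) = C_c(G⁰, 𝔥)` of continuous sections of `𝔥` with compact support. -/
def gammaC (ℰ : GHermitianBundle 𝒳 F E) (μ : InvariantMeasures 𝒳) :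
    Submodule ℂ (∀ u : M, L2Fibre ℰ μ u) where
  carrier := {e | (Continuous fun u => (⟨u, e u⟩ : L2Bundle ℰ μ)) ∧
    ∃ K : Set M, IsCompact K ∧ ∀ u ∉ K, e u = 0}
  add_mem' := by
    rintro f h ⟨hf, K, hK, hfK⟩ ⟨hh, L, hL, hhL⟩
    refine ⟨L2Bundle.continuous_add hf hh, K ∪ L, hK.union hL, fun x hx => ?_⟩
    rw [Pi.add_apply, hfK x fun h => hx (Or.inl h), hhL x fun h => hx (Or.inr h), add_zero]
  zero_mem' := ⟨L2Bundle.continuous_zero, ∅, isCompact_empty, fun _ _ => rfl⟩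
  smul_mem' := by
    rintro c f ⟨hf, K, hK, hfK⟩
    refine ⟨L2Bundle.continuous_smul c hf, K, hK, fun x hx => ?_⟩
    rw [Pi.smul_apply, hfK x hx, smul_zero]

/-- The element `u ↦ f|_{X^u}` of `Γ_c(𝔥)` defined by `f ∈ C_c(X, E)`. -/
def GHermitianBundle.toGammaC (ℰ : GHermitianBundle 𝒳 F E) (μ : InvariantMeasures 𝒳)
    (f : ℰ.ccSec) : gammaC ℰ μ :=
  ⟨ℰ.field μ f, L2Bundle.continuous_field f, by
    obtain ⟨K, hK, hfK⟩ := f.2.2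
    have hp : Continuous 𝒳.p := 𝒳.submersion_p.contMDiff.continuous
    refine ⟨𝒳.p '' K, hK.image hp, fun u hu => ?_⟩
    have : ℰ.restr μ f u = 0 := PreL2.val_ext fun x =>
      hfK x.1 fun hx => hu ⟨x.1, hx, x.2⟩
    rw [GHermitianBundle.field, this]
    exact UniformSpace.Completion.coe_zero⟩

/-- A family `T = (T^u)` of bounded operators `T^u` on the fibres of `𝔥` is a *morphism* of `𝔥` if
both `T` and the family `T⋆` of the adjoint operators are continuous maps from `𝔥` to `𝔥`. -/
def IsMorphism (T : ∀ u : M, L2Fibre ℰ μ u →L[ℂ] L2Fibre ℰ μ u) : Prop :=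
  (Continuous fun ξ : L2Bundle ℰ μ => (⟨ξ.base, T ξ.base ξ.vec⟩ : L2Bundle ℰ μ)) ∧
    Continuous fun ξ : L2Bundle ℰ μ => (⟨ξ.base, star (T ξ.base) ξ.vec⟩ : L2Bundle ℰ μ)

/-- A family of operators on the fibres of `𝔥` is *equivariant* if `T^{r(g)} L_g = L_g T^{s(g)}` for
every arrow `g`. -/
def IsEquivariant (T : ∀ u : M, L2Fibre ℰ μ u →L[ℂ] L2Fibre ℰ μ u) : Prop :=
  ∀ (g : G) (ξ : L2Fibre ℰ μ (𝒢.s g)),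
    T (𝒢.r g) (L2Fibre.transl ℰ μ g rfl rfl ξ) = L2Fibre.transl ℰ μ g rfl rfl (T (𝒢.s g) ξ)

theorem IsEquivariant.star {T : ∀ u : M, L2Fibre ℰ μ u →L[ℂ] L2Fibre ℰ μ u}
    (hT : IsEquivariant T) : IsEquivariant (star T) := by
  intro g ξ
  have hsurj : Function.Surjective (L2Fibre.transl ℰ μ g rfl rfl :
      L2Fibre ℰ μ (𝒢.s g) → L2Fibre ℰ μ (𝒢.r g)) := by
    intro ξ
    have h1 : ∀ (g' : G) (hg : g' = g) (hs : 𝒢.s g' = 𝒢.s g) (hr : 𝒢.r g' = 𝒢.r g)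
        (η : L2Fibre ℰ μ (𝒢.s g)), L2Fibre.transl ℰ μ g' hs hr η =
          L2Fibre.transl ℰ μ g rfl rfl η := by
      rintro _ rfl _ _ _
      rfl
    have h2 := L2Fibre.transl_transl (𝒢.inv g) (𝒢.s_inv g) (𝒢.r_inv g) ξ
    rw [h1 _ (𝒢.inv_inv g)] at h2
    exact ⟨_, h2⟩
  refine ext_inner_left ℂ fun η => ?_
  obtain ⟨η, rfl⟩ := hsurj η
  simp only [Pi.star_apply, ContinuousLinearMap.star_eq_adjoint]
  rw [ContinuousLinearMap.adjoint_inner_right, hT, L2Fibre.inner_transl, L2Fibre.inner_transl,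
    ContinuousLinearMap.adjoint_inner_right]

/-- The C⋆-algebra `B_G(𝔥)` of bounded equivariant morphisms of `𝔥`. -/
def boundedMorphisms (ℰ : GHermitianBundle 𝒳 F E) (μ : InvariantMeasures 𝒳) :
    StarSubalgebra ℂ (∀ u : M, L2Fibre ℰ μ u →L[ℂ] L2Fibre ℰ μ u) where
  carrier := {T | IsMorphism T ∧ BddAbove (range fun u => ‖T u‖) ∧ IsEquivariant T}
  mul_mem' := by
    rintro S T ⟨hS, ⟨a, ha⟩, hSe⟩ ⟨hT, ⟨b, hb⟩, hTe⟩
    refine ⟨⟨hS.1.comp hT.1, ?_⟩, ⟨a * b, ?_⟩, ?_⟩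
    · refine (hT.2.comp hS.2).congr fun ξ => ?_
      simp
    · rintro _ ⟨u, rfl⟩
      exact (norm_mul_le _ _).trans (mul_le_mul (ha ⟨u, rfl⟩) (hb ⟨u, rfl⟩) (norm_nonneg _)
        ((norm_nonneg _).trans (ha ⟨u, rfl⟩)))
    · intro g ξ
      simp only [Pi.mul_apply, mul_apply_eq_comp]
      rw [hTe, hSe]
  add_mem' := by
    rintro S T ⟨hS, ⟨a, ha⟩, hSe⟩ ⟨hT, ⟨b, hb⟩, hTe⟩
    refine ⟨⟨L2Bundle.continuous_add hS.1 hT.1, ?_⟩, ⟨a + b, ?_⟩, ?_⟩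
    · refine (L2Bundle.continuous_add hS.2 hT.2).congr fun ξ => ?_
      simp
    · rintro _ ⟨u, rfl⟩
      exact (norm_add_le _ _).trans (add_le_add (ha ⟨u, rfl⟩) (hb ⟨u, rfl⟩))
    · intro g ξ
      simp only [Pi.add_apply, add_apply, map_add]
      rw [hTe, hSe]
  algebraMap_mem' c := by
    refine ⟨⟨?_, ?_⟩, ⟨‖c‖, ?_⟩, ?_⟩
    · exact L2Bundle.continuous_smul c (continuous_id (X := L2Bundle ℰ μ))
    · refine (L2Bundle.continuous_smul (star c) (continuous_id (X := L2Bundle ℰ μ))).congr fun ξ => ?_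
      simp [Algebra.algebraMap_eq_smul_one]
    · rintro _ ⟨u, rfl⟩
      refine ContinuousLinearMap.opNorm_le_bound _ (norm_nonneg _) fun ξ => ?_
      exact (norm_smul c ξ).le
    · intro g ξ
      simp [Algebra.algebraMap_eq_smul_one]
  star_mem' := by
    rintro T ⟨hT, ⟨a, ha⟩, hTe⟩
    refine ⟨⟨hT.2, ?_⟩, ⟨a, ?_⟩, hTe.star⟩
    · simpa using hT.1
    · rintro _ ⟨u, rfl⟩
      exact (norm_star (T u)).le.trans (ha ⟨u, rfl⟩)

/-- The ideal `K_G(𝔥)` of `B_G(𝔥)`: the bounded equivariant morphisms `T` that are compact, i.e. for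
which, for every compact set `A` of units, the images under `T^u`, `u ∈ A`, of the closed unit balls
of `𝔥^u` form together a set with compact closure in `𝔥`. -/
def compactMorphisms (ℰ : GHermitianBundle 𝒳 F E) (μ : InvariantMeasures 𝒳) :
    Set (boundedMorphisms ℰ μ) :=
  {T | ∀ A : Set M, IsCompact A → IsCompact (closure
    {ζ : L2Bundle ℰ μ | ∃ u ∈ A, ∃ ξ : L2Fibre ℰ μ u, ‖ξ‖ ≤ 1 ∧ ζ = ⟨u, T.1 u ξ⟩})}

/-- The action `u ↦ T^u e(u)` of `T ∈ B_G(𝔥)` on sections `e ∈ Γ_c(𝔥)`. -/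
def applySection (T : boundedMorphisms ℰ μ) (e : gammaC ℰ μ) : gammaC ℰ μ :=
  ⟨fun u => T.1 u (e.1 u), T.2.1.1.comp e.2.1, by
    obtain ⟨K, hK, heK⟩ := e.2.2
    refine ⟨K, hK, fun u hu => ?_⟩
    change T.1 u (e.1 u) = 0
    rw [heK u hu, map_zero]⟩

/-! ### The Hilbert module of the Hilbert bundle -/

variable [MeasurableSpace G]

/-- `IsModuleCompletion lam ι` says that the Hilbert `C⋆_red(G)`-module `Γ`, together with the map
`ι : Γ_c(𝔥) → Γ`, is the completion `Γ(𝔥)` of the pre-Hilbert `C_c(G)`-module `Γ_c(𝔥)`, where `C_c(G)`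
is regarded as a subalgebra of `C⋆_red(G)`. -/
structure IsModuleCompletion (lam : HaarSystem 𝒢) {Γ : Type*} [NormedAddCommGroup Γ]
    [NormedSpace ℂ Γ] [CompleteSpace Γ] [HilbertModule lam.CRed Γ]
    (ι : gammaC ℰ μ →ₗ[ℂ] Γ) : Prop where
  dense : DenseRange ι
  /-- the inner product of `e₁, e₂ ∈ Γ_c(𝔥)` is the function `g ↦ ⟪e₁(r g), L_g e₂(s g)⟫`, which
  belongs to `C_c(G)` -/
  inner_eq : ∀ e₁ e₂ : gammaC ℰ μ, ∃ f : C_c(G, ℂ),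
    (∀ g, f g = inner ℂ (e₁.1 (𝒢.r g)) (L2Fibre.transl ℰ μ g rfl rfl (e₂.1 (𝒢.s g)))) ∧
    lam.IsRegularRep f (HilbertModule.ip (ι e₁) (ι e₂) : lam.CRed).1
  /-- the action of `f ∈ C_c(G)` on `e ∈ Γ_c(𝔥)` is the section
  `u ↦ ∫ f(g⁻¹) L_g e(s g) dλ^u(g)`, which belongs to `Γ_c(𝔥)` -/
  act_eq : ∀ (e : gammaC ℰ μ) (f : C_c(G, ℂ)), ∃ a : lam.CRed, lam.IsRegularRep f a.1 ∧
    ∃ e' : gammaC ℰ μ, (∀ u, e'.1 u = ∫ g : Fib 𝒢.r u,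
      f (𝒢.inv g.1) • L2Fibre.transl ℰ μ g.1 rfl g.2 (e.1 (𝒢.s g.1)) ∂(lam.meas u)) ∧
    ι e' = HilbertModule.ract (ι e) a

/-- The integrand `g ↦ ⟪L_g e₂, ξ⟫ L_g e₁`, for `g` in `G^u` and `ξ ∈ 𝔥^u` (the inner product being
linear in the second variable), of the operator
`T(e₁, e₂)^u ξ = ∫ ⟪L_g e₂, ξ⟫ L_g e₁ dλ^u(g)`. -/
def rankOneIntegrand (e₁ e₂ : ℰ.ccSec) (u : M) (ξ : L2Fibre ℰ μ u) (g : Fib 𝒢.r u) :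
    L2Fibre ℰ μ u :=
  (inner ℂ (L2Fibre.transl ℰ μ g.1 rfl g.2 (ℰ.field μ e₂ (𝒢.s g.1))) ξ : ℂ) •
    L2Fibre.transl ℰ μ g.1 rfl g.2 (ℰ.field μ e₁ (𝒢.s g.1))

/-- `IsRankOneMorphism lam e₁ e₂ T` says that `T` is the morphism `T(e₁, e₂)`. -/
def IsRankOneMorphism (lam : HaarSystem 𝒢) (e₁ e₂ : ℰ.ccSec) (T : boundedMorphisms ℰ μ) : Prop :=
  ∀ (u : M) (ξ : L2Fibre ℰ μ u), Integrable (rankOneIntegrand e₁ e₂ u ξ) (lam.meas u) ∧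
    T.1 u ξ = ∫ g, rankOneIntegrand e₁ e₂ u ξ g ∂(lam.meas u)

end Density
end Sections
end Bundles
end EquivariantHilbert

end

open EquivariantHilbert

/-!
# Equivariant morphisms as adjointable operators

The Hilbert module `Γ(𝔥)` is realised by concrete operators. A section `e ∈ Γ_c(𝔥)` defines at each
unit `u` the *analysis operator* `W_u(e) : 𝔥^u → L²(G_u, λ_u)`, which maps `η` to
`k ↦ ⟪L_{k⁻¹} e(r k), η⟫` (a continuous function with compact support, since the groupoid is proper),
and its adjoint, the *synthesis operator* `V_u(e)` (`analysisOp`, `synthesisOp`). These operators are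
uniformly bounded in `u`, because a continuous invariant function on a `G`-compact unit space is
bounded. The invariance of the Haar system gives the identities

* `π_u(⟨e₁, e₂⟩) = V_u(e₁)⋆ V_u(e₂)` (`analysisOp_synthesisOp_isRegular`),
* `V_u(e f) = V_u(e) π_u(f)` for `f ∈ C_c(G)` (`synthesisOp_actSection`),
* `V_u(T e) = T^u V_u(e)` for an equivariant morphism `T` (`synthesisOp_applySection`),
* `T(e₁, e₂)^u = V_u(e₁) V_u(e₂)⋆` (`rankOneOp_apply`).

By the first one, any completion of `Γ_c(𝔥)` is isometric to a closed space of bounded families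
`x = (x_u)` of operators `L²(G_u, λ_u) → 𝔥^u` (`realise`), with inner product `(x_u⋆ y_u)_u` and with
the composition `(x_u a_u)_u` as the action of the reduced algebra. Conversely these formulas make
the completion of `Γ_c(𝔥)` in the norm `sup_u ‖V_u(e)‖` a Hilbert module. The operators `π_u(f)` are
bounded because they are of Hilbert-Schmidt type, again with a norm that is bounded in `u`
(`exists_norm_convOp_le`), and the positivity of `x_u⋆ x_u` in the reduced algebra itself follows from
the functional calculus (`SynthesisSpace.exists_ip_eq`).

In this picture `Φ(T)` is the composition with `T^u` (`IsModuleCompletion.realise_moduleMap`), so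
`‖Φ(T)‖ ≤ sup_u ‖T^u‖`, and `Φ(T(e₁, e₂)) = θ_{e₁, e₂}` is read off from the identities. For the
opposite inequality (`IsModuleCompletion.norm_apply_le_norm_moduleMap`), the powers of `R = T⋆T` grow
on the vectors `x_u ξ` at most like the powers of `‖Φ(T)‖²`; as these vectors span a dense subspace of
`𝔥^u` and `R` is self-adjoint, `‖R^u‖ ≤ ‖Φ(T)‖²` (`norm_le_of_pow_le`).

The operators `T(e₁, e₂)` are compact morphisms (`rankOne_mem_compactMorphisms`) and the image of
`K_G(𝔥)` is closed, so that it contains `K(Γ(𝔥))`. For the other inclusion, let `T` be a compact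
morphism and `c` a cut-off function, with `∫ c(s g) dλ^u(g) = 1`. Over the support of `c`, finitely
many sections `f_i` approximate the images of the unit balls under `T`. The *regularised projections*
`Q = ∑ ((K + δ)⁻¹)_{ij} ⟪f_j, ·⟫ f_i` with the Gram matrix `K` of the `f_i` depend continuously on the
unit and almost fix the vectors `f_i` (`norm_sub_regProj_le_of_near`). The averages
`∫ c(s g) L_g Q L_g⁻¹ T^u dλ^u(g)` are then uniformly close to `T^u`, and they are finite sums of
operators `T(p, q)` (`exists_rankOne_approx`).

Properness and `G`-compactness enter the lemmas as `Fact` instances.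
-/

set_option linter.unusedSectionVars false

noncomputable section

namespace EquivariantHilbert

/-! ### Topology and measures on a Lie groupoid -/

/-- A continuous function with compact support on a closed subspace extends to a continuous
function with compact support. -/
theorem exists_extension_hasCompactSupport {C Y : Type*} [TopologicalSpace C] [TopologicalSpace Y]
    [T2Space Y] [LocallyCompactSpace Y] [NormalSpace Y] {i : C → Y}
    (hi : Topology.IsClosedEmbedding i) {φ : C → ℂ} (hφ : Continuous φ) (hc : HasCompactSupport φ) :
    ∃ Φ : Y → ℂ, Continuous Φ ∧ HasCompactSupport Φ ∧ ∀ x, Φ (i x) = φ x := by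
  obtain ⟨H, hH⟩ := ContinuousMap.exists_extension' (Y := ℂ) (e := i) hi ⟨φ, hφ⟩
  have hK : IsCompact (i '' tsupport φ) := IsCompact.image hc hi.continuous
  obtain ⟨χ, h1, -, hχ, -⟩ :=
    exists_continuous_one_zero_of_isCompact hK isClosed_empty (disjoint_empty _)
  refine ⟨fun y => (χ y : ℂ) * H y, by fun_prop, ?_, fun x => ?_⟩
  · refine HasCompactSupport.mul_right (f := fun y => (χ y : ℂ)) ?_
    exact hχ.comp_left (g := fun t : ℝ => (t : ℂ)) (by simp)
  · have hx : H (i x) = φ x := congrFun hH x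
    by_cases h : x ∈ tsupport φ
    · have := h1 (mem_image_of_mem i h)
      simp only [Pi.one_apply] at this
      simp [this, hx]
    · simp [hx, image_eq_zero_of_notMem_tsupport h]

section GroupoidLemmas

variable {m k : ℕ} {M : Type uM} {G : Type uG}
  [TopologicalSpace M] [ChartedSpace (EuclideanSpace ℝ (Fin m)) M]
  [TopologicalSpace G] [ChartedSpace (EuclideanSpace ℝ (Fin k)) G]

namespace LieGroupoid

variable (𝒢 : LieGroupoid m k M G)

theorem continuous_r : Continuous 𝒢.r := 𝒢.submersion_r.contMDiff.continuous

theorem continuous_s : Continuous 𝒢.s := 𝒢.submersion_s.contMDiff.continuous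

theorem continuous_inv : Continuous 𝒢.inv := 𝒢.smooth_inv.continuous

theorem continuous_mul_of_composable {Y : Type*} [TopologicalSpace Y] {a b : Y → G}
    (ha : Continuous a) (hb : Continuous b) (h : ∀ y, 𝒢.s (a y) = 𝒢.r (b y)) :
    Continuous fun y => 𝒢.mul (a y) (b y) :=
  𝒢.smooth_mul.continuousOn.comp_continuous (f := fun y => (a y, b y)) (ha.prodMk hb) h

theorem inv_mul_cancel_left (g h : G) (hgh : 𝒢.s g = 𝒢.r h) :
    𝒢.mul (𝒢.inv g) (𝒢.mul g h) = h := by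
  rw [← 𝒢.mul_assoc _ _ _ (𝒢.s_inv g) hgh, 𝒢.inv_mul, hgh, 𝒢.unit_mul]

theorem mul_inv_cancel_left (g h : G) (hgh : 𝒢.r g = 𝒢.r h) :
    𝒢.mul g (𝒢.mul (𝒢.inv g) h) = h := by
  rw [← 𝒢.mul_assoc _ _ _ (𝒢.r_inv g).symm ((𝒢.s_inv g).trans hgh), 𝒢.mul_inv, hgh, 𝒢.unit_mul]

theorem eq_inv_of_mul_eq_unit {a b : G} (h : 𝒢.s a = 𝒢.r b) {u : M} (hab : 𝒢.mul a b = 𝒢.unit u) :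
    b = 𝒢.inv a := by
  have h1 := 𝒢.inv_mul_cancel_left a b h
  have hu : u = 𝒢.r a := by rw [← 𝒢.r_unit u, ← hab, 𝒢.r_mul _ _ h]
  rw [← h1, hab, hu, ← 𝒢.s_inv a, 𝒢.mul_unit]

theorem inv_mul_rev (a b : G) (h : 𝒢.s a = 𝒢.r b) :
    𝒢.inv (𝒢.mul a b) = 𝒢.mul (𝒢.inv b) (𝒢.inv a) := by
  symm
  have h1 : 𝒢.s (𝒢.inv b) = 𝒢.r (𝒢.inv a) := by rw [𝒢.s_inv, 𝒢.r_inv, h]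
  refine 𝒢.eq_inv_of_mul_eq_unit (u := 𝒢.r a) ?_ ?_
  · rw [𝒢.s_mul _ _ h, 𝒢.r_mul _ _ h1, 𝒢.r_inv]
  · rw [𝒢.mul_assoc _ _ _ h (by rw [𝒢.r_mul _ _ h1, 𝒢.r_inv]),
      𝒢.mul_inv_cancel_left _ _ (by rw [𝒢.r_inv, h]), 𝒢.mul_inv]

/-- Left multiplication by an arrow `g` from `u` to `v`, a homeomorphism `G^u → G^v`. -/
def leftMul (g : G) {u v : M} (hs : 𝒢.s g = u) (hr : 𝒢.r g = v) : Fib 𝒢.r u ≃ₜ Fib 𝒢.r v where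
  toFun h := ⟨𝒢.mul g h.1, (𝒢.r_mul g h.1 (hs.trans h.2.symm)).trans hr⟩
  invFun h := ⟨𝒢.mul (𝒢.inv g) h.1, (𝒢.r_mul _ h.1 ((𝒢.s_inv g).trans (hr.trans h.2.symm))).trans
    ((𝒢.r_inv g).trans hs)⟩
  left_inv h := Subtype.ext (𝒢.inv_mul_cancel_left g h.1 (hs.trans h.2.symm))
  right_inv h := Subtype.ext (𝒢.mul_inv_cancel_left g h.1 (hr.trans h.2.symm))
  continuous_toFun := Continuous.subtype_mk (𝒢.continuous_mul_of_composable continuous_const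
    continuous_subtype_val fun h => hs.trans h.2.symm) _
  continuous_invFun := Continuous.subtype_mk (𝒢.continuous_mul_of_composable continuous_const
    continuous_subtype_val fun h => (𝒢.s_inv g).trans (hr.trans h.2.symm)) _

theorem leftMul_coe (g : G) {u v : M} (hs : 𝒢.s g = u) (hr : 𝒢.r g = v) (h : Fib 𝒢.r u) :
    (𝒢.leftMul g hs hr h).1 = 𝒢.mul g h.1 := rfl

/-- Inversion, a homeomorphism `G^u → G_u`. -/
def invFib (u : M) : Fib 𝒢.r u ≃ₜ Fib 𝒢.s u where
  toFun g := ⟨𝒢.inv g.1, (𝒢.s_inv g.1).trans g.2⟩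
  invFun g := ⟨𝒢.inv g.1, (𝒢.r_inv g.1).trans g.2⟩
  left_inv g := Subtype.ext (𝒢.inv_inv g.1)
  right_inv g := Subtype.ext (𝒢.inv_inv g.1)
  continuous_toFun := Continuous.subtype_mk (𝒢.continuous_inv.comp continuous_subtype_val) _
  continuous_invFun := Continuous.subtype_mk (𝒢.continuous_inv.comp continuous_subtype_val) _

theorem invFib_coe {u : M} (g : Fib 𝒢.r u) : (𝒢.invFib u g).1 = 𝒢.inv g.1 := rfl

theorem invFib_symm_coe {u : M} (g : Fib 𝒢.s u) : ((𝒢.invFib u).symm g).1 = 𝒢.inv g.1 := rfl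

theorem isClosedEmbedding_fib_r [T2Space M] (u : M) :
    Topology.IsClosedEmbedding (Subtype.val : Fib 𝒢.r u → G) :=
  (isClosed_singleton.preimage 𝒢.continuous_r).isClosedEmbedding_subtypeVal

theorem isClosedEmbedding_fib_s [T2Space M] (u : M) :
    Topology.IsClosedEmbedding (Subtype.val : Fib 𝒢.s u → G) :=
  (isClosed_singleton.preimage 𝒢.continuous_s).isClosedEmbedding_subtypeVal

end LieGroupoid

variable [MeasurableSpace G] [BorelSpace G] {𝒢 : LieGroupoid m k M G}
  [T2Space M] [T2Space G] [SecondCountableTopology G] [LocallyCompactSpace G]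
  [LocallyCompactSpace M] (lam : HaarSystem 𝒢)

instance HaarSystem.locallyCompactSpace_fib_r (𝒢 : LieGroupoid m k M G) (u : M) :
    LocallyCompactSpace (Fib 𝒢.r u) :=
  (𝒢.isClosedEmbedding_fib_r u).locallyCompactSpace

instance HaarSystem.locallyCompactSpace_fib_s (𝒢 : LieGroupoid m k M G) (u : M) :
    LocallyCompactSpace (Fib 𝒢.s u) :=
  (𝒢.isClosedEmbedding_fib_s u).locallyCompactSpace

instance HaarSystem.regular_meas (u : M) : (lam.meas u).Regular := lam.isContinuous.regular u

instance HaarSystem.isOpenPosMeasure_meas (u : M) : (lam.meas u).IsOpenPosMeasure :=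
  lam.isContinuous.full_support u

theorem HaarSystem.measSource_eq (u : M) : lam.measSource u = (lam.meas u).map (𝒢.invFib u) := rfl

instance HaarSystem.regular_measSource (u : M) : (lam.measSource u).Regular := by
  rw [lam.measSource_eq]
  exact Measure.Regular.map (𝒢.invFib u)

theorem HaarSystem.integral_measSource {V : Type*} [NormedAddCommGroup V] [NormedSpace ℝ V] {u : M}
    (F : Fib 𝒢.s u → V) :
    ∫ g, F g ∂(lam.measSource u) = ∫ g, F (𝒢.invFib u g) ∂(lam.meas u) := by
  rw [lam.measSource_eq]
  exact (𝒢.invFib u).measurableEmbedding.integral_map F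

/-- Left invariance of the Haar system as an identity of measures. -/
theorem HaarSystem.map_leftMul (g : G) {u v : M} (hs : 𝒢.s g = u) (hr : 𝒢.r g = v) :
    (lam.meas u).map (𝒢.leftMul g hs hr) = lam.meas v := by
  subst hs hr
  have : ((lam.meas (𝒢.s g)).map (𝒢.leftMul g rfl rfl)).Regular :=
    Measure.Regular.map (𝒢.leftMul g rfl rfl)
  refine Measure.ext_of_integral_eq_on_compactlySupported fun f => ?_
  rw [(𝒢.leftMul g rfl rfl).measurableEmbedding.integral_map]
  obtain ⟨Φ, hΦ, hΦc, hΦf⟩ := exists_extension_hasCompactSupport (𝒢.isClosedEmbedding_fib_r (𝒢.r g))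
    (φ := fun h => (f h : ℂ)) (by fun_prop)
    (f.hasCompactSupport.comp_left (g := fun t : ℝ => (t : ℂ)) (by simp))
  have h := lam.left_invariant g Φ hΦ hΦc
  have h1 : ∀ h : Fib 𝒢.r (𝒢.s g), Φ (𝒢.mul g h.1) = (f (𝒢.leftMul g rfl rfl h) : ℂ) := fun h =>
    hΦf (𝒢.leftMul g rfl rfl h)
  simp_rw [h1, hΦf, integral_complex_ofReal] at h
  exact_mod_cast h

theorem HaarSystem.integral_leftMul {V : Type*} [NormedAddCommGroup V] [NormedSpace ℝ V]
    (g : G) {u v : M} (hs : 𝒢.s g = u) (hr : 𝒢.r g = v) (F : Fib 𝒢.r v → V) :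
    ∫ h, F (𝒢.leftMul g hs hr h) ∂(lam.meas u) = ∫ h, F h ∂(lam.meas v) := by
  rw [← lam.map_leftMul g hs hr]
  exact ((𝒢.leftMul g hs hr).measurableEmbedding.integral_map F).symm

/-- The convolution in terms of the fibre over the source of the argument. -/
theorem HaarSystem.conv_inv (f ξ : G → ℂ) {u : M} (l : Fib 𝒢.r u) :
    lam.conv f ξ (𝒢.inv l.1) =
      ∫ h : Fib 𝒢.r u, f (𝒢.mul (𝒢.inv l.1) h.1) * ξ (𝒢.inv h.1) ∂(lam.meas u) := by
  rw [HaarSystem.conv, ← lam.integral_leftMul (𝒢.inv l.1) ((𝒢.s_inv l.1).trans l.2) rfl]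
  refine integral_congr_ae (ae_of_all _ fun h => ?_)
  have hl : 𝒢.s (𝒢.inv l.1) = 𝒢.r h.1 := ((𝒢.s_inv l.1).trans l.2).trans h.2.symm
  have key : 𝒢.mul (𝒢.inv (𝒢.mul (𝒢.inv l.1) h.1)) (𝒢.inv l.1) = 𝒢.inv h.1 := by
    have hu : 𝒢.unit (𝒢.s (𝒢.inv l.1)) = 𝒢.unit (𝒢.s (𝒢.inv h.1)) := by
      rw [hl, 𝒢.s_inv]
    rw [𝒢.inv_mul_rev _ _ hl, 𝒢.mul_assoc, 𝒢.inv_mul, hu, 𝒢.mul_unit]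
    · rw [𝒢.s_inv, hl.symm, 𝒢.r_inv]
    · rw [𝒢.s_inv]
  simp only [LieGroupoid.leftMul_coe, key]

/-- Restrictions of functions in `C_c(G)` are dense in `L²(G_u, λ_u)`. -/
theorem HaarSystem.exists_restrict_near (u : M) (η : Lp ℂ 2 (lam.measSource u)) {ε : ℝ}
    (hε : 0 < ε) : ∃ (ξ : C_c(G, ℂ)) (ζ : Lp ℂ 2 (lam.measSource u)),
      (ζ : Fib 𝒢.s u → ℂ) =ᵐ[lam.measSource u] (fun g => ξ g.1) ∧ ‖η - ζ‖ < ε := by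
  obtain ⟨φ, hφc, hφ, hcont, hmem⟩ := (Lp.memLp η).exists_hasCompactSupport_eLpNorm_sub_le
    (by simp) (ε := ENNReal.ofReal (ε / 2)) (by simpa using hε)
  obtain ⟨Φ, hΦ, hΦc, hΦφ⟩ := exists_extension_hasCompactSupport (𝒢.isClosedEmbedding_fib_s u)
    hcont hφc
  refine ⟨⟨⟨Φ, hΦ⟩, hΦc⟩, hmem.toLp φ, ?_, ?_⟩
  · filter_upwards [hmem.coeFn_toLp] with g hg
    rw [hg]
    exact (hΦφ g).symm
  · rw [Lp.norm_def]
    have : eLpNorm (⇑(η - hmem.toLp φ)) 2 (lam.measSource u) = eLpNorm (⇑η - φ) 2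
        (lam.measSource u) := by
      refine eLpNorm_congr_ae ?_
      filter_upwards [Lp.coeFn_sub η (hmem.toLp φ), hmem.coeFn_toLp] with g h1 h2
      rw [h1, Pi.sub_apply, h2, Pi.sub_apply]
    rw [this]
    refine (ENNReal.toReal_mono (by simp) hφ).trans_lt ?_
    rw [ENNReal.toReal_ofReal (by positivity)]
    linarith

end GroupoidLemmas

/-! ### Fibre integrals and the cut-off function -/

section Cutoff

variable {m k : ℕ} {M : Type uM} {G : Type uG}
  [TopologicalSpace M] [ChartedSpace (EuclideanSpace ℝ (Fin m)) M]
  [TopologicalSpace G] [ChartedSpace (EuclideanSpace ℝ (Fin k)) G]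

/-- A set of arrows is *fibrewise compact* if its part over each compact set of units (with respect
to the range map) is relatively compact. -/
def LieGroupoid.IsFibrewiseCompact (𝒢 : LieGroupoid m k M G) (S : Set G) : Prop :=
  ∀ A : Set M, IsCompact A → ∃ K : Set G, IsCompact K ∧ S ∩ 𝒢.r ⁻¹' A ⊆ K

variable {𝒢 : LieGroupoid m k M G}

theorem LieGroupoid.IsProper.isFibrewiseCompact (h : 𝒢.IsProper) {B : Set M} (hB : IsCompact B) :
    𝒢.IsFibrewiseCompact (𝒢.s ⁻¹' B) := fun A hA =>
  ⟨_, h (A ×ˢ B) (hA.prod hB), fun _ hg => ⟨hg.2, hg.1⟩⟩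

theorem LieGroupoid.isFibrewiseCompact_of_isCompact (𝒢 : LieGroupoid m k M G) {K : Set G}
    (hK : IsCompact K) : 𝒢.IsFibrewiseCompact K := fun _ _ => ⟨K, hK, inter_subset_left⟩

variable [MeasurableSpace G] [BorelSpace G]
  [T2Space M] [T2Space G] [SecondCountableTopology G] [LocallyCompactSpace G]
  [LocallyCompactSpace M] (lam : HaarSystem 𝒢)

theorem LieGroupoid.IsFibrewiseCompact.hasCompactSupport_fib {S : Set G}
    (hS : 𝒢.IsFibrewiseCompact S) (u : M) {V : Type*} [Zero V] {φ : Fib 𝒢.r u → V}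
    (h : ∀ g : Fib 𝒢.r u, g.1 ∉ S → φ g = 0) : HasCompactSupport φ := by
  obtain ⟨K, hK, hSK⟩ := hS {u} isCompact_singleton
  exact HasCompactSupport.intro ((𝒢.isClosedEmbedding_fib_r u).isCompact_preimage hK)
    fun g hg => h g fun hg' => hg (hSK ⟨hg', g.2⟩)

/-- Fibre integrals of continuous functions with fibrewise compact support are continuous. -/
theorem HaarSystem.continuous_integral {φ : G → ℂ} (hφ : Continuous φ) {S : Set G}
    (hS : 𝒢.IsFibrewiseCompact S) (h0 : ∀ g ∉ S, φ g = 0) :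
    Continuous fun u => ∫ g : Fib 𝒢.r u, φ g ∂(lam.meas u) := by
  rw [continuous_iff_continuousAt]
  intro u₀
  obtain ⟨A, hA, hAu⟩ := exists_compact_mem_nhds u₀
  obtain ⟨χ, h1, -, hχ, -⟩ :=
    exists_continuous_one_zero_of_isCompact hA isClosed_empty (disjoint_empty _)
  have hr := 𝒢.continuous_r
  obtain ⟨K, hK, hSK⟩ := hS (tsupport χ) hχ
  have hc := lam.isContinuous.continuous_integral (fun g => (χ (𝒢.r g) : ℂ) * φ g) (by fun_prop)
    (HasCompactSupport.intro hK fun g hg => by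
      by_cases hg' : g ∈ S
      · have : χ (𝒢.r g) = 0 := image_eq_zero_of_notMem_tsupport fun h => hg (hSK ⟨hg', h⟩)
        simp [this]
      · simp [h0 g hg'])
  refine hc.continuousAt.congr ?_
  filter_upwards [hAu] with u hu
  refine integral_congr_ae (ae_of_all _ fun g => ?_)
  have : χ (𝒢.r g) = 1 := by rw [g.2]; exact h1 hu
  simp [this]

theorem HaarSystem.continuous_integral_real {φ : G → ℝ} (hφ : Continuous φ) {S : Set G}
    (hS : 𝒢.IsFibrewiseCompact S) (h0 : ∀ g ∉ S, φ g = 0) :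
    Continuous fun u => ∫ g : Fib 𝒢.r u, φ g ∂(lam.meas u) := by
  have h := lam.continuous_integral (φ := fun g => (φ g : ℂ)) (by fun_prop) hS
    (fun g hg => by simp [h0 g hg])
  simp_rw [integral_complex_ofReal] at h
  exact Complex.continuous_re.comp h

theorem HaarSystem.integral_pos {u : M} {φ : Fib 𝒢.r u → ℝ} (hφ : Continuous φ)
    (hc : HasCompactSupport φ) (h0 : ∀ g, 0 ≤ φ g) {g : Fib 𝒢.r u} (hg : φ g ≠ 0) :
    0 < ∫ g, φ g ∂(lam.meas u) :=
  hφ.integral_pos_of_hasCompactSupport_nonneg_nonzero hc h0 hg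

/-- The range map is open, since the measures of a Haar system have full support. -/
theorem HaarSystem.isOpenMap_r (lam : HaarSystem 𝒢) : IsOpenMap 𝒢.r := by
  intro U hU
  refine isOpen_iff_mem_nhds.2 ?_
  rintro _ ⟨g₀, hg₀, rfl⟩
  obtain ⟨f, h1, hfU, hf, hf01⟩ := exists_continuous_one_zero_of_isCompact
    (isCompact_singleton (x := g₀)) hU.isClosed_compl (by simpa using hg₀)
  have hc := lam.continuous_integral_real f.continuous (𝒢.isFibrewiseCompact_of_isCompact hf)
    fun g hg => image_eq_zero_of_notMem_tsupport hg
  have hpos : 0 < ∫ g : Fib 𝒢.r (𝒢.r g₀), f g ∂(lam.meas (𝒢.r g₀)) :=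
    lam.integral_pos (by fun_prop) ((𝒢.isFibrewiseCompact_of_isCompact hf).hasCompactSupport_fib _
      fun g hg => image_eq_zero_of_notMem_tsupport hg) (fun g => (hf01 g).1) (g := ⟨g₀, rfl⟩)
      (by simp [h1 (mem_singleton g₀)])
  filter_upwards [hc.continuousAt.eventually (lt_mem_nhds hpos)] with u hu
  by_contra hcon
  refine hu.ne' ?_
  have : ∀ g : Fib 𝒢.r u, f g = 0 := fun g => hfU fun hgU => hcon ⟨g, hgU, g.2⟩
  simp [this]

/-- A compact set of units that meets every orbit. -/
theorem HaarSystem.exists_compact_meets (lam : HaarSystem 𝒢) (hcompact : 𝒢.IsGCompact) :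
    ∃ A : Set M, IsCompact A ∧ ∀ u, ∃ g : Fib 𝒢.r u, 𝒢.s g ∈ A := by
  have hq : CompactSpace (Quot fun u v : M => ∃ g : G, 𝒢.s g = u ∧ 𝒢.r g = v) := hcompact
  choose A hA hAn using fun u : M => exists_compact_mem_nhds u
  set R := fun u v : M => ∃ g : G, 𝒢.s g = u ∧ 𝒢.r g = v
  have hR : Equivalence R := by
    refine ⟨fun u => ⟨𝒢.unit u, 𝒢.s_unit u, 𝒢.r_unit u⟩, ?_, ?_⟩
    · rintro _ _ ⟨g, rfl, rfl⟩
      exact ⟨𝒢.inv g, 𝒢.s_inv g, 𝒢.r_inv g⟩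
    · rintro _ _ _ ⟨g, rfl, rfl⟩ ⟨h, hh, rfl⟩
      exact ⟨𝒢.mul h g, 𝒢.s_mul _ _ hh, 𝒢.r_mul _ _ hh⟩
  have hsat : ∀ U : Set M, Quot.mk R ⁻¹' (Quot.mk R '' U) = 𝒢.r '' (𝒢.s ⁻¹' U) := by
    intro U
    ext v
    constructor
    · rintro ⟨u, hu, huv⟩
      obtain ⟨g, hg, hg'⟩ := (hR.quot_mk_eq_iff u v).1 huv
      exact ⟨g, by rwa [mem_preimage, hg], hg'⟩
    · rintro ⟨g, hg, rfl⟩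
      exact ⟨𝒢.s g, hg, Quot.sound ⟨g, rfl, rfl⟩⟩
  have ho : ∀ u, IsOpen (Quot.mk R '' interior (A u)) := fun u => by
    rw [← isQuotientMap_quot_mk.isOpen_preimage, hsat]
    exact lam.isOpenMap_r _ (isOpen_interior.preimage 𝒢.continuous_s)
  obtain ⟨t, ht⟩ := isCompact_univ.elim_finite_subcover _ ho (by
    rintro ⟨u⟩ -
    exact mem_iUnion.2 ⟨u, u, mem_interior_iff_mem_nhds.2 (hAn u), rfl⟩)
  refine ⟨⋃ i ∈ t, A i, t.isCompact_biUnion fun i _ => hA i, fun u => ?_⟩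
  obtain ⟨i, hi, hu⟩ := mem_iUnion₂.1 (ht (mem_univ (Quot.mk R u)))
  have : u ∈ Quot.mk R ⁻¹' (Quot.mk R '' interior (A i)) := hu
  rw [hsat] at this
  obtain ⟨g, hg, rfl⟩ := this
  exact ⟨⟨g, rfl⟩, mem_iUnion₂.2 ⟨i, hi, interior_subset hg⟩⟩

/-- A continuous invariant function on the units is bounded. -/
theorem HaarSystem.exists_bound_of_invariant (lam : HaarSystem 𝒢) (hcompact : 𝒢.IsGCompact)
    {φ : M → ℝ} (hφ : Continuous φ) (hinv : ∀ g, φ (𝒢.r g) = φ (𝒢.s g)) :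
    ∃ C, 0 ≤ C ∧ ∀ u, φ u ≤ C := by
  obtain ⟨A, hA, hAu⟩ := lam.exists_compact_meets hcompact
  obtain ⟨C, hC⟩ := hA.bddAbove_image hφ.continuousOn
  refine ⟨max C 0, le_max_right _ _, fun u => ?_⟩
  obtain ⟨g, hg⟩ := hAu u
  have h1 := hC (mem_image_of_mem φ hg)
  rw [← hinv, g.2] at h1
  exact h1.trans (le_max_left _ _)

/-- Integrals of functions of the source over the fibres of the range map are invariant. -/
theorem HaarSystem.integral_comp_s {V : Type*} [NormedAddCommGroup V] [NormedSpace ℝ V]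
    (b : M → V) (g : G) : ∫ h : Fib 𝒢.r (𝒢.r g), b (𝒢.s h) ∂(lam.meas (𝒢.r g)) =
      ∫ h : Fib 𝒢.r (𝒢.s g), b (𝒢.s h) ∂(lam.meas (𝒢.s g)) := by
  rw [← lam.integral_leftMul g rfl rfl]
  refine integral_congr_ae (ae_of_all _ fun h => ?_)
  simp only [LieGroupoid.leftMul_coe]
  rw [𝒢.s_mul _ _ h.2.symm]

/-- The cut-off function of a proper `G`-compact groupoid: a bump function `b` that is positive on a
compact set meeting every orbit, divided by the invariant function `u ↦ ∫ b(s g) dλ^u(g)`. -/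
theorem HaarSystem.exists_cutoff (lam : HaarSystem 𝒢) (hproper : 𝒢.IsProper)
    (hcompact : 𝒢.IsGCompact) : ∃ c : C(M, ℝ), HasCompactSupport c ∧ (∀ u, 0 ≤ c u) ∧
      ∀ u, ∫ g : Fib 𝒢.r u, c (𝒢.s g) ∂(lam.meas u) = 1 := by
  obtain ⟨A, hA, hAu⟩ := lam.exists_compact_meets hcompact
  obtain ⟨b, h1, -, hb, hb01⟩ :=
    exists_continuous_one_zero_of_isCompact hA isClosed_empty (disjoint_empty _)
  have hs := 𝒢.continuous_s
  have hS := hproper.isFibrewiseCompact hb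
  have h0 : ∀ g ∉ 𝒢.s ⁻¹' tsupport b, b (𝒢.s g) = 0 := fun g hg =>
    image_eq_zero_of_notMem_tsupport hg
  have hB := lam.continuous_integral_real (φ := fun g => b (𝒢.s g)) (by fun_prop) hS h0
  set B : M → ℝ := fun u => ∫ g : Fib 𝒢.r u, b (𝒢.s g) ∂(lam.meas u)
  have hpos : ∀ u, 0 < B u := fun u => by
    obtain ⟨g, hg⟩ := hAu u
    exact lam.integral_pos (by fun_prop) (hS.hasCompactSupport_fib _ fun g hg => h0 _ hg)
      (fun g => (hb01 _).1) (g := g) (by simp [h1 hg])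
  refine ⟨⟨fun u => b u / B u, b.continuous.div hB fun u => (hpos u).ne'⟩, ?_, fun u =>
    div_nonneg (hb01 u).1 (hpos u).le, fun u => ?_⟩
  · exact HasCompactSupport.intro hb fun u hu => by
      simp [image_eq_zero_of_notMem_tsupport hu]
  · have : ∀ g : Fib 𝒢.r u, b (𝒢.s g) / B (𝒢.s g) = (B u)⁻¹ * b (𝒢.s g) := fun g => by
      have h2 : B (𝒢.r g) = B (𝒢.s g) := lam.integral_comp_s b g
      rw [← h2, g.2, div_eq_inv_mul]
    simp only [ContinuousMap.coe_mk, this]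
    rw [integral_const_mul]
    exact inv_mul_cancel₀ (hpos u).ne'

end Cutoff

section HilbertBundle

variable {m k d z : ℕ} {M : Type uM} {G : Type uG} {X : Type uX} {Z : Type uZ}
  [TopologicalSpace M] [ChartedSpace (EuclideanSpace ℝ (Fin m)) M]
  [TopologicalSpace G] [ChartedSpace (EuclideanSpace ℝ (Fin k)) G]
  [TopologicalSpace X] [ChartedSpace (EuclideanSpace ℝ (Fin d)) X]
  [TopologicalSpace Z] [ChartedSpace (EuclideanSpace ℝ (Fin z)) Z]
  {𝒢 : LieGroupoid m k M G}
  {F : Type uF} [NormedAddCommGroup F] [NormedSpace ℂ F]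
  {E : X → Type uE} [∀ x, NormedAddCommGroup (E x)] [∀ x, InnerProductSpace ℂ (E x)]
  [TopologicalSpace (TotalSpace F E)] [FiberBundle F E] [VectorBundle ℂ F E]
  [CompactSpace Z] [MeasurableSpace X] [BorelSpace X] {𝒳 : GFibreBundle 𝒢 d z X Z}
  {ℰ : GHermitianBundle 𝒳 F E} {μ : InvariantMeasures 𝒳}
  [T2Space X] [SecondCountableTopology X] [FiniteDimensional ℂ F] [T2Space M]

/-! ### Topology of the Hilbert bundle -/

/-- Translation by a product of arrows is the composition of the translations. -/
theorem L2Fibre.transl_mul {u v w : M} (h g : G) (hg : 𝒢.s g = u) (hv : 𝒢.r g = v)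
    (hh : 𝒢.s h = v) (hw : 𝒢.r h = w) (hs : 𝒢.s (𝒢.mul h g) = u) (hr : 𝒢.r (𝒢.mul h g) = w)
    (ξ : L2Fibre ℰ μ u) : L2Fibre.transl ℰ μ h hh hw (L2Fibre.transl ℰ μ g hg hv ξ) =
      L2Fibre.transl ℰ μ (𝒢.mul h g) hs hr ξ := by
  induction ξ using UniformSpace.Completion.induction_on with
  | hp => exact isClosed_eq (by fun_prop) (by fun_prop)
  | ih f =>
    rw [transl_coe, transl_coe, transl_coe]
    congr 1
    refine PreL2.val_ext fun y => ?_
    have hcomp : 𝒢.s h = 𝒢.r g := hh.trans hv.symm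
    have key : ∀ (x : Fib 𝒳.p u) (y' : Fib 𝒳.p v) (x' : Fib 𝒳.p u) (hx : x' = x)
        (h1 : 𝒢.s g = 𝒳.p x.1) (h2 : 𝒳.act g x.1 = y'.1) (h3 : 𝒢.s h = 𝒳.p y'.1)
        (h4 : 𝒳.act h y'.1 = y.1) (h5 : 𝒢.s (𝒢.mul h g) = 𝒳.p x'.1)
        (h6 : 𝒳.act (𝒢.mul h g) x'.1 = y.1),
        ℰ.eact h y'.1 y.1 h3 h4 (ℰ.eact g x.1 y'.1 h1 h2 (f.val x)) =
          ℰ.eact (𝒢.mul h g) x'.1 y.1 h5 h6 (f.val x') := by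
      rintro x y' _ rfl h1 h2 h3 h4 h5 h6
      exact ℰ.eact_eact _ _ _ _ _ _ _ _ _ _ _ _
    refine key _ _ _ (Subtype.ext ?_) _ _ _ _ _ _
    change 𝒳.act (𝒢.inv (𝒢.mul h g)) y.1 = 𝒳.act (𝒢.inv g) (𝒳.act (𝒢.inv h) y.1)
    rw [𝒳.act_act _ _ _ (by rw [𝒢.s_inv, 𝒢.r_inv, hcomp])
      (by rw [𝒢.s_inv, hw, y.2]), 𝒢.inv_mul_rev _ _ hcomp]

namespace L2Bundle

theorem continuous_norm_vec : Continuous fun ξ : L2Bundle ℰ μ => ‖ξ.vec‖ := by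
  rw [continuous_iff_continuousAt]
  intro ξ₀
  rw [ContinuousAt, Metric.tendsto_nhds]
  intro ε hε
  obtain ⟨f, hf⟩ := ℰ.exists_field_near ξ₀.vec (show 0 < ε / 3 by linarith)
  have h1 : ∀ᶠ ξ in 𝓝 ξ₀, ‖ξ.vec - ℰ.field μ f ξ.base‖ < ε / 3 :=
    Filter.mem_of_superset ((isOpen_tube f isOpen_univ (ε / 3)).mem_nhds ⟨mem_univ _, hf⟩)
      fun ξ hξ => hξ.2
  have h2 := ((ℰ.continuous_norm_field f (μ := μ)).comp continuous_base).continuousAt (x := ξ₀)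
  rw [ContinuousAt, Metric.tendsto_nhds] at h2
  filter_upwards [h1, h2 (ε / 3) (by linarith)] with ξ h3 h4
  rw [Real.dist_eq] at h4 ⊢
  simp only [Function.comp] at h4
  have h5 := abs_norm_sub_norm_le ξ.vec (ℰ.field μ f ξ.base)
  have h6 := abs_norm_sub_norm_le ξ₀.vec (ℰ.field μ f ξ₀.base)
  rw [abs_le] at h5 h6
  rw [abs_lt] at h4 ⊢
  constructor <;> linarith

section

variable {Y : Type*} [TopologicalSpace Y] {b : Y → M} {v w : ∀ y, L2Fibre ℰ μ (b y)}

theorem continuous_norm (hv : Continuous fun y => (⟨b y, v y⟩ : L2Bundle ℰ μ)) :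
    Continuous fun y => ‖v y‖ :=
  continuous_norm_vec.comp hv

theorem continuous_sub (hv : Continuous fun y => (⟨b y, v y⟩ : L2Bundle ℰ μ))
    (hw : Continuous fun y => (⟨b y, w y⟩ : L2Bundle ℰ μ)) :
    Continuous fun y => (⟨b y, v y - w y⟩ : L2Bundle ℰ μ) := by
  have := continuous_add hv (continuous_smul (-1) hw)
  simpa [sub_eq_add_neg] using this

theorem continuous_inner (hv : Continuous fun y => (⟨b y, v y⟩ : L2Bundle ℰ μ))
    (hw : Continuous fun y => (⟨b y, w y⟩ : L2Bundle ℰ μ)) :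
    Continuous fun y => (inner ℂ (v y) (w y) : ℂ) := by
  simp_rw [inner_eq_sum_norm_sq_div_four (𝕜 := ℂ)]
  have hI := continuous_smul (RCLike.I : ℂ) hw
  have h1 := RCLike.continuous_ofReal (K := ℂ) |>.comp (continuous_norm (continuous_add hv hw))
  have h2 := RCLike.continuous_ofReal (K := ℂ) |>.comp (continuous_norm (continuous_sub hv hw))
  have h3 := RCLike.continuous_ofReal (K := ℂ) |>.comp (continuous_norm (continuous_sub hv hI))
  have h4 := RCLike.continuous_ofReal (K := ℂ) |>.comp (continuous_norm (continuous_add hv hI))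
  simp only [Function.comp_def] at h1 h2 h3 h4
  fun_prop

theorem continuous_smul_fun {c : Y → ℂ} (hc : Continuous c)
    (hv : Continuous fun y => (⟨b y, v y⟩ : L2Bundle ℰ μ)) :
    Continuous fun y => (⟨b y, c y • v y⟩ : L2Bundle ℰ μ) := by
  have hb : Continuous b := continuous_base.comp hv
  refine continuous_of_approx hb fun y₀ ε hε => ?_
  have hC : 0 < ‖c y₀‖ + 1 := by positivity
  obtain ⟨f, hf⟩ := exists_approx hv y₀ (div_pos (half_pos hε) hC)
  refine ⟨c y₀ • f, ?_⟩
  have hn := (((hc.sub continuous_const).norm).mul ((ℰ.continuous_norm_field f (μ := μ)).comp hb)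
    : Continuous fun y => ‖c y - c y₀‖ * ‖ℰ.field μ f (b y)‖)
  have h0 : ∀ᶠ y in 𝓝 y₀, ‖c y - c y₀‖ * ‖ℰ.field μ f (b y)‖ < ε / 2 :=
    hn.continuousAt.eventually (gt_mem_nhds (by simpa using hε))
  have h1 : ∀ᶠ y in 𝓝 y₀, ‖c y‖ < ‖c y₀‖ + 1 :=
    hc.norm.continuousAt.eventually (gt_mem_nhds (by linarith))
  filter_upwards [hf, h0, h1] with y h2 h3 h4
  rw [ℰ.field_smul]
  have h5 : c y • v y - c y₀ • ℰ.field μ f (b y) = c y • (v y - ℰ.field μ f (b y)) +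
      (c y - c y₀) • ℰ.field μ f (b y) := by module
  rw [h5]
  refine (norm_add_le _ _).trans_lt ?_
  rw [norm_smul, norm_smul]
  rw [lt_div_iff₀ hC] at h2
  have := norm_nonneg (v y - ℰ.field μ f (b y))
  nlinarith

/-- A vector field along `b` is continuous if, near each point, it is uniformly close to continuous
ones. -/
theorem continuous_of_locally_uniform (hb : Continuous b)
    (h : ∀ y₀, ∀ ε > 0, ∃ w : ∀ y, L2Fibre ℰ μ (b y),
      (Continuous fun y => (⟨b y, w y⟩ : L2Bundle ℰ μ)) ∧ ∀ᶠ y in 𝓝 y₀, ‖v y - w y‖ < ε) :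
    Continuous fun y => (⟨b y, v y⟩ : L2Bundle ℰ μ) := by
  refine continuous_of_approx hb fun y₀ ε hε => ?_
  obtain ⟨w, hw, hvw⟩ := h y₀ (ε / 2) (half_pos hε)
  obtain ⟨f, hf⟩ := exists_approx hw y₀ (half_pos hε)
  refine ⟨f, ?_⟩
  filter_upwards [hvw, hf] with y h1 h2
  have := norm_add_le (v y - w y) (w y - ℰ.field μ f (b y))
  rw [sub_add_sub_cancel] at this
  linarith

theorem continuous_sum {ι : Type*} (t : Finset ι) (hb : Continuous b)
    {v : ι → ∀ y, L2Fibre ℰ μ (b y)}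
    (hv : ∀ i ∈ t, Continuous fun y => (⟨b y, v i y⟩ : L2Bundle ℰ μ)) :
    Continuous fun y => (⟨b y, ∑ i ∈ t, v i y⟩ : L2Bundle ℰ μ) := by
  classical
  induction t using Finset.induction_on with
  | empty => simpa [Function.comp_def] using (continuous_zero (ℰ := ℰ) (μ := μ)).comp hb
  | insert i t hi ih =>
    simp_rw [Finset.sum_insert hi]
    exact continuous_add (hv i (Finset.mem_insert_self i t))
      (ih fun j hj => hv j (Finset.mem_insert_of_mem hj))

/-- The topology of `𝔥` induces the norm topology on the fibres. -/
theorem continuous_mk_iff {u : M} {v : Y → L2Fibre ℰ μ u} :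
    (Continuous fun y => (⟨u, v y⟩ : L2Bundle ℰ μ)) ↔ Continuous v := by
  constructor
  · intro h
    rw [continuous_iff_continuousAt]
    intro y₀
    rw [ContinuousAt, Metric.tendsto_nhds]
    intro ε hε
    obtain ⟨f, hf⟩ := exists_approx h y₀ (half_pos hε)
    have h0 := hf.self_of_nhds
    filter_upwards [hf] with y hy
    rw [dist_eq_norm]
    have := norm_sub_le (v y - ℰ.field μ f u) (v y₀ - ℰ.field μ f u)
    rw [sub_sub_sub_cancel_right] at this
    linarith
  · intro h
    refine continuous_of_approx continuous_const fun y₀ ε hε => ?_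
    obtain ⟨f, hf⟩ := ℰ.exists_field_near (v y₀) hε
    exact ⟨f, (h.sub continuous_const).norm.continuousAt.eventually (gt_mem_nhds hf)⟩

end

/-- Convergence in `𝔥` may be tested on the defining sections that approximate the limit. -/
theorem tendsto_nhds_of_approx {Y : Type*} {l : Filter Y} {a : Y → L2Bundle ℰ μ} {ζ : L2Bundle ℰ μ}
    (hb : Filter.Tendsto (fun y => (a y).base) l (𝓝 ζ.base))
    (h : ∀ ε > 0, ∃ f : ℰ.ccSec, ‖ζ.vec - ℰ.field μ f ζ.base‖ < ε ∧
      ∀ᶠ y in l, ‖(a y).vec - ℰ.field μ f (a y).base‖ < ε) :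
    Filter.Tendsto a l (𝓝 ζ) := by
  refine TopologicalSpace.tendsto_nhds_generateFrom_iff.2 ?_
  rintro _ ⟨f, U, ε, hU, rfl⟩ ⟨hζ, hlt⟩
  obtain ⟨e, he, hae⟩ := h ((ε - ‖ζ.vec - ℰ.field μ f ζ.base‖) / 3) (by linarith)
  have h1 : ‖ℰ.field μ (e - f) ζ.base‖ <
      ‖ζ.vec - ℰ.field μ f ζ.base‖ + (ε - ‖ζ.vec - ℰ.field μ f ζ.base‖) / 3 * 2 := by
    rw [ℰ.field_sub]
    have := norm_add_le (ℰ.field μ e ζ.base - ζ.vec) (ζ.vec - ℰ.field μ f ζ.base)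
    rw [sub_add_sub_cancel, norm_sub_rev _ ζ.vec] at this
    linarith
  have hc := (ℰ.continuous_norm_field (e - f) (μ := μ)).continuousAt.tendsto.comp hb
  filter_upwards [hae, hc.eventually (gt_mem_nhds h1), hb.eventually (hU.mem_nhds hζ)]
    with y h2 h3 h4
  refine ⟨h4, ?_⟩
  simp only [Function.comp] at h3
  have := norm_add_le ((a y).vec - ℰ.field μ e (a y).base)
    (ℰ.field μ e (a y).base - ℰ.field μ f (a y).base)
  rw [sub_add_sub_cancel, ← ℰ.field_sub] at this
  linarith

instance : T2Space (L2Bundle ℰ μ) := by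
  refine ⟨fun ξ η hne => ?_⟩
  by_cases hb : ξ.base = η.base
  · obtain ⟨u, ξ⟩ := ξ
    obtain ⟨u', η⟩ := η
    obtain rfl : u = u' := hb
    have hpos : 0 < ‖ξ - η‖ := norm_pos_iff.2 (sub_ne_zero.2 fun h => hne (by rw [h]))
    set ε := ‖ξ - η‖ / 4 with hε
    have hε0 : 0 < ε := by positivity
    obtain ⟨f, hf⟩ := ℰ.exists_field_near ξ hε0
    obtain ⟨h, hh⟩ := ℰ.exists_field_near η hε0
    have hU : IsOpen {w : M | 2 * ε < ‖ℰ.field μ (f - h) w‖} :=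
      isOpen_lt continuous_const (ℰ.continuous_norm_field (f - h))
    have hu : 2 * ε < ‖ℰ.field μ (f - h) u‖ := by
      rw [ℰ.field_sub]
      have h1 : ξ - η = (ξ - ℰ.field μ f u) + (ℰ.field μ f u - ℰ.field μ h u) -
          (η - ℰ.field μ h u) := by abel
      have h2 := norm_sub_le ((ξ - ℰ.field μ f u) + (ℰ.field μ f u - ℰ.field μ h u))
        (η - ℰ.field μ h u)
      have h3 := norm_add_le (ξ - ℰ.field μ f u) (ℰ.field μ f u - ℰ.field μ h u)
      rw [← h1] at h2
      linarith
    refine ⟨_, _, isOpen_tube f hU ε, isOpen_tube h hU ε, ⟨hu, hf⟩, ⟨hu, hh⟩, ?_⟩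
    rw [Set.disjoint_left]
    rintro ⟨w, ζ⟩ ⟨hw, h1⟩ ⟨-, h2⟩
    simp only [mem_ofPred_eq] at hw h1 h2
    rw [ℰ.field_sub] at hw
    have := norm_sub_le (ζ - ℰ.field μ h w) (ζ - ℰ.field μ f w)
    rw [sub_sub_sub_cancel_left] at this
    linarith
  · obtain ⟨U, V, hU, hV, h1, h2, hUV⟩ := t2_separation hb
    exact ⟨_, _, hU.preimage continuous_base, hV.preimage continuous_base, h1, h2,
      hUV.preimage base⟩

/-- A set of vectors over a compact set of units has compact closure in `𝔥` if it lies, for each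
`ε > 0`, within fibrewise distance `ε` of a compact set. -/
theorem isCompact_closure_of_approx {S : Set (L2Bundle ℰ μ)} {A : Set M} (hA : IsCompact A)
    (hS : ∀ ζ ∈ S, ζ.base ∈ A)
    (h : ∀ ε > 0, ∃ C : Set (L2Bundle ℰ μ), IsCompact C ∧ ∀ ζ ∈ S,
      ∃ v : L2Fibre ℰ μ ζ.base, ⟨ζ.base, v⟩ ∈ C ∧ ‖ζ.vec - v‖ ≤ ε) : IsCompact (closure S) := by
  choose C hC hSC using fun n : ℕ => h (1 / ((n : ℝ) + 1)) (by positivity)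
  set T : Set (L2Bundle ℰ μ) := {ζ | ζ.base ∈ A ∧ ∀ n : ℕ, ∃ v : L2Fibre ℰ μ ζ.base,
    ⟨ζ.base, v⟩ ∈ C n ∧ ‖ζ.vec - v‖ ≤ 1 / ((n : ℝ) + 1)} with hT
  suffices hTc : IsCompact T from
    hTc.of_isClosed_subset isClosed_closure
      (closure_minimal (fun ζ hζ => ⟨hS ζ hζ, fun n => hSC n ζ hζ⟩) hTc.isClosed)
  rw [isCompact_iff_ultrafilter_le_nhds]
  intro 𝒰 h𝒰
  have h𝒰T : T ∈ 𝒰 := Filter.le_principal_iff.1 h𝒰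
  have hbA : A ∈ 𝒰.map base :=
    Ultrafilter.mem_map.2 (Filter.mem_of_superset h𝒰T fun ζ (hζ : ζ ∈ T) => hζ.1)
  obtain ⟨u, huA, hu⟩ := isCompact_iff_ultrafilter_le_nhds.1 hA _ (Filter.le_principal_iff.2 hbA)
  have hw : ∀ n : ℕ, ∃ w : ∀ ζ : L2Bundle ℰ μ, L2Fibre ℰ μ ζ.base, ∀ ζ ∈ T,
      ⟨ζ.base, w ζ⟩ ∈ C n ∧ ‖ζ.vec - w ζ‖ ≤ 1 / ((n : ℝ) + 1) := by
    intro n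
    have : ∀ ζ : L2Bundle ℰ μ, ∃ v : L2Fibre ℰ μ ζ.base, ζ ∈ T →
        ⟨ζ.base, v⟩ ∈ C n ∧ ‖ζ.vec - v‖ ≤ 1 / ((n : ℝ) + 1) := by
      intro ζ
      by_cases hζ : ζ ∈ T
      · obtain ⟨v, hv⟩ := hζ.2 n
        exact ⟨v, fun _ => hv⟩
      · exact ⟨0, fun h => absurd h hζ⟩
    choose w hw using this
    exact ⟨w, hw⟩
  choose w hw using hw
  -- limits of the approximating vectors along the ultrafilter
  have hlim : ∀ n, ∃ y : L2Fibre ℰ μ u, (⟨u, y⟩ : L2Bundle ℰ μ) ∈ C n ∧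
      Filter.Tendsto (fun ζ => (⟨ζ.base, w n ζ⟩ : L2Bundle ℰ μ)) 𝒰 (𝓝 ⟨u, y⟩) := by
    intro n
    have hm : C n ∈ 𝒰.map fun ζ => (⟨ζ.base, w n ζ⟩ : L2Bundle ℰ μ) :=
      Ultrafilter.mem_map.2 (Filter.mem_of_superset h𝒰T fun ζ hζ => (hw n ζ hζ).1)
    obtain ⟨⟨u', y⟩, hy, hle⟩ :=
      isCompact_iff_ultrafilter_le_nhds.1 (hC n) _ (Filter.le_principal_iff.2 hm)
    have hle' : Filter.Tendsto (fun ζ => (⟨ζ.base, w n ζ⟩ : L2Bundle ℰ μ)) 𝒰 (𝓝 ⟨u', y⟩) := hle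
    have h1 := (continuous_base.tendsto _).comp hle'
    have h2 : Filter.Tendsto base (𝒰 : Filter (L2Bundle ℰ μ)) (𝓝 u) := hu
    obtain rfl : u' = u := tendsto_nhds_unique h1 h2
    exact ⟨y, hy, hle'⟩
  choose y hyC hy using hlim
  -- if both families converge then so do the norms of the differences
  have hdist : ∀ (n : ℕ) (f : ℰ.ccSec), Filter.Tendsto
      (fun ζ : L2Bundle ℰ μ => ‖w n ζ - ℰ.field μ f ζ.base‖) 𝒰 (𝓝 ‖y n - ℰ.field μ f u‖) := by
    intro n f
    have hc : Continuous fun ζ : L2Bundle ℰ μ => ‖ζ.vec - ℰ.field μ f ζ.base‖ :=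
      continuous_norm (continuous_sub (b := base) (v := vec) continuous_id
        ((continuous_field f).comp continuous_base))
    exact (hc.tendsto (⟨u, y n⟩ : L2Bundle ℰ μ)).comp (hy n)
  have hcauchy : ∀ n n' : ℕ, ‖y n - y n'‖ ≤ 1 / ((n : ℝ) + 1) + 1 / ((n' : ℝ) + 1) := by
    intro n n'
    refine le_of_forall_pos_le_add fun ε hε => ?_
    obtain ⟨f, hf⟩ := ℰ.exists_field_near (y n) (show 0 < ε / 4 by linarith)
    have hev : ∀ᶠ ζ in (𝒰 : Filter (L2Bundle ℰ μ)),
        ‖w n ζ - ℰ.field μ f ζ.base‖ < ε / 4 := (hdist n f).eventually (gt_mem_nhds hf)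
    have hb : ‖y n' - ℰ.field μ f u‖ ≤ 1 / ((n : ℝ) + 1) + 1 / ((n' : ℝ) + 1) + ε / 4 := by
      refine le_of_tendsto (hdist n' f) ?_
      filter_upwards [hev, h𝒰T] with ζ h1 h2
      have h3 := (hw n ζ h2).2
      have h4 := (hw n' ζ h2).2
      have h5 : w n' ζ - ℰ.field μ f ζ.base = (ζ.vec - w n ζ) + (w n ζ - ℰ.field μ f ζ.base) -
        (ζ.vec - w n' ζ) := by abel
      rw [h5]
      refine (norm_sub_le _ _).trans ?_
      have h6 := norm_add_le (ζ.vec - w n ζ) (w n ζ - ℰ.field μ f ζ.base)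
      linarith
    have := norm_sub_le (y n - ℰ.field μ f u) (y n' - ℰ.field μ f u)
    rw [sub_sub_sub_cancel_right] at this
    linarith
  have hone := tendsto_one_div_add_atTop_nhds_zero_nat (𝕜 := ℝ)
  have hCS : CauchySeq y := by
    refine cauchySeq_of_le_tendsto_0 (fun n : ℕ => 1 / ((n : ℝ) + 1) + 1 / ((n : ℝ) + 1))
      (fun a b n ha hb => ?_) (by simpa using hone.add hone)
    rw [dist_eq_norm]
    refine (hcauchy a b).trans (add_le_add ?_ ?_) <;>
    · apply one_div_le_one_div_of_le (by positivity)
      gcongr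
  obtain ⟨y₀, hy₀⟩ := cauchySeq_tendsto_of_complete hCS
  have hny : ∀ n : ℕ, ‖y₀ - y n‖ ≤ 1 / ((n : ℝ) + 1) := by
    intro n
    have h1 : Filter.Tendsto (fun n' => ‖y n' - y n‖) Filter.atTop (𝓝 ‖y₀ - y n‖) :=
      (hy₀.sub_const _).norm
    have h2 : Filter.Tendsto (fun n' : ℕ => 1 / ((n' : ℝ) + 1) + 1 / ((n : ℝ) + 1)) Filter.atTop
      (𝓝 (0 + 1 / ((n : ℝ) + 1))) := hone.add_const _
    rw [zero_add] at h2
    exact le_of_tendsto_of_tendsto' h1 h2 fun n' => hcauchy n' n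
  refine ⟨⟨u, y₀⟩, ⟨huA, fun n => ⟨y n, hyC n, hny n⟩⟩, ?_⟩
  refine tendsto_nhds_of_approx (a := id) hu fun ε hε => ?_
  obtain ⟨f, hf⟩ := ℰ.exists_field_near y₀ (show 0 < ε / 4 by linarith)
  obtain ⟨n, hn⟩ := exists_nat_one_div_lt (show 0 < ε / 4 by linarith)
  have hyn : ‖y n - ℰ.field μ f u‖ < ε / 2 := by
    have := norm_sub_le (y₀ - ℰ.field μ f u) (y₀ - y n)
    rw [sub_sub_sub_cancel_left] at this
    have := hny n
    linarith
  refine ⟨f, hf.trans (by linarith), ?_⟩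
  filter_upwards [(hdist n f).eventually (gt_mem_nhds hyn), h𝒰T] with ζ h1 h2
  have h3 := (hw n ζ h2).2
  have := norm_add_le (ζ.vec - w n ζ) (w n ζ - ℰ.field μ f ζ.base)
  rw [sub_add_sub_cancel] at this
  simp only [id]
  linarith

end L2Bundle

end HilbertBundle

section Action

variable {m k d z : ℕ} {M : Type uM} {G : Type uG} {X : Type uX} {Z : Type uZ}
  [TopologicalSpace M] [ChartedSpace (EuclideanSpace ℝ (Fin m)) M]
  [TopologicalSpace G] [ChartedSpace (EuclideanSpace ℝ (Fin k)) G]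
  [TopologicalSpace X] [ChartedSpace (EuclideanSpace ℝ (Fin d)) X]
  [TopologicalSpace Z] [ChartedSpace (EuclideanSpace ℝ (Fin z)) Z]
  {𝒢 : LieGroupoid m k M G}
  {F : Type uF} [NormedAddCommGroup F] [NormedSpace ℂ F]
  {E : X → Type uE} [∀ x, NormedAddCommGroup (E x)] [∀ x, InnerProductSpace ℂ (E x)]
  [TopologicalSpace (TotalSpace F E)] [FiberBundle F E] [VectorBundle ℂ F E]
  [CompactSpace Z] [MeasurableSpace X] [BorelSpace X] {𝒳 : GFibreBundle 𝒢 d z X Z}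
  {ℰ : GHermitianBundle 𝒳 F E} {μ : InvariantMeasures 𝒳}
  [T2Space X] [SecondCountableTopology X] [FiniteDimensional ℂ F] [T2Space M]

/-! ### Continuity of the action on the Hilbert bundle -/

theorem GFibreBundle.continuous_p (𝒳 : GFibreBundle 𝒢 d z X Z) : Continuous 𝒳.p :=
  𝒳.submersion_p.contMDiff.continuous

/-- The bundle projection of a bundle with compact fibres is (locally) proper. -/
theorem GFibreBundle.exists_isCompact_preimage [LocallyCompactSpace M]
    (𝒳 : GFibreBundle 𝒢 d z X Z) (u : M) : ∃ A ∈ 𝓝 u, IsCompact (𝒳.p ⁻¹' A) := by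
  obtain ⟨U, hU, hu, τ, hsrc, htgt, hfst, -, -⟩ := 𝒳.locally_trivial u
  obtain ⟨A, hA, hAU, hAc⟩ := local_compact_nhds (hU.mem_nhds hu)
  refine ⟨A, hA, ?_⟩
  have hsub : A ×ˢ (univ : Set Z) ⊆ τ.target := by
    rw [htgt]
    exact prod_mono hAU Subset.rfl
  have := (hAc.prod isCompact_univ).image_of_continuousOn (τ.continuousOn_symm.mono hsub)
  convert this using 1
  ext x
  constructor
  · intro hx
    have hxs : x ∈ τ.source := by rw [hsrc]; exact hAU hx
    exact ⟨τ x, ⟨by rw [hfst x hxs]; exact hx, mem_univ _⟩, τ.left_inv hxs⟩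
  · rintro ⟨⟨a, b⟩, hab, rfl⟩
    have hs := τ.map_target (hsub hab)
    change 𝒳.p _ ∈ A
    rw [← hfst _ hs, τ.right_inv (hsub hab)]
    exact hab.1

/-- Near each unit the `L²` norm is dominated by a multiple of the supremum norm. -/
theorem PreL2.exists_norm_le [LocallyCompactSpace M] [LocallyCompactSpace X] (ℰ : GHermitianBundle 𝒳 F E)
    (μ : InvariantMeasures 𝒳) (u₀ : M) :
    ∃ C > 0, ∀ᶠ u in 𝓝 u₀, ∀ (f : PreL2 ℰ μ u) (δ : ℝ), 0 ≤ δ → (∀ x, ‖f.val x‖ ≤ δ) →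
      ‖f‖ ≤ C * δ := by
  obtain ⟨A, hA, hAc⟩ := 𝒳.exists_isCompact_preimage u₀
  obtain ⟨χ, h1, -, hχ, hχ01⟩ :=
    exists_continuous_one_zero_of_isCompact hAc isClosed_empty (disjoint_empty _)
  have hc := μ.isContinuous.continuous_integral (fun x => (χ x : ℂ)) (by fun_prop)
    (hχ.comp_left (g := fun t : ℝ => (t : ℂ)) (by simp))
  simp_rw [integral_complex_ofReal] at hc
  have hc' := Complex.continuous_re.comp hc
  simp only [Function.comp_def, Complex.ofReal_re] at hc'
  set I := fun u => ∫ x : Fib 𝒳.p u, χ x ∂(μ.meas u) with hI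
  have hI0 : ∀ u, 0 ≤ I u := fun u => integral_nonneg fun x => (hχ01 x).1
  refine ⟨√(I u₀ + 1), Real.sqrt_pos.2 (by linarith [hI0 u₀]), ?_⟩
  filter_upwards [hA, hc'.continuousAt.eventually (gt_mem_nhds (show I u₀ < I u₀ + 1 by linarith))]
    with u hu hlt f δ hδ hf
  have := μ.isContinuous.regular u
  have h2 : ‖f‖ ^ 2 ≤ δ ^ 2 * I u := by
    have h3 := norm_sq_eq f
    rw [integral_complex_ofReal] at h3
    rw [Complex.ofReal_injective h3, ← integral_const_mul]
    refine integral_mono_of_nonneg (ae_of_all _ fun x => by positivity) ?_ (ae_of_all _ fun x => ?_)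
    · exact Continuous.integrable_of_hasCompactSupport (by fun_prop)
        (HasCompactSupport.of_compactSpace _)
    · have h4 : χ x.1 = 1 := h1 (show 𝒳.p x.1 ∈ A by rw [x.2]; exact hu)
      simp only [h4, mul_one]
      exact pow_le_pow_left₀ (norm_nonneg _) (hf x) 2
  refine le_of_sq_le_sq ?_ (by positivity)
  rw [mul_pow, Real.sq_sqrt (by linarith [hI0 u₀])]
  nlinarith [sq_nonneg δ]

/-- The translates of a section depend continuously on the arrow and on the point. -/
theorem PreL2.continuous_translFun_restr (f : ℰ.ccSec) :
    Continuous fun q : {q : G × X // 𝒢.r q.1 = 𝒳.p q.2} =>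
      (⟨q.1.2, translFun (ℰ := ℰ) (μ := μ) q.1.1 rfl rfl (ℰ.restr μ f (𝒢.s q.1.1))
        ⟨q.1.2, q.2.symm⟩⟩ : TotalSpace F E) := by
  obtain ⟨Ψ, hΨ, hc⟩ := ℰ.smooth_eact
  have ha : Continuous fun q : {q : G × X // 𝒢.r q.1 = 𝒳.p q.2} => 𝒳.act (𝒢.inv q.1.1) q.1.2 :=
    𝒳.smooth_act.continuousOn.comp_continuous
      (f := fun q : {q : G × X // 𝒢.r q.1 = 𝒳.p q.2} => (𝒢.inv q.1.1, q.1.2))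
      ((𝒢.continuous_inv.comp (by fun_prop)).prodMk (by fun_prop))
      (fun q => (𝒢.s_inv _).trans q.2)
  have hf := f.2.1.comp ha
  have := hc.continuousOn.comp_continuous
    (f := fun q : {q : G × X // 𝒢.r q.1 = 𝒳.p q.2} => (q.1.1,
      (⟨𝒳.act (𝒢.inv q.1.1) q.1.2, f.1 (𝒳.act (𝒢.inv q.1.1) q.1.2)⟩ : TotalSpace F E)))
    ((by fun_prop : Continuous fun q : {q : G × X // 𝒢.r q.1 = 𝒳.p q.2} => q.1.1).prodMk hf)
    (fun q => PreL2.s_eq 𝒳 q.1.1 rfl rfl ⟨q.1.2, q.2.symm⟩)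
  refine this.congr fun q => ?_
  refine (hΨ q.1.1 _ (PreL2.s_eq 𝒳 q.1.1 rfl rfl ⟨q.1.2, q.2.symm⟩) _).trans ?_
  have key : ∀ (g : G) (x y' : X) (h1 : 𝒢.s g = 𝒳.p x) (h2 : 𝒳.act g x = y') (v : E x),
      (⟨𝒳.act g x, ℰ.eact g x (𝒳.act g x) h1 rfl v⟩ : TotalSpace F E) =
        ⟨y', ℰ.eact g x y' h1 h2 v⟩ := by
    rintro g x _ h1 rfl v
    rfl
  exact key _ _ _ _ (PreL2.act_eq 𝒳 q.1.1 rfl rfl ⟨q.1.2, q.2.symm⟩) _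

/-- For a section `f ∈ C_c(X, E)` the map `g ↦ L_g f(s g)` is continuous: near `g₀` it is close to a
section of `E` that restricts to `L_{g₀} f(s g₀)`, first uniformly on the compact fibres and then in
the `L²` norm. -/
theorem L2Fibre.continuous_transl_field [LocallyCompactSpace M] [LocallyCompactSpace X]
    (f : ℰ.ccSec) : Continuous fun g =>
      (⟨𝒢.r g, L2Fibre.transl ℰ μ g rfl rfl (ℰ.field μ f (𝒢.s g))⟩ : L2Bundle ℰ μ) := by
  have hr := 𝒢.continuous_r
  refine L2Bundle.continuous_of_approx hr fun g₀ ε hε => ?_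
  obtain ⟨h, hh⟩ := ℰ.exists_restr_eq
    (PreL2.transl g₀ rfl rfl (ℰ.restr μ f (𝒢.s g₀)) : PreL2 ℰ μ (𝒢.r g₀))
  refine ⟨h, ?_⟩
  obtain ⟨C, hC, hCu⟩ := PreL2.exists_norm_le ℰ μ (𝒢.r g₀)
  obtain ⟨A, hA, hAc⟩ := 𝒳.exists_isCompact_preimage (𝒢.r g₀)
  have hδ : 0 < ε / (2 * C) := by positivity
  let D : {q : G × X // 𝒢.r q.1 = 𝒳.p q.2} → ℝ := fun q =>
    ‖PreL2.translFun (ℰ := ℰ) (μ := μ) q.1.1 rfl rfl (ℰ.restr μ f (𝒢.s q.1.1))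
        ⟨q.1.2, q.2.symm⟩ - h.1 q.1.2‖
  have hD : Continuous D := by
    refine ℰ.continuous_norm (b := fun q : {q : G × X // 𝒢.r q.1 = 𝒳.p q.2} => q.1.2) ?_
    have h1 := continuous_section_smul (c := fun _ => (-1 : ℂ)) continuous_const
      (h.2.1.comp (by fun_prop : Continuous fun q : {q : G × X // 𝒢.r q.1 = 𝒳.p q.2} => q.1.2))
    have h2 := continuous_section_add (PreL2.continuous_translFun_restr (μ := μ) f) h1
    simpa [sub_eq_add_neg] using h2
  have hev : ∀ᶠ g in 𝓝 g₀, ∀ y ∈ 𝒳.p ⁻¹' A, ∀ hy : 𝒢.r g = 𝒳.p y,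
      D ⟨(g, y), hy⟩ < ε / (2 * C) := by
    refine hAc.eventually_forall_of_forall_eventually fun y hy => ?_
    by_cases hy' : 𝒢.r g₀ = 𝒳.p y
    · have h0 : D ⟨(g₀, y), hy'⟩ = 0 := by
        have h1 : (ℰ.restr μ h (𝒢.r g₀)).val ⟨y, hy'.symm⟩ = h.1 y := rfl
        rw [hh] at h1
        simp only [D]
        rw [← h1]
        exact norm_eq_zero.2 (sub_self _)
      have h2 := hD.continuousAt (x := ⟨(g₀, y), hy'⟩)
      have h3 := h2.eventually (gt_mem_nhds (by rw [h0]; exact hδ))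
      rw [nhds_subtype_eq_comap, Filter.eventually_comap] at h3
      filter_upwards [h3] with q hq hq'
      exact hq ⟨q, hq'⟩ rfl
    · have hne : ∀ᶠ q : G × X in 𝓝 (g₀, y), 𝒢.r q.1 ≠ 𝒳.p q.2 := by
        have h1 : IsOpen {q : G × X | 𝒢.r q.1 ≠ 𝒳.p q.2} :=
          (isClosed_eq (hr.comp continuous_fst) (𝒳.continuous_p.comp continuous_snd)).isOpen_compl
        exact h1.mem_nhds hy'
      filter_upwards [hne] with q hq hq'
      exact absurd hq' hq
  filter_upwards [hev, hr.continuousAt.eventually hA, hr.continuousAt.eventually hCu] with g h1 h2 h3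
  have h4 : L2Fibre.transl ℰ μ g rfl rfl (ℰ.field μ f (𝒢.s g)) - ℰ.field μ h (𝒢.r g) =
      ((PreL2.transl g rfl rfl (ℰ.restr μ f (𝒢.s g)) - ℰ.restr μ h (𝒢.r g) :
        PreL2 ℰ μ (𝒢.r g)) : L2Fibre ℰ μ (𝒢.r g)) := by
    rw [UniformSpace.Completion.coe_sub, GHermitianBundle.field, L2Fibre.transl_coe]
    rfl
  rw [h4, UniformSpace.Completion.norm_coe]
  have h5 := h3 (PreL2.transl g rfl rfl (ℰ.restr μ f (𝒢.s g)) - ℰ.restr μ h (𝒢.r g)) _ hδ.le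
    fun x => (h1 x.1 (by rw [mem_preimage, x.2]; exact h2) x.2.symm).le
  have h6 : C * (ε / (2 * C)) = ε / 2 := by field_simp
  linarith

theorem L2Fibre.continuous_transl [LocallyCompactSpace M] [LocallyCompactSpace X]
    {e : ∀ u, L2Fibre ℰ μ u} (he : Continuous fun u => (⟨u, e u⟩ : L2Bundle ℰ μ)) :
    Continuous fun g =>
      (⟨𝒢.r g, L2Fibre.transl ℰ μ g rfl rfl (e (𝒢.s g))⟩ : L2Bundle ℰ μ) := by
  refine L2Bundle.continuous_of_locally_uniform 𝒢.continuous_r fun g₀ ε hε => ?_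
  obtain ⟨f, hf⟩ := L2Bundle.exists_approx he (𝒢.s g₀) hε
  refine ⟨_, L2Fibre.continuous_transl_field f, ?_⟩
  filter_upwards [𝒢.continuous_s.continuousAt.eventually hf] with g hg
  rw [← map_sub, L2Fibre.norm_transl]
  exact hg

end Action

section Orbits

variable {m k d z : ℕ} {M : Type uM} {G : Type uG} {X : Type uX} {Z : Type uZ}
  [TopologicalSpace M] [ChartedSpace (EuclideanSpace ℝ (Fin m)) M]
  [TopologicalSpace G] [ChartedSpace (EuclideanSpace ℝ (Fin k)) G]
  [TopologicalSpace X] [ChartedSpace (EuclideanSpace ℝ (Fin d)) X]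
  [TopologicalSpace Z] [ChartedSpace (EuclideanSpace ℝ (Fin z)) Z]
  {𝒢 : LieGroupoid m k M G}
  {F : Type uF} [NormedAddCommGroup F] [NormedSpace ℂ F]
  {E : X → Type uE} [∀ x, NormedAddCommGroup (E x)] [∀ x, InnerProductSpace ℂ (E x)]
  [TopologicalSpace (TotalSpace F E)] [FiberBundle F E] [VectorBundle ℂ F E]
  [CompactSpace Z] [MeasurableSpace X] [BorelSpace X] {𝒳 : GFibreBundle 𝒢 d z X Z}
  {ℰ : GHermitianBundle 𝒳 F E} {μ : InvariantMeasures 𝒳}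
  [T2Space X] [SecondCountableTopology X] [FiniteDimensional ℂ F] [T2Space M]
  [LocallyCompactSpace M] [LocallyCompactSpace X]
  [MeasurableSpace G] [BorelSpace G] [T2Space G] [SecondCountableTopology G]
  [LocallyCompactSpace G] (lam : HaarSystem 𝒢)

/-! ### Translates of sections and their fibre integrals -/

/-- The translates `g ↦ L_g e(s g)` over `G^u` of a section `e` of `𝔥`, as a function with values in
the single fibre `𝔥^u`. -/
def orb (e : ∀ u, L2Fibre ℰ μ u) (u : M) (g : Fib 𝒢.r u) : L2Fibre ℰ μ u :=
  L2Fibre.transl ℰ μ g.1 rfl g.2 (e (𝒢.s g.1))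

theorem norm_orb (e : ∀ u, L2Fibre ℰ μ u) (u : M) (g : Fib 𝒢.r u) :
    ‖orb e u g‖ = ‖e (𝒢.s g.1)‖ := L2Fibre.norm_transl _ _ _ _

theorem mk_orb (e : ∀ u, L2Fibre ℰ μ u) (u : M) (g : Fib 𝒢.r u) :
    (⟨u, orb e u g⟩ : L2Bundle ℰ μ) =
      ⟨𝒢.r g.1, L2Fibre.transl ℰ μ g.1 rfl rfl (e (𝒢.s g.1))⟩ := by
  obtain ⟨g, rfl⟩ := g
  rfl

theorem continuous_orb {e : ∀ u, L2Fibre ℰ μ u}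
    (he : Continuous fun u => (⟨u, e u⟩ : L2Bundle ℰ μ)) (u : M) : Continuous (orb e u) := by
  rw [← L2Bundle.continuous_mk_iff]
  simp_rw [mk_orb]
  exact (L2Fibre.continuous_transl he).comp continuous_subtype_val

theorem transl_orb (e : ∀ u, L2Fibre ℰ μ u) {u v : M} (h : G) (hs : 𝒢.s h = u) (hr : 𝒢.r h = v)
    (g : Fib 𝒢.r u) :
    L2Fibre.transl ℰ μ h hs hr (orb e u g) = orb e v (𝒢.leftMul h hs hr g) := by
  have hcomp : 𝒢.s h = 𝒢.r g.1 := hs.trans g.2.symm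
  rw [orb, L2Fibre.transl_mul h g.1 rfl g.2 hs hr (𝒢.s_mul _ _ hcomp)
    ((𝒢.r_mul _ _ hcomp).trans hr)]
  have key : ∀ (w : M) (hw : 𝒢.s (𝒢.mul h g.1) = w) (hr' : 𝒢.r (𝒢.mul h g.1) = v),
      L2Fibre.transl ℰ μ (𝒢.mul h g.1) hw hr' (e w) =
        L2Fibre.transl ℰ μ (𝒢.mul h g.1) rfl hr' (e (𝒢.s (𝒢.mul h g.1))) := by
    rintro _ rfl _
    rfl
  exact key _ _ _

theorem orb_unit (e : ∀ u, L2Fibre ℰ μ u) (u : M) : orb e u ⟨𝒢.unit u, 𝒢.r_unit u⟩ = e u := by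
  have hs := 𝒢.s_unit u
  have h1 := transl_orb e (𝒢.unit u) hs (𝒢.r_unit u) ⟨𝒢.unit u, 𝒢.r_unit u⟩
  have h2 : 𝒢.leftMul (𝒢.unit u) hs (𝒢.r_unit u) ⟨𝒢.unit u, 𝒢.r_unit u⟩ =
      ⟨𝒢.unit u, 𝒢.r_unit u⟩ := by
    refine Subtype.ext ?_
    have h3 := 𝒢.mul_unit (𝒢.unit u)
    rwa [hs] at h3
  rw [h2] at h1
  have hinj : Function.Injective (L2Fibre.transl ℰ μ (𝒢.unit u) hs (𝒢.r_unit u)) := by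
    intro a b hab
    rw [← sub_eq_zero, ← norm_eq_zero, ← L2Fibre.norm_transl (𝒢.unit u) hs (𝒢.r_unit u),
      map_sub, hab, sub_self, norm_zero]
  have key : ∀ (w : M) (hw : 𝒢.s (𝒢.unit u) = w) ,
      L2Fibre.transl ℰ μ (𝒢.unit u) hw (𝒢.r_unit u) (e w) =
        orb e u ⟨𝒢.unit u, 𝒢.r_unit u⟩ := by
    rintro _ rfl
    rfl
  exact hinj (h1.trans (key u hs).symm)

/-- The function `⟨e₁, e₂⟩` on arrows takes the value `⟪L_l e₁(s l), L_h e₂(s h)⟫` at `l⁻¹ h`. -/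
theorem inner_orb (e₁ e₂ : ∀ u, L2Fibre ℰ μ u) {u : M} (l h : Fib 𝒢.r u) :
    (inner ℂ (e₁ (𝒢.r (𝒢.mul (𝒢.inv l.1) h.1))) (L2Fibre.transl ℰ μ (𝒢.mul (𝒢.inv l.1) h.1) rfl rfl
      (e₂ (𝒢.s (𝒢.mul (𝒢.inv l.1) h.1)))) : ℂ) = inner ℂ (orb e₁ u l) (orb e₂ u h) := by
  have hs : 𝒢.s (𝒢.inv l.1) = u := (𝒢.s_inv _).trans l.2
  have hr : 𝒢.r (𝒢.inv l.1) = 𝒢.r (𝒢.mul (𝒢.inv l.1) h.1) :=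
    (𝒢.r_mul _ _ (hs.trans h.2.symm)).symm
  rw [← L2Fibre.inner_transl (𝒢.inv l.1) hs hr, transl_orb, transl_orb]
  congr 1
  have h2 : 𝒢.leftMul (𝒢.inv l.1) hs hr l =
      ⟨𝒢.unit (𝒢.r (𝒢.mul (𝒢.inv l.1) h.1)), 𝒢.r_unit _⟩ := by
    refine Subtype.ext ?_
    rw [LieGroupoid.leftMul_coe, 𝒢.inv_mul, ← hr, 𝒢.r_inv]
  rw [h2, orb_unit]

/-- Uniform approximation of the translates of a continuous section, over a compact set of arrows,
by finite sums of products of functions on `G` and sections over `G⁰`. -/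
theorem exists_approx_orb {e : ∀ u, L2Fibre ℰ μ u}
    (he : Continuous fun u => (⟨u, e u⟩ : L2Bundle ℰ μ)) {K : Set G} (hK : IsCompact K) {ε : ℝ}
    (hε : 0 < ε) : ∃ (t : Finset G) (ρ : t → C(G, ℝ)) (f : t → ℰ.ccSec),
      (∀ i g, 0 ≤ ρ i g) ∧ (∀ i, HasCompactSupport (ρ i)) ∧
      ∀ (u : M) (g : Fib 𝒢.r u), g.1 ∈ K →
        ‖orb e u g - ∑ i, (ρ i g.1 : ℂ) • ℰ.field μ (f i) u‖ ≤ ε := by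
  have hc := L2Fibre.continuous_transl he
  choose f hf using fun g₀ : G => L2Bundle.exists_approx hc g₀ hε
  have hW : ∀ g₀, ∃ W : Set G, IsOpen W ∧ g₀ ∈ W ∧ ∀ g ∈ W,
      ‖L2Fibre.transl ℰ μ g rfl rfl (e (𝒢.s g)) - ℰ.field μ (f g₀) (𝒢.r g)‖ < ε := by
    intro g₀
    obtain ⟨W, hW, hWo, hg⟩ := eventually_nhds_iff.1 (hf g₀)
    exact ⟨W, hWo, hg, hW⟩
  choose W hWo hWm hWε using hW
  obtain ⟨t, ht⟩ := hK.elim_finite_subcover W hWo fun x _ => mem_iUnion.2 ⟨x, hWm x⟩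
  obtain ⟨χ, hχ, hχc⟩ := PartitionOfUnity.exists_isSubordinate_of_locallyFinite_t2space hK
    (fun i : t => W i.1) (fun i => hWo i.1) (locallyFinite_of_finite _)
    (by simpa [iUnion_subtype] using ht)
  refine ⟨t, fun i => χ i, fun i => f i.1, fun i g => χ.nonneg i g, hχc, ?_⟩
  rintro _ ⟨g, rfl⟩ hg
  have h1 : ∑ i, χ i g = 1 := by rw [← finsum_eq_sum_of_fintype, χ.sum_eq_one hg]
  have h2 : orb e (𝒢.r g) ⟨g, rfl⟩ - ∑ i, (χ i g : ℂ) • ℰ.field μ (f i.1) (𝒢.r g) =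
      ∑ i, (χ i g : ℂ) • (L2Fibre.transl ℰ μ g rfl rfl (e (𝒢.s g)) -
        ℰ.field μ (f i.1) (𝒢.r g)) := by
    simp_rw [smul_sub, Finset.sum_sub_distrib, ← Finset.sum_smul, ← Complex.ofReal_sum, h1,
      Complex.ofReal_one, one_smul]
    rfl
  change ‖orb e (𝒢.r g) ⟨g, rfl⟩ - ∑ i, (χ i g : ℂ) • ℰ.field μ (f i.1) (𝒢.r g)‖ ≤ ε
  rw [h2]
  calc _ ≤ ∑ i, ‖(χ i g : ℂ) • (L2Fibre.transl ℰ μ g rfl rfl (e (𝒢.s g)) -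
        ℰ.field μ (f i.1) (𝒢.r g))‖ := norm_sum_le _ _
    _ ≤ ∑ i, χ i g * ε := by
      refine Finset.sum_le_sum fun i _ => ?_
      rw [norm_smul, Complex.norm_real, Real.norm_of_nonneg (χ.nonneg i g)]
      by_cases hi : g ∈ W i.1
      · exact mul_le_mul_of_nonneg_left (hWε _ _ hi).le (χ.nonneg i g)
      · have : χ i g = 0 := image_eq_zero_of_notMem_tsupport fun h => hi (hχ i h)
        simp [this]
    _ = ε := by rw [← Finset.sum_mul, h1, one_mul]

/-- Integrating an approximation of the translates of a section. -/
theorem norm_integral_orb_sub_le {e : ∀ u, L2Fibre ℰ μ u}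
    (he : Continuous fun u => (⟨u, e u⟩ : L2Bundle ℰ μ)) {u : M} {K : Set G} {ε : ℝ}
    {t : Finset G} {ρ : t → C(G, ℝ)} {f : t → ℰ.ccSec}
    (hρ : ∀ (g : Fib 𝒢.r u), g.1 ∈ K →
        ‖orb e u g - ∑ i, (ρ i g.1 : ℂ) • ℰ.field μ (f i) u‖ ≤ ε)
    {φ : Fib 𝒢.r u → ℂ} (hφ : Continuous φ) (hφc : HasCompactSupport φ)
    (hφK : ∀ g : Fib 𝒢.r u, g.1 ∉ K → φ g = 0) :
    ‖∫ g, φ g • orb e u g ∂(lam.meas u) -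
      ∑ i, (∫ g, φ g * ρ i g.1 ∂(lam.meas u)) • ℰ.field μ (f i) u‖ ≤
        ε * ∫ g, ‖φ g‖ ∂(lam.meas u) := by
  have hint : ∀ i, Integrable (fun g => φ g * ρ i g.1) (lam.meas u) := fun i =>
    Continuous.integrable_of_hasCompactSupport (by fun_prop) hφc.mul_right
  have h1 : Integrable (fun g => φ g • orb e u g) (lam.meas u) :=
    (hφ.smul (continuous_orb he u)).integrable_of_hasCompactSupport hφc.smul_right
  have h2 : ∑ i, (∫ g, φ g * ρ i g.1 ∂(lam.meas u)) • ℰ.field μ (f i) u =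
      ∫ g, ∑ i, (φ g * ρ i g.1) • ℰ.field μ (f i) u ∂(lam.meas u) := by
    rw [integral_finsetSum _ fun i _ => (hint i).smul_const _]
    refine Finset.sum_congr rfl fun i _ => ?_
    rw [integral_smul_const]
  rw [h2, ← integral_sub h1 (integrable_finsetSum _ fun i _ => (hint i).smul_const _),
    ← integral_const_mul]
  refine norm_integral_le_of_norm_le
    ((hφ.norm.integrable_of_hasCompactSupport hφc.norm).const_mul ε) (ae_of_all _ fun g => ?_)
  have h3 : φ g • orb e u g - ∑ i, (φ g * ρ i g.1) • ℰ.field μ (f i) u =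
      φ g • (orb e u g - ∑ i, (ρ i g.1 : ℂ) • ℰ.field μ (f i) u) := by
    rw [smul_sub, Finset.smul_sum]
    simp_rw [smul_smul]
  rw [h3, norm_smul, mul_comm]
  by_cases hg : g.1 ∈ K
  · exact mul_le_mul_of_nonneg_right (hρ g hg) (norm_nonneg _)
  · simp [hφK g hg]

/-- Fibre integrals of translates of continuous sections are continuous sections. -/
theorem continuous_integral_orb {e : ∀ u, L2Fibre ℰ μ u}
    (he : Continuous fun u => (⟨u, e u⟩ : L2Bundle ℰ μ)) {φ : G → ℂ} (hφ : Continuous φ) {S : Set G}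
    (hS : 𝒢.IsFibrewiseCompact S) (h0 : ∀ g ∉ S, φ g = 0) :
    Continuous fun u => (⟨u, ∫ g : Fib 𝒢.r u, φ g • orb e u g ∂(lam.meas u)⟩ : L2Bundle ℰ μ) := by
  refine L2Bundle.continuous_of_locally_uniform continuous_id fun u₀ ε hε => ?_
  obtain ⟨A, hA, hAu⟩ := exists_compact_mem_nhds u₀
  obtain ⟨K, hK, hSK⟩ := hS A hA
  have hn := lam.continuous_integral_real hφ.norm hS fun g hg => by rw [h0 g hg, norm_zero]
  set I := fun u => ∫ g : Fib 𝒢.r u, ‖φ g‖ ∂(lam.meas u)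
  have hI : ∀ u, 0 ≤ I u := fun u => integral_nonneg fun g => norm_nonneg _
  have hpos : 0 < I u₀ + 1 := by linarith [hI u₀]
  obtain ⟨t, ρ, f, -, -, hρ⟩ := exists_approx_orb he hK (div_pos (half_pos hε) hpos)
  refine ⟨fun u => ∑ i, (∫ g : Fib 𝒢.r u, φ g * ρ i g ∂(lam.meas u)) • ℰ.field μ (f i) u,
    L2Bundle.continuous_sum _ continuous_id fun i _ => L2Bundle.continuous_smul_fun
      (lam.continuous_integral (φ := fun g => φ g * ρ i g) (by fun_prop) hS
        fun g hg => by simp [h0 g hg]) (L2Bundle.continuous_field _), ?_⟩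
  filter_upwards [hAu, hn.continuousAt.eventually (gt_mem_nhds (show I u₀ < I u₀ + 1 by linarith))]
    with u hu hlt
  refine (norm_integral_orb_sub_le lam he (hρ u) (φ := fun g => φ g.1) (by fun_prop)
    (hS.hasCompactSupport_fib u fun g hg => h0 _ hg) fun g hg => ?_).trans_lt ?_
  · exact h0 _ fun h => hg (hSK ⟨h, by rw [mem_preimage, g.2]; exact hu⟩)
  · rw [div_mul_eq_mul_div, div_lt_iff₀ hpos]
    nlinarith [hI u]

end Orbits

section Operators

variable {m k d z : ℕ} {M : Type uM} {G : Type uG} {X : Type uX} {Z : Type uZ}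
  [TopologicalSpace M] [ChartedSpace (EuclideanSpace ℝ (Fin m)) M]
  [TopologicalSpace G] [ChartedSpace (EuclideanSpace ℝ (Fin k)) G]
  [TopologicalSpace X] [ChartedSpace (EuclideanSpace ℝ (Fin d)) X]
  [TopologicalSpace Z] [ChartedSpace (EuclideanSpace ℝ (Fin z)) Z]
  {𝒢 : LieGroupoid m k M G}
  {F : Type uF} [NormedAddCommGroup F] [NormedSpace ℂ F]
  {E : X → Type uE} [∀ x, NormedAddCommGroup (E x)] [∀ x, InnerProductSpace ℂ (E x)]
  [TopologicalSpace (TotalSpace F E)] [FiberBundle F E] [VectorBundle ℂ F E]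
  [CompactSpace Z] [MeasurableSpace X] [BorelSpace X] {𝒳 : GFibreBundle 𝒢 d z X Z}
  {ℰ : GHermitianBundle 𝒳 F E} {μ : InvariantMeasures 𝒳}
  [T2Space X] [SecondCountableTopology X] [FiniteDimensional ℂ F] [T2Space M]
  [LocallyCompactSpace M] [LocallyCompactSpace X]
  [MeasurableSpace G] [BorelSpace G] [T2Space G] [SecondCountableTopology G]
  [LocallyCompactSpace G] (lam : HaarSystem 𝒢)
  [Fact 𝒢.IsProper]

/-! ### The operators between `L²(G_u, λ_u)` and `𝔥^u` defined by a section -/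

theorem norm_sq_Lp_two {Y : Type*} [MeasurableSpace Y] {ν : Measure Y} (f : Lp ℂ 2 ν) :
    ‖f‖ ^ 2 = ∫ y, ‖f y‖ ^ 2 ∂ν := by
  have h := inner_self_eq_norm_sq_to_K (𝕜 := ℂ) f
  rw [L2.inner_def] at h
  have h1 : ∀ y, (inner ℂ (f y) (f y) : ℂ) = ((‖f y‖ ^ 2 : ℝ) : ℂ) := fun y => by
    rw [inner_self_eq_norm_sq_to_K]
    norm_cast
  simp_rw [h1, integral_complex_ofReal] at h
  have h2 : ((‖f‖ : ℂ)) ^ 2 = ((‖f‖ ^ 2 : ℝ) : ℂ) := by push_cast; rfl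
  exact (Complex.ofReal_injective (h.trans h2)).symm

theorem hasCompactSupport_orb (e : gammaC ℰ μ) (u : M) : HasCompactSupport (orb e.1 u) := by
  obtain ⟨K, hK, heK⟩ := e.2.2
  refine ((Fact.out : 𝒢.IsProper).isFibrewiseCompact hK).hasCompactSupport_fib u fun g hg => ?_
  rw [orb, heK _ hg, map_zero]

/-- The coefficient `k ↦ ⟪L_{k⁻¹} e(r k), η⟫` on `G_u` of a vector `η ∈ 𝔥^u` with respect to a
section `e`. -/
def orbCoeff (e : gammaC ℰ μ) (u : M) (η : L2Fibre ℰ μ u) (k : Fib 𝒢.s u) : ℂ :=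
  inner ℂ (orb e.1 u ((𝒢.invFib u).symm k)) η

theorem continuous_orbCoeff (e : gammaC ℰ μ) (u : M) (η : L2Fibre ℰ μ u) :
    Continuous (orbCoeff e u η) :=
  Continuous.inner (𝕜 := ℂ) ((continuous_orb e.2.1 u).comp (𝒢.invFib u).symm.continuous)
    continuous_const

theorem hasCompactSupport_orbCoeff (e : gammaC ℰ μ) (u : M) (η : L2Fibre ℰ μ u) :
    HasCompactSupport (orbCoeff e u η) :=
  ((hasCompactSupport_orb e u).comp_homeomorph (𝒢.invFib u).symm).comp_left
    (g := fun ξ => (inner ℂ ξ η : ℂ)) (inner_zero_left _)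

theorem memLp_orbCoeff (e : gammaC ℰ μ) (u : M) (η : L2Fibre ℰ μ u) :
    MemLp (orbCoeff e u η) 2 (lam.measSource u) :=
  (continuous_orbCoeff e u η).memLp_of_hasCompactSupport (hasCompactSupport_orbCoeff e u η)

/-- The integral `∫ ‖e(s g)‖² dλ^u(g)`. -/
def orbEnergy (e : gammaC ℰ μ) (u : M) : ℝ := ∫ g : Fib 𝒢.r u, ‖e.1 (𝒢.s g.1)‖ ^ 2 ∂(lam.meas u)

theorem orbEnergy_nonneg (e : gammaC ℰ μ) (u : M) : 0 ≤ orbEnergy lam e u :=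
  integral_nonneg fun _ => sq_nonneg _

theorem continuous_orbEnergy (e : gammaC ℰ μ) : Continuous (orbEnergy lam e) := by
  obtain ⟨K, hK, heK⟩ := e.2.2
  have h1 := (L2Bundle.continuous_norm e.2.1).comp 𝒢.continuous_s
  exact lam.continuous_integral_real (h1.pow 2)
    ((Fact.out : 𝒢.IsProper).isFibrewiseCompact hK) fun g hg => by simp [heK _ hg]

/-- The energies are bounded, since they are a continuous invariant function on the units. -/
theorem exists_orbEnergy_le (hcompact : 𝒢.IsGCompact) (e : gammaC ℰ μ) :
    ∃ C, 0 ≤ C ∧ ∀ u, orbEnergy lam e u ≤ C :=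
  lam.exists_bound_of_invariant hcompact (continuous_orbEnergy lam e) fun g =>
    lam.integral_comp_s (fun u => ‖e.1 u‖ ^ 2) g

theorem integrable_norm_sq_orb (e : gammaC ℰ μ) (u : M) :
    Integrable (fun g : Fib 𝒢.r u => ‖e.1 (𝒢.s g.1)‖ ^ 2) (lam.meas u) := by
  have h1 : HasCompactSupport fun g => ‖orb e.1 u g‖ ^ 2 :=
    (hasCompactSupport_orb e u).comp_left (g := fun v => ‖v‖ ^ 2) (by simp)
  have h2 : Integrable (fun g => ‖orb e.1 u g‖ ^ 2) (lam.meas u) :=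
    ((continuous_orb e.2.1 u).norm.pow 2).integrable_of_hasCompactSupport h1
  exact h2.congr (ae_of_all _ fun g => congrArg (· ^ 2) (norm_orb e.1 u g))

theorem norm_toLp_orbCoeff_le (e : gammaC ℰ μ) (u : M) (η : L2Fibre ℰ μ u) :
    ‖(memLp_orbCoeff lam e u η).toLp _‖ ≤ √(orbEnergy lam e u) * ‖η‖ := by
  refine le_of_sq_le_sq ?_ (mul_nonneg (Real.sqrt_nonneg _) (norm_nonneg _))
  rw [mul_pow, Real.sq_sqrt (orbEnergy_nonneg lam e u), norm_sq_Lp_two]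
  have h1 : ∫ k, ‖(memLp_orbCoeff lam e u η).toLp _ k‖ ^ 2 ∂(lam.measSource u) =
      ∫ k, ‖orbCoeff e u η k‖ ^ 2 ∂(lam.measSource u) := by
    refine integral_congr_ae ?_
    filter_upwards [(memLp_orbCoeff lam e u η).coeFn_toLp] with k hk
    rw [hk]
  rw [h1, lam.integral_measSource, orbEnergy, ← integral_mul_const]
  have hle : ∀ g : Fib 𝒢.r u, ‖orbCoeff e u η (𝒢.invFib u g)‖ ^ 2 ≤
      ‖e.1 (𝒢.s g.1)‖ ^ 2 * ‖η‖ ^ 2 := fun g => by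
    rw [orbCoeff, Homeomorph.symm_apply_apply, ← norm_orb e.1 u g, ← mul_pow]
    exact pow_le_pow_left₀ (norm_nonneg _) (norm_inner_le_norm _ _) 2
  exact integral_mono_of_nonneg (ae_of_all _ fun x => sq_nonneg _)
    ((integrable_norm_sq_orb lam e u).mul_const _) (ae_of_all _ hle)

/-- The analysis operator `𝔥^u → L²(G_u, λ_u)` of a section `e`: it maps `η` to the function
`k ↦ ⟪L_{k⁻¹} e(r k), η⟫`. -/
def analysisOp (e : gammaC ℰ μ) (u : M) : L2Fibre ℰ μ u →L[ℂ] Lp ℂ 2 (lam.measSource u) :=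
  LinearMap.mkContinuous
    { toFun := fun η => (memLp_orbCoeff lam e u η).toLp _
      map_add' := fun η η' => by
        rw [← MemLp.toLp_add]
        congr 1
        ext k
        exact inner_add_right _ _ _
      map_smul' := fun c η => by
        rw [RingHom.id_apply, ← MemLp.toLp_const_smul]
        congr 1
        ext k
        exact inner_smul_right _ _ _ } _ (norm_toLp_orbCoeff_le lam e u)

/-- The synthesis operator `L²(G_u, λ_u) → 𝔥^u` of a section `e`: it maps `ξ` to
`∫ ξ(k) L_{k⁻¹} e(r k) dλ_u(k)`.  It is defined as the adjoint of the analysis operator. -/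
def synthesisOp (e : gammaC ℰ μ) (u : M) : Lp ℂ 2 (lam.measSource u) →L[ℂ] L2Fibre ℰ μ u :=
  ContinuousLinearMap.adjoint (analysisOp lam e u)

theorem coeFn_analysisOp (e : gammaC ℰ μ) (u : M) (η : L2Fibre ℰ μ u) :
    analysisOp lam e u η =ᵐ[lam.measSource u] orbCoeff e u η :=
  (memLp_orbCoeff lam e u η).coeFn_toLp

theorem adjoint_synthesisOp (e : gammaC ℰ μ) (u : M) :
    ContinuousLinearMap.adjoint (synthesisOp lam e u) = analysisOp lam e u :=
  ContinuousLinearMap.adjoint_adjoint _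

theorem norm_synthesisOp_le (e : gammaC ℰ μ) (u : M) :
    ‖synthesisOp lam e u‖ ≤ √(orbEnergy lam e u) := by
  rw [synthesisOp, LinearIsometryEquiv.norm_map]
  exact LinearMap.mkContinuous_norm_le _ (Real.sqrt_nonneg _) _

theorem exists_norm_synthesisOp_le (hcompact : 𝒢.IsGCompact) (e : gammaC ℰ μ) :
    ∃ C, ∀ u, ‖synthesisOp lam e u‖ ≤ C := by
  obtain ⟨C, -, hC⟩ := exists_orbEnergy_le lam hcompact e
  exact ⟨√C, fun u => (norm_synthesisOp_le lam e u).trans (Real.sqrt_le_sqrt (hC u))⟩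

theorem inner_analysisOp (e : gammaC ℰ μ) (u : M) {φ : Fib 𝒢.s u → ℂ}
    {ξ : Lp ℂ 2 (lam.measSource u)} (hξ : ξ =ᵐ[lam.measSource u] φ) (η : L2Fibre ℰ μ u) :
    (inner ℂ ξ (analysisOp lam e u η) : ℂ) =
      ∫ g, star (φ (𝒢.invFib u g)) * inner ℂ (orb e.1 u g) η ∂(lam.meas u) := by
  have h2 : (inner ℂ ξ (analysisOp lam e u η) : ℂ) =
      ∫ k, star (φ k) * orbCoeff e u η k ∂(lam.measSource u) := by
    rw [L2.inner_def]
    refine integral_congr_ae ?_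
    filter_upwards [hξ, coeFn_analysisOp lam e u η] with k h3 h4
    rw [h3, h4, RCLike.inner_apply, mul_comm]
    rfl
  rw [h2, lam.integral_measSource]
  refine integral_congr_ae (ae_of_all _ fun g => ?_)
  simp [orbCoeff]

theorem synthesisOp_apply (e : gammaC ℰ μ) (u : M) {φ : Fib 𝒢.s u → ℂ} (hφ : Continuous φ)
    {ξ : Lp ℂ 2 (lam.measSource u)} (hξ : ξ =ᵐ[lam.measSource u] φ) :
    synthesisOp lam e u ξ = ∫ g, φ (𝒢.invFib u g) • orb e.1 u g ∂(lam.meas u) := by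
  have hint : Integrable (fun g => φ (𝒢.invFib u g) • orb e.1 u g) (lam.meas u) :=
    ((hφ.comp (𝒢.invFib u).continuous).smul
      (continuous_orb e.2.1 u)).integrable_of_hasCompactSupport (hasCompactSupport_orb e u).smul_left
  refine ext_inner_right ℂ fun η => ?_
  rw [synthesisOp, ContinuousLinearMap.adjoint_inner_left, inner_analysisOp lam e u hξ]
  rw [← inner_conj_symm, ← integral_inner hint, ← integral_conj]
  refine integral_congr_ae (ae_of_all _ fun g => ?_)
  simp only [inner_smul_right, map_mul, inner_conj_symm]
  rfl

theorem synthesisOp_add (e e' : gammaC ℰ μ) (u : M) :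
    synthesisOp lam (e + e') u = synthesisOp lam e u + synthesisOp lam e' u := by
  rw [synthesisOp, synthesisOp, synthesisOp, ← map_add]
  congr 1
  ext1 η
  refine Lp.ext ?_
  rw [add_apply]
  filter_upwards [coeFn_analysisOp lam (e + e') u η, coeFn_analysisOp lam e u η,
    coeFn_analysisOp lam e' u η, Lp.coeFn_add (analysisOp lam e u η) (analysisOp lam e' u η)]
    with k h1 h2 h3 h4
  rw [h1, h4, Pi.add_apply, h2, h3, orbCoeff, orbCoeff, orbCoeff, ← inner_add_left]
  congr 1
  exact (L2Fibre.transl ℰ μ _ _ _).map_add _ _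

theorem synthesisOp_smul (c : ℂ) (e : gammaC ℰ μ) (u : M) :
    synthesisOp lam (c • e) u = c • synthesisOp lam e u := by
  rw [synthesisOp, synthesisOp]
  refine ContinuousLinearMap.ext fun ξ => ext_inner_right ℂ fun η => ?_
  rw [smul_apply, inner_smul_left, ContinuousLinearMap.adjoint_inner_left,
    ContinuousLinearMap.adjoint_inner_left, ← inner_smul_right]
  congr 1
  refine Lp.ext ?_
  filter_upwards [coeFn_analysisOp lam (c • e) u η, coeFn_analysisOp lam e u η,
    Lp.coeFn_smul (starRingEnd ℂ c) (analysisOp lam e u η)] with k h1 h2 h3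
  rw [h1, h3, Pi.smul_apply, h2, orbCoeff, orbCoeff, smul_eq_mul, ← inner_smul_left]
  congr 1
  exact (L2Fibre.transl ℰ μ _ _ _).map_smul c _

theorem orb_applySection (T : boundedMorphisms ℰ μ) (e : gammaC ℰ μ) (u : M) (g : Fib 𝒢.r u) :
    orb (applySection T e).1 u g = T.1 u (orb e.1 u g) := by
  obtain ⟨g, rfl⟩ := g
  exact (T.2.2.2 g _).symm

/-- By equivariance, the synthesis operator of `T e` is the composition of `T` with that of `e`. -/
theorem synthesisOp_applySection (T : boundedMorphisms ℰ μ) (e : gammaC ℰ μ) (u : M) :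
    synthesisOp lam (applySection T e) u = (T.1 u).comp (synthesisOp lam e u) := by
  rw [synthesisOp, synthesisOp]
  refine ContinuousLinearMap.ext fun ξ => ext_inner_right ℂ fun η => ?_
  rw [ContinuousLinearMap.comp_apply, ContinuousLinearMap.adjoint_inner_left,
    ← ContinuousLinearMap.adjoint_inner_right, ContinuousLinearMap.adjoint_inner_left]
  congr 1
  refine Lp.ext ?_
  filter_upwards [coeFn_analysisOp lam (applySection T e) u η,
    coeFn_analysisOp lam e u (ContinuousLinearMap.adjoint (T.1 u) η)] with k h1 h2
  rw [h1, h2, orbCoeff, orbCoeff, ContinuousLinearMap.adjoint_inner_right, orb_applySection]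

/-- Some continuous section with compact support approximates a given vector. -/
theorem exists_gammaC_near (u : M) (ξ : L2Fibre ℰ μ u) {ε : ℝ} (hε : 0 < ε) :
    ∃ e : gammaC ℰ μ, ‖ξ - e.1 u‖ < ε := by
  obtain ⟨f, hf⟩ := ℰ.exists_field_near ξ hε
  exact ⟨ℰ.toGammaC μ f, hf⟩

/-- The analysis operators of all sections separate the vectors of `𝔥^u`. -/
theorem eq_zero_of_analysisOp_eq_zero (u : M) (η : L2Fibre ℰ μ u)
    (h : ∀ e : gammaC ℰ μ, analysisOp lam e u η = 0) : η = 0 := by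
  have h1 : ∀ e : gammaC ℰ μ, (inner ℂ (e.1 u) η : ℂ) = 0 := by
    intro e
    have hae : orbCoeff e u η =ᵐ[lam.measSource u] 0 := by
      refine (coeFn_analysisOp lam e u η).symm.trans ?_
      rw [h e]
      exact Lp.coeFn_zero _ _ _
    have hopen : (lam.measSource u).IsOpenPosMeasure := by
      rw [lam.measSource_eq]
      exact (𝒢.invFib u).continuous.isOpenPosMeasure_map (𝒢.invFib u).surjective
    have h2 := (continuous_orbCoeff e u η).ae_eq_iff_eq (lam.measSource u) continuous_zero |>.1 hae
    have h3 := congrFun h2 (𝒢.invFib u ⟨𝒢.unit u, 𝒢.r_unit u⟩)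
    rwa [orbCoeff, Homeomorph.symm_apply_apply, orb_unit] at h3
  by_contra hne
  have hpos : 0 < ‖η‖ := norm_pos_iff.2 hne
  obtain ⟨e, he⟩ := exists_gammaC_near u η hpos
  have h2 : (inner ℂ (η - e.1 u) η : ℂ) = ((‖η‖ ^ 2 : ℝ) : ℂ) := by
    rw [inner_sub_left, h1 e, sub_zero, inner_self_eq_norm_sq_to_K]
    push_cast
    rfl
  have h3 := norm_inner_le_norm (𝕜 := ℂ) (η - e.1 u) η
  rw [h2, Complex.norm_real, Real.norm_of_nonneg (by positivity)] at h3
  nlinarith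

/-- The operator `π_u(⟨e₁, e₂⟩)` is the composition of a synthesis and an analysis operator. -/
theorem analysisOp_synthesisOp_isRegular (e₁ e₂ : gammaC ℰ μ) {f : G → ℂ}
    (hf : ∀ g, f g = inner ℂ (e₁.1 (𝒢.r g)) (L2Fibre.transl ℰ μ g rfl rfl (e₂.1 (𝒢.s g)))) (u : M)
    (ξ : C_c(G, ℂ)) (η : Lp ℂ 2 (lam.measSource u))
    (hη : (η : Fib 𝒢.s u → ℂ) =ᵐ[lam.measSource u] fun g => ξ g.1) :
    analysisOp lam e₁ u (synthesisOp lam e₂ u η) =ᵐ[lam.measSource u]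
      fun g => lam.conv f ξ g.1 := by
  have hξ : Continuous fun g : Fib 𝒢.s u => ξ g.1 := by fun_prop
  filter_upwards [coeFn_analysisOp lam e₁ u (synthesisOp lam e₂ u η)] with k hk
  rw [hk, orbCoeff, synthesisOp_apply lam e₂ u hξ hη]
  have hint : Integrable (fun g => ξ (𝒢.invFib u g).1 • orb e₂.1 u g) (lam.meas u) :=
    ((hξ.comp (𝒢.invFib u).continuous).smul (continuous_orb
      e₂.2.1 u)).integrable_of_hasCompactSupport (hasCompactSupport_orb e₂ u).smul_left
  rw [← integral_inner hint]
  obtain ⟨l, rfl⟩ := (𝒢.invFib u).surjective k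
  rw [LieGroupoid.invFib_coe, lam.conv_inv]
  refine integral_congr_ae (ae_of_all _ fun h => ?_)
  simp only [Homeomorph.symm_apply_apply, inner_smul_right, hf, inner_orb]
  exact mul_comm _ _

/-- The function `⟨e₁, e₂⟩` belongs to `C_c(G)`. -/
theorem exists_inner_cc (e₁ e₂ : gammaC ℰ μ) : ∃ f : C_c(G, ℂ), ∀ g,
    f g = inner ℂ (e₁.1 (𝒢.r g)) (L2Fibre.transl ℰ μ g rfl rfl (e₂.1 (𝒢.s g))) := by
  obtain ⟨K₁, hK₁, h₁⟩ := e₁.2.2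
  obtain ⟨K₂, hK₂, h₂⟩ := e₂.2.2
  refine ⟨⟨⟨fun g => inner ℂ (e₁.1 (𝒢.r g)) (L2Fibre.transl ℰ μ g rfl rfl (e₂.1 (𝒢.s g))),
    L2Bundle.continuous_inner (e₁.2.1.comp 𝒢.continuous_r) (L2Fibre.continuous_transl e₂.2.1)⟩,
    HasCompactSupport.intro ((Fact.out : 𝒢.IsProper) _ (hK₁.prod hK₂)) fun g hg => ?_⟩,
    fun g => rfl⟩
  change inner ℂ (e₁.1 (𝒢.r g)) (L2Fibre.transl ℰ μ g rfl rfl (e₂.1 (𝒢.s g))) = (0 : ℂ)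
  by_cases hr : 𝒢.r g ∈ K₁
  · have hs : 𝒢.s g ∉ K₂ := fun h => hg ⟨hr, h⟩
    rw [h₂ _ hs, map_zero, inner_zero_right]
  · rw [h₁ _ hr, inner_zero_left]

/-- The regular representation operators of a function are determined by their definition on
`C_c(G)`. -/
theorem HaarSystem.IsRegularRep.at_eq {f : C_c(G, ℂ)} {a : lam.RegularProduct}
    (ha : lam.IsRegularRep f a) (u : M)
    {B : Lp ℂ 2 (lam.measSource u) →L[ℂ] Lp ℂ 2 (lam.measSource u)}
    (hB : ∀ (ξ : C_c(G, ℂ)) (η : Lp ℂ 2 (lam.measSource u)),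
      (η : Fib 𝒢.s u → ℂ) =ᵐ[lam.measSource u] (fun g => ξ g.1) →
      (B η : Fib 𝒢.s u → ℂ) =ᵐ[lam.measSource u] (fun g => lam.conv f ξ g.1)) : a.at u = B := by
  set D : Set (Lp ℂ 2 (lam.measSource u)) :=
    {ζ | ∃ ξ : C_c(G, ℂ), (ζ : Fib 𝒢.s u → ℂ) =ᵐ[lam.measSource u] fun g => ξ g.1}
  have hD : Dense D := fun η => Metric.mem_closure_iff.2 fun ε hε => by
    obtain ⟨ξ, ζ, h1, h2⟩ := lam.exists_restrict_near u η hε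
    exact ⟨ζ, ⟨ξ, h1⟩, by rwa [dist_eq_norm]⟩
  refine ContinuousLinearMap.ext fun η => ?_
  refine congrFun (Continuous.ext_on hD (a.at u).continuous B.continuous ?_) η
  rintro ζ ⟨ξ, hξ⟩
  exact Lp.ext ((ha u ξ ζ hξ).trans (hB ξ ζ hξ).symm)

theorem HaarSystem.IsRegularRep.at_eq_comp {e₁ e₂ : gammaC ℰ μ} {f : C_c(G, ℂ)}
    (hf : ∀ g, f g = inner ℂ (e₁.1 (𝒢.r g)) (L2Fibre.transl ℰ μ g rfl rfl (e₂.1 (𝒢.s g))))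
    {a : lam.RegularProduct} (ha : lam.IsRegularRep f a) (u : M) :
    a.at u = (ContinuousLinearMap.adjoint (synthesisOp lam e₁ u)).comp (synthesisOp lam e₂ u) := by
  rw [adjoint_synthesisOp]
  exact HaarSystem.IsRegularRep.at_eq lam ha u
    (analysisOp_synthesisOp_isRegular lam e₁ e₂ hf u)

end Operators

/-! ### Hilbert modules over the reduced C⋆-algebra -/

namespace HilbertModule

variable {A : Type*} {V : Type*} [NonUnitalCStarAlgebra A] [NormedAddCommGroup V]
    [NormedSpace ℂ V] [CompleteSpace V] [HilbertModule A V]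

theorem norm_ip_self_add_le (x y : V) :
    ‖(ip x y + ip y x : A)‖ ≤ 3 * (‖x‖ ^ 2 + ‖y‖ ^ 2) := by
  have h1 : (ip x y + ip y x : A) = ip (x + y) (x + y) - ip x x - ip y y := by
    rw [ip_add_right, ip_add_left, ip_add_left]
    abel
  rw [h1]
  refine (norm_sub_le _ _).trans ?_
  have h2 := norm_sub_le (ip (x + y) (x + y) : A) (ip x x)
  rw [← norm_sq_eq, ← norm_sq_eq] at h2
  rw [← norm_sq_eq]
  have h3 := norm_add_le x y
  nlinarith [norm_nonneg (x + y), sq_nonneg (‖x‖ - ‖y‖)]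

theorem norm_ip_le_sq (x y : V) : ‖(ip x y : A)‖ ≤ 3 * (‖x‖ ^ 2 + ‖y‖ ^ 2) := by
  have h1 := norm_ip_self_add_le (A := A) x y
  have h2 := norm_ip_self_add_le (A := A) x (Complex.I • y)
  have h3 : (2 : ℂ) • (ip x y : A) = (ip x y + ip y x) -
      Complex.I • (ip x (Complex.I • y) + ip (Complex.I • y) x) := by
    rw [ip_smul_right, ip_smul_left, smul_add, smul_smul, smul_smul]
    simp only [RCLike.star_def, Complex.conj_I, Complex.I_mul_I, mul_neg, neg_neg]
    module
  have h4 := norm_sub_le (ip x y + ip y x : A)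
    (Complex.I • (ip x (Complex.I • y) + ip (Complex.I • y) x))
  rw [← h3, norm_smul, norm_smul] at h4
  simp only [Complex.norm_ofNat, Complex.norm_I, one_mul] at h4
  rw [norm_smul, Complex.norm_I, one_mul] at h2
  linarith

theorem ip_zero_right (x : V) : (ip x 0 : A) = 0 := by
  simpa using ip_smul_right (A := A) 0 x (0 : V)

theorem ip_zero_left (x : V) : (ip 0 x : A) = 0 := by
  rw [← star_ip, ip_zero_right, star_zero]

/-- A crude Cauchy-Schwarz inequality, from the polarization identity. The constant is irrelevant:
only the continuity of the inner product is deduced from it. -/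
theorem norm_ip_le_six (x y : V) : ‖(ip x y : A)‖ ≤ 6 * (‖x‖ * ‖y‖) := by
  by_cases hx : x = 0
  · simp [hx, ip_zero_left]
  by_cases hy : y = 0
  · simp [hy, ip_zero_right]
  have hx' : 0 < ‖x‖ := norm_pos_iff.2 hx
  have hy' : 0 < ‖y‖ := norm_pos_iff.2 hy
  have h := norm_ip_le_sq (A := A) (((‖x‖⁻¹ : ℝ) : ℂ) • x) (((‖y‖⁻¹ : ℝ) : ℂ) • y)
  rw [ip_smul_right, ip_smul_left] at h
  simp only [norm_smul, norm_star, Complex.norm_real, norm_inv, norm_norm] at h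
  rw [inv_mul_cancel₀ hx'.ne', inv_mul_cancel₀ hy'.ne', ← mul_assoc, ← mul_inv,
    inv_mul_le_iff₀ (by positivity)] at h
  linarith

theorem continuous_ip_right (x : V) : Continuous fun y => (ip x y : A) := by
  let L : V →ₗ[ℂ] A :=
    { toFun := fun y => ip x y
      map_add' := ip_add_right x
      map_smul' := fun c y => ip_smul_right c x y }
  exact (L.mkContinuous (6 * ‖x‖) fun y => (norm_ip_le_six x y).trans_eq (by ring)).continuous

theorem continuous_ip_left (y : V) : Continuous fun x => (ip x y : A) := by
  have h : Continuous fun x => star (ip y x : A) := (continuous_ip_right y).star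
  simpa only [star_ip] using h

end HilbertModule

section RegularProduct

variable {m k : ℕ} {M : Type uM} {G : Type uG}
  [TopologicalSpace M] [ChartedSpace (EuclideanSpace ℝ (Fin m)) M]
  [TopologicalSpace G] [ChartedSpace (EuclideanSpace ℝ (Fin k)) G]
  {𝒢 : LieGroupoid m k M G} [MeasurableSpace G] {lam : HaarSystem 𝒢}

namespace HaarSystem.RegularProduct

@[ext]
theorem ext {a b : lam.RegularProduct} (h : ∀ u, a.at u = b.at u) : a = b :=
  Subtype.ext (funext h)

theorem at_star (a : lam.RegularProduct) (u : M) : (star a).at u = star (a.at u) := rfl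

theorem norm_at_le (a : lam.RegularProduct) (u : M) : ‖a.at u‖ ≤ ‖a‖ :=
  lp.norm_apply_le_norm (by simp)
    (show lp (fun u : M => Lp ℂ 2 (lam.measSource u) →L[ℂ] Lp ℂ 2 (lam.measSource u)) ∞ from a) u

theorem norm_le {a : lam.RegularProduct} {C : ℝ} (hC : 0 ≤ C) (h : ∀ u, ‖a.at u‖ ≤ C) : ‖a‖ ≤ C :=
  lp.norm_le_of_forall_le (f := show lp (fun u : M => Lp ℂ 2 (lam.measSource u) →L[ℂ]
    Lp ℂ 2 (lam.measSource u)) ∞ from a) hC h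

theorem continuous_at (u : M) : Continuous fun a : lam.RegularProduct => a.at u := by
  refine Metric.continuous_iff.2 fun a ε hε => ⟨ε, hε, fun b hb => ?_⟩
  rw [dist_eq_norm] at hb ⊢
  exact (norm_at_le (b - a) u).trans_lt hb

end HaarSystem.RegularProduct

end RegularProduct

section Completion

variable {m k d z : ℕ} {M : Type uM} {G : Type uG} {X : Type uX} {Z : Type uZ}
  [TopologicalSpace M] [ChartedSpace (EuclideanSpace ℝ (Fin m)) M]
  [TopologicalSpace G] [ChartedSpace (EuclideanSpace ℝ (Fin k)) G]
  [TopologicalSpace X] [ChartedSpace (EuclideanSpace ℝ (Fin d)) X]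
  [TopologicalSpace Z] [ChartedSpace (EuclideanSpace ℝ (Fin z)) Z]
  {𝒢 : LieGroupoid m k M G}
  {F : Type uF} [NormedAddCommGroup F] [NormedSpace ℂ F]
  {E : X → Type uE} [∀ x, NormedAddCommGroup (E x)] [∀ x, InnerProductSpace ℂ (E x)]
  [TopologicalSpace (TotalSpace F E)] [FiberBundle F E] [VectorBundle ℂ F E]
  [CompactSpace Z] [MeasurableSpace X] [BorelSpace X] {𝒳 : GFibreBundle 𝒢 d z X Z}
  {ℰ : GHermitianBundle 𝒳 F E} {μ : InvariantMeasures 𝒳}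
  [T2Space X] [SecondCountableTopology X] [FiniteDimensional ℂ F] [T2Space M]
  [LocallyCompactSpace M] [LocallyCompactSpace X]
  [MeasurableSpace G] [BorelSpace G] [T2Space G] [SecondCountableTopology G]
  [LocallyCompactSpace G] (lam : HaarSystem 𝒢)
  [Fact 𝒢.IsProper] [Fact 𝒢.IsGCompact]

instance synthesisNormedAddCommGroup (u : M) :
    NormedAddCommGroup (Lp ℂ 2 (lam.measSource u) →L[ℂ] L2Fibre ℰ μ u) :=
  ContinuousLinearMap.toNormedAddCommGroup

instance synthesisNormedSpace (u : M) :
    NormedSpace ℂ (Lp ℂ 2 (lam.measSource u) →L[ℂ] L2Fibre ℰ μ u) :=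
  ContinuousLinearMap.toNormedSpace

variable (ℰ μ) in
/-- The Banach space of uniformly bounded families of operators `L²(G_u, λ_u) → 𝔥^u`, in which the
Hilbert module of `𝔥` is realised. -/
def SynthesisSpace : Type _ :=
  lp (fun u : M => Lp ℂ 2 (lam.measSource u) →L[ℂ] L2Fibre ℰ μ u) ∞

namespace SynthesisSpace

variable {lam}

instance : NormedAddCommGroup (SynthesisSpace ℰ μ lam) :=
  inferInstanceAs (NormedAddCommGroup
    (lp (fun u : M => Lp ℂ 2 (lam.measSource u) →L[ℂ] L2Fibre ℰ μ u) ∞))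

instance : NormedSpace ℂ (SynthesisSpace ℰ μ lam) :=
  inferInstanceAs (NormedSpace ℂ
    (lp (fun u : M => Lp ℂ 2 (lam.measSource u) →L[ℂ] L2Fibre ℰ μ u) ∞))

instance : CompleteSpace (SynthesisSpace ℰ μ lam) :=
  inferInstanceAs (CompleteSpace
    (lp (fun u : M => Lp ℂ 2 (lam.measSource u) →L[ℂ] L2Fibre ℰ μ u) ∞))

/-- The operator at the unit `u` of a family of operators. -/
def op (x : SynthesisSpace ℰ μ lam) (u : M) : Lp ℂ 2 (lam.measSource u) →L[ℂ] L2Fibre ℰ μ u :=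
  x.1 u

/-- A uniformly bounded family of operators as an element of the Banach space. -/
def of (x : ∀ u, Lp ℂ 2 (lam.measSource u) →L[ℂ] L2Fibre ℰ μ u) (hx : ∃ C, ∀ u, ‖x u‖ ≤ C) :
    SynthesisSpace ℰ μ lam :=
  ⟨x, by
    obtain ⟨C, hC⟩ := hx
    exact memℓp_infty ⟨C, by rintro _ ⟨u, rfl⟩; exact hC u⟩⟩

@[ext]
theorem ext {x y : SynthesisSpace ℰ μ lam} (h : ∀ u, x.op u = y.op u) : x = y :=
  Subtype.ext (funext h)

theorem op_add (x y : SynthesisSpace ℰ μ lam) (u : M) : (x + y).op u = x.op u + y.op u := rfl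

theorem op_smul (c : ℂ) (x : SynthesisSpace ℰ μ lam) (u : M) : (c • x).op u = c • x.op u := rfl

theorem norm_le {x : SynthesisSpace ℰ μ lam} {C : ℝ} (hC : 0 ≤ C) (h : ∀ u, ‖x.op u‖ ≤ C) :
    ‖x‖ ≤ C :=
  lp.norm_le_of_forall_le (f := show lp (fun u : M => Lp ℂ 2 (lam.measSource u) →L[ℂ]
    L2Fibre ℰ μ u) ∞ from x) hC h

theorem norm_op_le (x : SynthesisSpace ℰ μ lam) (u : M) : ‖x.op u‖ ≤ ‖x‖ :=
  lp.norm_apply_le_norm (by simp)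
    (show lp (fun u : M => Lp ℂ 2 (lam.measSource u) →L[ℂ] L2Fibre ℰ μ u) ∞ from x) u

theorem continuous_op (u : M) : Continuous fun x : SynthesisSpace ℰ μ lam => x.op u := by
  refine Metric.continuous_iff.2 fun a ε hε => ⟨ε, hε, fun b hb => ?_⟩
  rw [dist_eq_norm] at hb ⊢
  exact (norm_op_le (b - a) u).trans_lt hb

/-- The C⋆-identity for the operator-valued inner product of `SynthesisSpace`. -/
theorem norm_sq_eq {x : SynthesisSpace ℰ μ lam} {a : lam.RegularProduct}
    (h : ∀ u, a.at u = (ContinuousLinearMap.adjoint (x.op u)).comp (x.op u)) : ‖x‖ ^ 2 = ‖a‖ := by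
  have h1 : ∀ u, ‖a.at u‖ = ‖x.op u‖ * ‖x.op u‖ := fun u => by
    rw [h u, ContinuousLinearMap.norm_adjoint_comp_self]
  refine le_antisymm ?_ (HaarSystem.RegularProduct.norm_le (sq_nonneg _) fun u => ?_)
  · have h2 : ‖x‖ ≤ √‖a‖ := norm_le (Real.sqrt_nonneg _) fun u => by
      refine Real.le_sqrt_of_sq_le ?_
      rw [sq, ← h1]
      exact HaarSystem.RegularProduct.norm_at_le a u
    calc ‖x‖ ^ 2 ≤ √‖a‖ ^ 2 := pow_le_pow_left₀ (norm_nonneg _) h2 2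
      _ = ‖a‖ := Real.sq_sqrt (norm_nonneg _)
  · rw [h1, sq]
    exact mul_self_le_mul_self (norm_nonneg _) (norm_op_le x u)

end SynthesisSpace

variable (ℰ μ) in
/-- The map that sends a section to the family of its synthesis operators. -/
def synthesis : gammaC ℰ μ →ₗ[ℂ] SynthesisSpace ℰ μ lam where
  toFun e := .of (fun u => synthesisOp lam e u) (exists_norm_synthesisOp_le lam Fact.out e)
  map_add' e e' := SynthesisSpace.ext fun u => synthesisOp_add lam e e' u
  map_smul' c e := SynthesisSpace.ext fun u => synthesisOp_smul lam c e u

theorem op_synthesis (e : gammaC ℰ μ) (u : M) :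
    (synthesis ℰ μ lam e).op u = synthesisOp lam e u := rfl

/-- The realisation of a completion of `Γ_c(𝔥)` by families of operators `L²(G_u, λ_u) → 𝔥^u`,
the continuous extension of `synthesis` along `ι` (zero if there is none). -/
def realise (lam : HaarSystem 𝒢) {Γ : Type*} [NormedAddCommGroup Γ] [NormedSpace ℂ Γ]
    (ι : gammaC ℰ μ →ₗ[ℂ] Γ) : Γ →L[ℂ] SynthesisSpace ℰ μ lam :=
  (synthesis ℰ μ lam).extendOfNorm ι

/-- The map `ι` has dense range, and the norm of `ι e` is that of the family of synthesis operators
of `e`. -/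
structure IsNormCompletion (lam : HaarSystem 𝒢) {Γ : Type*} [NormedAddCommGroup Γ]
    [NormedSpace ℂ Γ] (ι : gammaC ℰ μ →ₗ[ℂ] Γ) : Prop where
  dense : DenseRange ι
  norm_coe : ∀ e, ‖ι e‖ = ‖synthesis ℰ μ lam e‖

variable {Γ : Type*} [NormedAddCommGroup Γ] [NormedSpace ℂ Γ]

namespace IsNormCompletion

variable {lam} {ι : gammaC ℰ μ →ₗ[ℂ] Γ}

theorem realise_coe (h : IsNormCompletion lam ι) (e : gammaC ℰ μ) :
    realise lam ι (ι e) = synthesis ℰ μ lam e :=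
  LinearMap.extendOfNorm_eq h.dense ⟨1, fun e => by rw [one_mul, h.norm_coe]⟩ e

theorem norm_realise (h : IsNormCompletion lam ι) (x : Γ) : ‖realise lam ι x‖ = ‖x‖ := by
  refine h.dense.induction (fun y hy => ?_) (isClosed_eq (by fun_prop) (by fun_prop)) x
  obtain ⟨e, rfl⟩ := hy
  rw [h.realise_coe, h.norm_coe]

theorem isometry_realise (h : IsNormCompletion lam ι) : Isometry (realise lam ι) :=
  AddMonoidHomClass.isometry_of_norm (realise lam ι) h.norm_realise

theorem realise_injective (h : IsNormCompletion lam ι) : Function.Injective (realise lam ι) :=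
  h.isometry_realise.injective

end IsNormCompletion

variable [CompleteSpace Γ] [HilbertModule lam.CRed Γ] {ι : gammaC ℰ μ →ₗ[ℂ] Γ}

namespace IsModuleCompletion

open HilbertModule

variable {lam}

theorem at_ip_coe (h : IsModuleCompletion lam ι) (e₁ e₂ : gammaC ℰ μ) (u : M) :
    (ip (ι e₁) (ι e₂) : lam.CRed).1.at u =
      (ContinuousLinearMap.adjoint (synthesisOp lam e₁ u)).comp (synthesisOp lam e₂ u) := by
  obtain ⟨f, hf, hreg⟩ := h.inner_eq e₁ e₂
  exact HaarSystem.IsRegularRep.at_eq_comp lam hf hreg u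

theorem norm_coe (h : IsModuleCompletion lam ι) (e : gammaC ℰ μ) :
    ‖ι e‖ = ‖synthesis ℰ μ lam e‖ := by
  have h1 := HilbertModule.norm_sq_eq (A := lam.CRed) (ι e)
  have h2 := SynthesisSpace.norm_sq_eq (x := synthesis ℰ μ lam e) (h.at_ip_coe e e)
  have h3 : ‖ι e‖ ^ 2 = ‖synthesis ℰ μ lam e‖ ^ 2 := by rw [h1, h2]; rfl
  exact (pow_left_inj₀ (norm_nonneg _) (norm_nonneg _) two_ne_zero).1 h3

theorem isNormCompletion (h : IsModuleCompletion lam ι) : IsNormCompletion lam ι :=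
  ⟨h.dense, h.norm_coe⟩

theorem realise_coe (h : IsModuleCompletion lam ι) (e : gammaC ℰ μ) :
    realise lam ι (ι e) = synthesis ℰ μ lam e :=
  h.isNormCompletion.realise_coe e

theorem norm_realise (h : IsModuleCompletion lam ι) (x : Γ) : ‖realise lam ι x‖ = ‖x‖ :=
  h.isNormCompletion.norm_realise x

theorem ext_op (h : IsModuleCompletion lam ι) {x y : Γ}
    (hxy : ∀ u, (realise lam ι x).op u = (realise lam ι y).op u) : x = y :=
  h.isNormCompletion.realise_injective (SynthesisSpace.ext hxy)

theorem continuous_realise_op (lam : HaarSystem 𝒢) {Γ : Type*} [NormedAddCommGroup Γ]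
    [NormedSpace ℂ Γ] (ι : gammaC ℰ μ →ₗ[ℂ] Γ) (u : M) :
    Continuous fun x => (realise lam ι x).op u :=
  (SynthesisSpace.continuous_op u).comp (realise lam ι).continuous

/-- Under the realisation, the inner product of the module is `(x, y) ↦ (x_u⋆ y_u)_u`. -/
theorem at_ip (h : IsModuleCompletion lam ι) (x y : Γ) (u : M) :
    (ip x y : lam.CRed).1.at u =
      (ContinuousLinearMap.adjoint ((realise lam ι x).op u)).comp ((realise lam ι y).op u) := by
  have hc : Continuous fun a : lam.CRed => a.1.at u :=
    (HaarSystem.RegularProduct.continuous_at u).comp continuous_subtype_val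
  have hr := continuous_realise_op lam ι u
  refine h.dense.induction (fun x' hx => ?_) (isClosed_eq (hc.comp (continuous_ip_left y)) ?_) x
  · obtain ⟨e₁, rfl⟩ := hx
    refine h.dense.induction (fun y' hy => ?_) (isClosed_eq (hc.comp (continuous_ip_right _)) ?_) y
    · obtain ⟨e₂, rfl⟩ := hy
      rw [h.at_ip_coe, h.realise_coe, h.realise_coe, op_synthesis, op_synthesis]
    · exact continuous_const.clm_comp hr
  · exact ((LinearIsometryEquiv.continuous _).comp hr).clm_comp continuous_const

/-- The adjoints of the operators that realise the elements of a completion separate vectors. -/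
theorem eq_zero_of_adjoint_realise (h : IsModuleCompletion lam ι) (u : M) (η : L2Fibre ℰ μ u)
    (hη : ∀ x : Γ, ContinuousLinearMap.adjoint ((realise lam ι x).op u) η = 0) : η = 0 :=
  eq_zero_of_analysisOp_eq_zero lam u η fun e => by
    rw [← adjoint_synthesisOp, ← op_synthesis, ← h.realise_coe]
    exact hη (ι e)

/-- Under the realisation, the module action is the composition of operators. -/
theorem realise_ract (h : IsModuleCompletion lam ι) (x : Γ) (a : lam.CRed) (u : M) :
    (realise lam ι (ract x a)).op u = ((realise lam ι x).op u).comp (a.1.at u) := by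
  refine ContinuousLinearMap.ext fun ξ => sub_eq_zero.1 (h.eq_zero_of_adjoint_realise u _ fun y => ?_)
  have h1 := congrArg (fun b : lam.CRed => b.1.at u) (ip_ract_right y x a)
  have h2 : (ip y x * a : lam.CRed).1.at u = ((ip y x : lam.CRed).1.at u).comp (a.1.at u) := rfl
  rw [h2, h.at_ip, h.at_ip] at h1
  have h3 := congrArg (fun S => S ξ) h1
  rw [map_sub, sub_eq_zero]
  exact h3

end IsModuleCompletion
end Completion

/-! ### The representation of the bounded equivariant morphisms -/

/-- A self-adjoint operator `R` satisfies `‖R‖ ≤ ρ` as soon as `‖Rⁿ v‖` grows at most like `ρⁿ` for a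
dense set of vectors `v`. -/
theorem norm_le_of_pow_le {H : Type*} [NormedAddCommGroup H] [InnerProductSpace ℂ H]
    [CompleteSpace H] {R : H →L[ℂ] H} (hR : IsSelfAdjoint R) {ρ : ℝ} (hρ : 0 ≤ ρ)
    (hd : Dense {v : H | ∃ C, ∀ n : ℕ, ‖(R ^ n) v‖ ≤ C * ρ ^ n}) : ‖R‖ ≤ ρ := by
  refine R.opNorm_le_bound hρ fun v => ?_
  refine hd.induction (P := fun v => ‖R v‖ ≤ ρ * ‖v‖) ?_
    (isClosed_le R.continuous.norm (continuous_const.mul continuous_norm)) v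
  rintro v ⟨C, hC⟩
  by_cases hv : v = 0
  · simp [hv]
  have hv0 : 0 < ‖v‖ := norm_pos_iff.2 hv
  -- log-convexity of the norms of the powers
  have hsq : ∀ n : ℕ, ‖(R ^ n) v‖ ^ 2 ≤ ‖v‖ * ‖(R ^ (2 * n)) v‖ := by
    intro n
    have h1 : (inner ℂ ((R ^ n) v) ((R ^ n) v) : ℂ) = inner ℂ v ((R ^ (2 * n)) v) := by
      have h2 : ContinuousLinearMap.adjoint (R ^ n) = R ^ n := (hR.pow n)
      rw [← ContinuousLinearMap.adjoint_inner_right, h2, two_mul, pow_add]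
      rfl
    have h3 := norm_inner_le_norm (𝕜 := ℂ) v ((R ^ (2 * n)) v)
    rw [← h1, inner_self_eq_norm_sq_to_K, norm_pow] at h3
    simpa using h3
  have hpow : ∀ j : ℕ, (‖R v‖ / ‖v‖) ^ (2 ^ j) ≤ ‖(R ^ (2 ^ j)) v‖ / ‖v‖ := by
    intro j
    induction j with
    | zero => simp
    | succ j ih =>
      rw [pow_succ 2 j, pow_mul (‖R v‖ / ‖v‖)]
      refine (pow_le_pow_left₀ (by positivity) ih 2).trans ?_
      have := hsq (2 ^ j)
      rw [div_pow, mul_comm (2 ^ j) 2, div_le_div_iff₀ (by positivity) hv0]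
      nlinarith
  by_contra hcon
  push Not at hcon
  set q := ‖R v‖ / ‖v‖ with hq
  have hρq : ρ < q := by rwa [hq, lt_div_iff₀ hv0]
  rcases hρ.eq_or_lt with h0 | hpos
  · have h1 := hC 1
    rw [← h0] at h1 hcon
    simp only [pow_one, mul_zero, zero_mul] at h1 hcon
    linarith
  have hq0 : 1 < q / ρ := by rwa [one_lt_div hpos]
  obtain ⟨n, hn⟩ := pow_unbounded_of_one_lt (C / ‖v‖) hq0
  have h1 : (q / ρ) ^ (2 ^ n) ≤ C / ‖v‖ := by
    rw [div_pow, div_le_iff₀ (by positivity)]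
    refine (hpow n).trans ?_
    rw [div_mul_eq_mul_div]
    exact div_le_div_of_nonneg_right (hC _) hv0.le
  have h2 : (q / ρ) ^ n ≤ (q / ρ) ^ (2 ^ n) :=
    pow_le_pow_right₀ hq0.le Nat.lt_two_pow_self.le
  linarith

section Morphisms

variable {m k d z : ℕ} {M : Type uM} {G : Type uG} {X : Type uX} {Z : Type uZ}
  [TopologicalSpace M] [ChartedSpace (EuclideanSpace ℝ (Fin m)) M]
  [TopologicalSpace G] [ChartedSpace (EuclideanSpace ℝ (Fin k)) G]
  [TopologicalSpace X] [ChartedSpace (EuclideanSpace ℝ (Fin d)) X]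
  [TopologicalSpace Z] [ChartedSpace (EuclideanSpace ℝ (Fin z)) Z]
  {𝒢 : LieGroupoid m k M G}
  {F : Type uF} [NormedAddCommGroup F] [NormedSpace ℂ F]
  {E : X → Type uE} [∀ x, NormedAddCommGroup (E x)] [∀ x, InnerProductSpace ℂ (E x)]
  [TopologicalSpace (TotalSpace F E)] [FiberBundle F E] [VectorBundle ℂ F E]
  [CompactSpace Z] [MeasurableSpace X] [BorelSpace X] {𝒳 : GFibreBundle 𝒢 d z X Z}
  {ℰ : GHermitianBundle 𝒳 F E} {μ : InvariantMeasures 𝒳}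
  [T2Space X] [SecondCountableTopology X] [FiniteDimensional ℂ F] [T2Space M]
  [LocallyCompactSpace M] [LocallyCompactSpace X]
  [MeasurableSpace G] [BorelSpace G] [T2Space G] [SecondCountableTopology G]
  [LocallyCompactSpace G] (lam : HaarSystem 𝒢)
  [Fact 𝒢.IsProper] [Fact 𝒢.IsGCompact]
  {Γ : Type uV} [NormedAddCommGroup Γ] [NormedSpace ℂ Γ] [CompleteSpace Γ]
  [HilbertModule lam.CRed Γ] {ι : gammaC ℰ μ →ₗ[ℂ] Γ}

theorem norm_le_iSup (T : boundedMorphisms ℰ μ) (u : M) : ‖T.1 u‖ ≤ ⨆ u, ‖T.1 u‖ :=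
  le_ciSup T.2.2.1 u

theorem iSup_norm_nonneg (T : boundedMorphisms ℰ μ) : 0 ≤ ⨆ u, ‖T.1 u‖ :=
  Real.iSup_nonneg fun _ => norm_nonneg _

/-- `applySection` as a linear map. -/
def applySectionLin (T : boundedMorphisms ℰ μ) : gammaC ℰ μ →ₗ[ℂ] gammaC ℰ μ where
  toFun := applySection T
  map_add' _ _ := Subtype.ext (funext fun u => (T.1 u).map_add _ _)
  map_smul' _ _ := Subtype.ext (funext fun u => (T.1 u).map_smul _ _)

theorem op_synthesis_applySection (T : boundedMorphisms ℰ μ) (e : gammaC ℰ μ) (u : M) :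
    (synthesis ℰ μ lam (applySection T e)).op u = (T.1 u).comp ((synthesis ℰ μ lam e).op u) :=
  synthesisOp_applySection lam T e u

theorem norm_synthesis_applySection_le (T : boundedMorphisms ℰ μ) (e : gammaC ℰ μ) :
    ‖synthesis ℰ μ lam (applySection T e)‖ ≤ (⨆ u, ‖T.1 u‖) * ‖synthesis ℰ μ lam e‖ := by
  refine SynthesisSpace.norm_le (mul_nonneg (iSup_norm_nonneg T) (norm_nonneg _)) fun u => ?_
  rw [op_synthesis_applySection]
  exact (ContinuousLinearMap.opNorm_comp_le _ _).trans (mul_le_mul (norm_le_iSup T u)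
    (SynthesisSpace.norm_op_le _ u) (norm_nonneg _) (iSup_norm_nonneg T))

namespace IsModuleCompletion

open HilbertModule

variable {lam}

/-- The operator on a completion of `Γ_c(𝔥)` induced by a bounded equivariant
morphism: the continuous extension of `e ↦ T e` (zero if there is none). -/
def moduleMap (ι : gammaC ℰ μ →ₗ[ℂ] Γ) (T : boundedMorphisms ℰ μ) : Γ →L[ℂ] Γ :=
  (ι ∘ₗ applySectionLin T).extendOfNorm ι

theorem norm_coe_applySection_le (h : IsModuleCompletion lam ι) (T : boundedMorphisms ℰ μ)
    (e : gammaC ℰ μ) : ‖(ι ∘ₗ applySectionLin T) e‖ ≤ (⨆ u, ‖T.1 u‖) * ‖ι e‖ := by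
  change ‖ι (applySection T e)‖ ≤ _
  rw [h.norm_coe, h.norm_coe]
  exact norm_synthesis_applySection_le lam T e

theorem moduleMap_coe (h : IsModuleCompletion lam ι) (T : boundedMorphisms ℰ μ) (e : gammaC ℰ μ) :
    moduleMap ι T (ι e) = ι (applySection T e) :=
  LinearMap.extendOfNorm_eq h.dense ⟨_, h.norm_coe_applySection_le T⟩ e

theorem norm_moduleMap_le (h : IsModuleCompletion lam ι) (T : boundedMorphisms ℰ μ) :
    ‖moduleMap ι T‖ ≤ ⨆ u, ‖T.1 u‖ :=
  ContinuousLinearMap.opNorm_le_bound _ (iSup_norm_nonneg T)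
    (LinearMap.norm_extendOfNorm_apply_le h.dense _ (h.norm_coe_applySection_le T))

theorem realise_moduleMap (h : IsModuleCompletion lam ι) (T : boundedMorphisms ℰ μ) (x : Γ)
    (u : M) : (realise lam ι (moduleMap ι T x)).op u = (T.1 u).comp ((realise lam ι x).op u) := by
  have hr := continuous_realise_op lam ι u
  refine h.dense.induction (fun y hy => ?_) (isClosed_eq
    (hr.comp (moduleMap ι T).continuous) (continuous_const.clm_comp hr)) x
  obtain ⟨e, rfl⟩ := hy
  rw [h.moduleMap_coe, h.realise_coe, h.realise_coe, op_synthesis_applySection]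

theorem ip_moduleMap (h : IsModuleCompletion lam ι) (T : boundedMorphisms ℰ μ) (x y : Γ) :
    (ip (moduleMap ι T x) y : lam.CRed) = ip x (moduleMap ι (star T) y) := by
  refine Subtype.ext (HaarSystem.RegularProduct.ext fun u => ?_)
  rw [h.at_ip, h.at_ip, h.realise_moduleMap, h.realise_moduleMap,
    ContinuousLinearMap.adjoint_comp]
  rfl

theorem moduleMap_one (h : IsModuleCompletion lam ι) : moduleMap ι (1 : boundedMorphisms ℰ μ) = 1 :=
  ContinuousLinearMap.ext fun x => h.ext_op fun u => by
    rw [h.realise_moduleMap]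
    exact ContinuousLinearMap.id_comp _

theorem moduleMap_mul (h : IsModuleCompletion lam ι) (S T : boundedMorphisms ℰ μ) :
    moduleMap ι (S * T) = moduleMap ι S * moduleMap ι T :=
  ContinuousLinearMap.ext fun x => h.ext_op fun u => by
    rw [mul_apply_eq_comp, h.realise_moduleMap, h.realise_moduleMap,
      h.realise_moduleMap]
    exact ContinuousLinearMap.comp_assoc _ _ _

theorem moduleMap_add (h : IsModuleCompletion lam ι) (S T : boundedMorphisms ℰ μ) :
    moduleMap ι (S + T) = moduleMap ι S + moduleMap ι T :=
  ContinuousLinearMap.ext fun x => h.ext_op fun u => by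
    rw [add_apply, map_add, SynthesisSpace.op_add, h.realise_moduleMap,
      h.realise_moduleMap, h.realise_moduleMap]
    exact ContinuousLinearMap.add_comp _ _ _

theorem moduleMap_algebraMap (h : IsModuleCompletion lam ι) (c : ℂ) :
    moduleMap ι (algebraMap ℂ (boundedMorphisms ℰ μ) c) = c • 1 :=
  ContinuousLinearMap.ext fun x => h.ext_op fun u => by
    rw [smul_apply, map_smul, SynthesisSpace.op_smul, h.realise_moduleMap]
    exact ContinuousLinearMap.smul_comp _ _ _

/-- The representation of the bounded equivariant morphisms of `𝔥` by adjointable operators. -/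
def repr (h : IsModuleCompletion lam ι) :
    boundedMorphisms ℰ μ →⋆ₐ[ℂ] adjointable lam.CRed Γ where
  toFun T := ⟨moduleMap ι T, moduleMap ι (star T), h.ip_moduleMap T⟩
  map_one' := Subtype.ext h.moduleMap_one
  map_mul' S T := Subtype.ext (h.moduleMap_mul S T)
  map_zero' := Subtype.ext (by
    have h1 := h.moduleMap_algebraMap 0
    rwa [map_zero, zero_smul] at h1)
  map_add' S T := Subtype.ext (h.moduleMap_add S T)
  commutes' c := Subtype.ext ((h.moduleMap_algebraMap c).trans
    (Algebra.algebraMap_eq_smul_one c).symm)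
  map_star' T := (eq_star_of_ip (h.ip_moduleMap T)).symm

theorem norm_ip_le (h : IsModuleCompletion lam ι) (x y : Γ) :
    ‖(ip x y : lam.CRed)‖ ≤ ‖x‖ * ‖y‖ := by
  refine HaarSystem.RegularProduct.norm_le (a := (ip x y : lam.CRed).1) (by positivity) fun u => ?_
  rw [h.at_ip]
  refine (ContinuousLinearMap.opNorm_comp_le _ _).trans ?_
  rw [LinearIsometryEquiv.norm_map, ← h.norm_realise x, ← h.norm_realise y]
  exact mul_le_mul (SynthesisSpace.norm_op_le _ u) (SynthesisSpace.norm_op_le _ u) (norm_nonneg _)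
    (norm_nonneg _)

theorem norm_adjoint_le (h : IsModuleCompletion lam ι) {S S' : Γ →L[ℂ] Γ}
    (hS : ∀ x y, (ip (S x) y : lam.CRed) = ip x (S' y)) : ‖S'‖ ≤ ‖S‖ := by
  refine ContinuousLinearMap.opNorm_le_bound _ (norm_nonneg _) fun y => ?_
  by_cases h0 : S' y = 0
  · rw [h0, norm_zero]; positivity
  have hpos := norm_pos_iff.2 h0
  have h1 := HilbertModule.norm_sq_eq (A := lam.CRed) (S' y)
  rw [← hS] at h1
  have h2 := h.norm_ip_le (S (S' y)) y
  rw [← h1] at h2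
  have h3 := S.le_opNorm (S' y)
  have h4 : ‖S' y‖ * ‖S' y‖ ≤ ‖S‖ * ‖y‖ * ‖S' y‖ := by
    nlinarith [norm_nonneg y]
  exact le_of_mul_le_mul_right h4 hpos

/-- The vectors `V_u(x) ξ` span a dense subspace of `𝔥^u`. -/
theorem dense_span_realise (h : IsModuleCompletion lam ι) (u : M) :
    Dense (Submodule.span ℂ {v : L2Fibre ℰ μ u | ∃ (x : Γ) (ξ : Lp ℂ 2 (lam.measSource u)),
      (realise lam ι x).op u ξ = v} : Set (L2Fibre ℰ μ u)) := by
  rw [Submodule.dense_iff_topologicalClosure_eq_top,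
    Submodule.topologicalClosure_eq_top_iff, Submodule.eq_bot_iff]
  intro η hη
  refine h.eq_zero_of_adjoint_realise u η fun x => ext_inner_left ℂ fun ξ => ?_
  rw [ContinuousLinearMap.adjoint_inner_right, inner_zero_right]
  exact (Submodule.mem_orthogonal _ _).1 hη _ (Submodule.subset_span ⟨x, ξ, rfl⟩)

/-- Each component of a morphism is bounded by the norm of the operator that it induces: the powers
of `T⋆T` grow on the dense subspace of vectors `V_u(x) ξ` like the powers of the induced operator. -/
theorem norm_apply_le_norm_moduleMap (h : IsModuleCompletion lam ι) (T : boundedMorphisms ℰ μ)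
    (u : M) : ‖T.1 u‖ ≤ ‖moduleMap ι T‖ := by
  set R : boundedMorphisms ℰ μ := star T * T with hR
  have hRu : R.1 u = star (T.1 u) * T.1 u := rfl
  have hsa : IsSelfAdjoint (R.1 u) := by rw [hRu]; exact IsSelfAdjoint.star_mul_self _
  have hbound : ‖moduleMap ι R‖ ≤ ‖moduleMap ι T‖ ^ 2 := by
    rw [hR, h.moduleMap_mul, sq]
    exact (norm_mul_le _ _).trans (mul_le_mul_of_nonneg_right
      (h.norm_adjoint_le (h.ip_moduleMap T)) (norm_nonneg _))
  have hpow : ∀ (n : ℕ) (x : Γ), (realise lam ι ((moduleMap ι R ^ n) x)).op u =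
      (R.1 u ^ n).comp ((realise lam ι x).op u) := by
    intro n
    induction n with
    | zero => intro x; rfl
    | succ n ih =>
      intro x
      rw [pow_succ, pow_succ, mul_apply_eq_comp, ih, h.realise_moduleMap]
      rfl
  have hnorm : ∀ (n : ℕ) (x : Γ), ‖(moduleMap ι R ^ n) x‖ ≤ (‖moduleMap ι T‖ ^ 2) ^ n * ‖x‖ := by
    intro n
    induction n with
    | zero => intro x; simp
    | succ n ih =>
      intro x
      rw [pow_succ (moduleMap ι R), mul_apply_eq_comp, pow_succ, mul_assoc]
      refine (ih _).trans (mul_le_mul_of_nonneg_left ?_ (by positivity))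
      exact (ContinuousLinearMap.le_opNorm _ _).trans
        (mul_le_mul_of_nonneg_right hbound (norm_nonneg _))
  have key : ‖R.1 u‖ ≤ ‖moduleMap ι T‖ ^ 2 := by
    refine norm_le_of_pow_le hsa (sq_nonneg _) ((h.dense_span_realise u).mono fun v hv => ?_)
    induction hv using Submodule.span_induction with
    | mem v hv =>
      obtain ⟨x, ξ, rfl⟩ := hv
      refine ⟨‖x‖ * ‖ξ‖, fun n => ?_⟩
      have h1 : (R.1 u ^ n) ((realise lam ι x).op u ξ) =
          (realise lam ι ((moduleMap ι R ^ n) x)).op u ξ := by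
        rw [hpow]
        rfl
      rw [h1]
      refine (ContinuousLinearMap.le_opNorm _ _).trans ?_
      have h2 := SynthesisSpace.norm_op_le (realise lam ι ((moduleMap ι R ^ n) x)) u
      rw [h.norm_realise] at h2
      have h3 := hnorm n x
      calc _ ≤ ((‖moduleMap ι T‖ ^ 2) ^ n * ‖x‖) * ‖ξ‖ :=
            mul_le_mul_of_nonneg_right (h2.trans h3) (norm_nonneg _)
        _ = _ := by ring
    | zero => exact ⟨0, fun n => by simp⟩
    | add v w _ _ hv hw =>
      obtain ⟨C, hC⟩ := hv
      obtain ⟨D, hD⟩ := hw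
      refine ⟨C + D, fun n => ?_⟩
      rw [map_add, add_mul]
      exact (norm_add_le _ _).trans (add_le_add (hC n) (hD n))
    | smul c v _ hv =>
      obtain ⟨C, hC⟩ := hv
      refine ⟨‖c‖ * C, fun n => ?_⟩
      rw [map_smul, norm_smul, mul_assoc]
      exact mul_le_mul_of_nonneg_left (hC n) (norm_nonneg _)
  have h5 : ‖star (T.1 u) * T.1 u‖ = ‖T.1 u‖ * ‖T.1 u‖ :=
    ContinuousLinearMap.norm_adjoint_comp_self _
  rw [hRu, h5, ← sq] at key
  exact (pow_le_pow_iff_left₀ (norm_nonneg _) (norm_nonneg _) two_ne_zero).1 key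

theorem norm_repr (h : IsModuleCompletion lam ι) (T : boundedMorphisms ℰ μ) :
    ‖h.repr T‖ = ⨆ u, ‖T.1 u‖ :=
  le_antisymm (h.norm_moduleMap_le T)
    (Real.iSup_le (fun u => h.norm_apply_le_norm_moduleMap T u) (norm_nonneg _))

theorem repr_injective (h : IsModuleCompletion lam ι) : Function.Injective h.repr := by
  rw [injective_iff_map_eq_zero]
  intro T hT
  have h1 := h.norm_repr T
  rw [hT] at h1
  change ‖(0 : Γ →L[ℂ] Γ)‖ = _ at h1
  rw [norm_zero] at h1
  refine Subtype.ext (funext fun u => norm_le_zero_iff.1 ?_)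
  exact (norm_le_iSup T u).trans h1.ge

end IsModuleCompletion
end Morphisms

section RankOne

variable {m k d z : ℕ} {M : Type uM} {G : Type uG} {X : Type uX} {Z : Type uZ}
  [TopologicalSpace M] [ChartedSpace (EuclideanSpace ℝ (Fin m)) M]
  [TopologicalSpace G] [ChartedSpace (EuclideanSpace ℝ (Fin k)) G]
  [TopologicalSpace X] [ChartedSpace (EuclideanSpace ℝ (Fin d)) X]
  [TopologicalSpace Z] [ChartedSpace (EuclideanSpace ℝ (Fin z)) Z]
  {𝒢 : LieGroupoid m k M G}
  {F : Type uF} [NormedAddCommGroup F] [NormedSpace ℂ F]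
  {E : X → Type uE} [∀ x, NormedAddCommGroup (E x)] [∀ x, InnerProductSpace ℂ (E x)]
  [TopologicalSpace (TotalSpace F E)] [FiberBundle F E] [VectorBundle ℂ F E]
  [CompactSpace Z] [MeasurableSpace X] [BorelSpace X] {𝒳 : GFibreBundle 𝒢 d z X Z}
  {ℰ : GHermitianBundle 𝒳 F E} {μ : InvariantMeasures 𝒳}
  [T2Space X] [SecondCountableTopology X] [FiniteDimensional ℂ F] [T2Space M]
  [LocallyCompactSpace M] [LocallyCompactSpace X]
  [MeasurableSpace G] [BorelSpace G] [T2Space G] [SecondCountableTopology G]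
  [LocallyCompactSpace G] (lam : HaarSystem 𝒢)
  [Fact 𝒢.IsProper] [Fact 𝒢.IsGCompact]
  {Γ : Type uV} [NormedAddCommGroup Γ] [NormedSpace ℂ Γ] [CompleteSpace Γ]
  [HilbertModule lam.CRed Γ] {ι : gammaC ℰ μ →ₗ[ℂ] Γ}

/-! ### Rank one morphisms -/

/-- A bounded family of operators is continuous on `𝔥` if it maps the sections that define
the topology to continuous sections. -/
theorem continuous_of_sections {T : ∀ u, L2Fibre ℰ μ u →L[ℂ] L2Fibre ℰ μ u} {C : ℝ}
    (hC : ∀ u, ‖T u‖ ≤ C)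
    (h : ∀ f : ℰ.ccSec, Continuous fun u => (⟨u, T u (ℰ.field μ f u)⟩ : L2Bundle ℰ μ)) :
    Continuous fun ξ : L2Bundle ℰ μ => (⟨ξ.base, T ξ.base ξ.vec⟩ : L2Bundle ℰ μ) := by
  refine L2Bundle.continuous_of_locally_uniform L2Bundle.continuous_base fun ξ₀ ε hε => ?_
  have hC0 : 0 ≤ C := (norm_nonneg _).trans (hC ξ₀.base)
  have hpos : 0 < ε / (C + 1) := by positivity
  obtain ⟨f, hf⟩ := ℰ.exists_field_near ξ₀.vec hpos
  refine ⟨fun ξ => T ξ.base (ℰ.field μ f ξ.base), (h f).comp L2Bundle.continuous_base, ?_⟩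
  filter_upwards [(L2Bundle.isOpen_tube f isOpen_univ _).mem_nhds ⟨mem_univ _, hf⟩] with ξ hξ
  have h1 : ‖ξ.vec - ℰ.field μ f ξ.base‖ < ε / (C + 1) := hξ.2
  rw [← map_sub]
  refine ((T ξ.base).le_of_opNorm_le (hC _) _).trans_lt ?_
  rw [lt_div_iff₀ (by positivity)] at h1
  nlinarith [norm_nonneg (ξ.vec - ℰ.field μ f ξ.base)]

/-- The operators `T(e₁, e₂)^u`, as compositions of analysis and synthesis operators. -/
def rankOneOp (e₁ e₂ : gammaC ℰ μ) (u : M) : L2Fibre ℰ μ u →L[ℂ] L2Fibre ℰ μ u :=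
  (synthesisOp lam e₁ u).comp (analysisOp lam e₂ u)

theorem integrable_rankOne (e₁ e₂ : gammaC ℰ μ) (u : M) (ξ : L2Fibre ℰ μ u) :
    Integrable (fun g => (inner ℂ (orb e₂.1 u g) ξ : ℂ) • orb e₁.1 u g) (lam.meas u) := by
  have hφ : Continuous fun g => (inner ℂ (orb e₂.1 u g) ξ : ℂ) :=
    Continuous.inner (𝕜 := ℂ) (continuous_orb e₂.2.1 u) continuous_const
  have hc : HasCompactSupport fun g => (inner ℂ (orb e₂.1 u g) ξ : ℂ) :=
    (hasCompactSupport_orb e₂ u).comp_left (g := fun v => (inner ℂ v ξ : ℂ)) (inner_zero_left _)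
  exact (hφ.smul (continuous_orb e₁.2.1 u)).integrable_of_hasCompactSupport hc.smul_right

theorem rankOneOp_apply (e₁ e₂ : gammaC ℰ μ) (u : M) (ξ : L2Fibre ℰ μ u) :
    rankOneOp lam e₁ e₂ u ξ =
      ∫ g, (inner ℂ (orb e₂.1 u g) ξ : ℂ) • orb e₁.1 u g ∂(lam.meas u) := by
  rw [rankOneOp, ContinuousLinearMap.comp_apply,
    synthesisOp_apply lam e₁ u (continuous_orbCoeff e₂ u ξ) (coeFn_analysisOp lam e₂ u ξ)]
  simp only [orbCoeff, Homeomorph.symm_apply_apply]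

theorem star_rankOneOp (e₁ e₂ : gammaC ℰ μ) (u : M) :
    star (rankOneOp lam e₁ e₂ u) = rankOneOp lam e₂ e₁ u := by
  rw [ContinuousLinearMap.star_eq_adjoint, rankOneOp, rankOneOp, ContinuousLinearMap.adjoint_comp,
    adjoint_synthesisOp]
  rfl

theorem exists_norm_rankOneOp_le (e₁ e₂ : gammaC ℰ μ) :
    ∃ C, ∀ u, ‖rankOneOp lam e₁ e₂ u‖ ≤ C := by
  obtain ⟨C₁, h₁⟩ := exists_norm_synthesisOp_le lam Fact.out e₁
  obtain ⟨C₂, h₂⟩ := exists_norm_synthesisOp_le lam Fact.out e₂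
  refine ⟨C₁ * C₂, fun u => (ContinuousLinearMap.opNorm_comp_le _ _).trans ?_⟩
  rw [← adjoint_synthesisOp, LinearIsometryEquiv.norm_map]
  exact mul_le_mul (h₁ u) (h₂ u) (norm_nonneg _) ((norm_nonneg _).trans (h₁ u))

theorem continuous_rankOneOp_section (e₁ e₂ e : gammaC ℰ μ) :
    Continuous fun u => (⟨u, rankOneOp lam e₁ e₂ u (e.1 u)⟩ : L2Bundle ℰ μ) := by
  obtain ⟨K, hK, heK⟩ := e₂.2.2
  have hφ : Continuous fun g => (inner ℂ (L2Fibre.transl ℰ μ g rfl rfl (e₂.1 (𝒢.s g)))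
      (e.1 (𝒢.r g)) : ℂ) :=
    L2Bundle.continuous_inner (L2Fibre.continuous_transl e₂.2.1) (e.2.1.comp 𝒢.continuous_r)
  have h := continuous_integral_orb lam e₁.2.1 hφ
    ((Fact.out : 𝒢.IsProper).isFibrewiseCompact hK) fun g hg => by
      rw [heK _ hg, map_zero, inner_zero_left]
  refine h.congr fun u => ?_
  rw [rankOneOp_apply]
  congr 1
  refine integral_congr_ae (ae_of_all _ fun g => ?_)
  obtain ⟨g, rfl⟩ := g
  rfl

theorem isMorphism_rankOneOp (e₁ e₂ : gammaC ℰ μ) : IsMorphism (rankOneOp lam e₁ e₂) := by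
  have key : ∀ e₁ e₂ : gammaC ℰ μ, Continuous fun ξ : L2Bundle ℰ μ =>
      (⟨ξ.base, rankOneOp lam e₁ e₂ ξ.base ξ.vec⟩ : L2Bundle ℰ μ) := fun e₁ e₂ => by
    obtain ⟨C, hC⟩ := exists_norm_rankOneOp_le lam e₁ e₂
    exact continuous_of_sections hC fun f =>
      continuous_rankOneOp_section lam e₁ e₂ (ℰ.toGammaC μ f)
  refine ⟨key e₁ e₂, ?_⟩
  simp_rw [star_rankOneOp]
  exact key e₂ e₁

theorem isEquivariant_rankOneOp (e₁ e₂ : gammaC ℰ μ) : IsEquivariant (rankOneOp lam e₁ e₂) := by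
  intro g ξ
  rw [rankOneOp_apply, rankOneOp_apply, ← lam.integral_leftMul g rfl rfl,
    ← ContinuousLinearMap.integral_comp_comm _ (integrable_rankOne lam e₁ e₂ _ ξ)]
  refine integral_congr_ae (ae_of_all _ fun h => ?_)
  simp only [← transl_orb, L2Fibre.inner_transl, map_smul]

/-- The morphism `T(e₁, e₂)`. -/
def rankOne (e₁ e₂ : gammaC ℰ μ) : boundedMorphisms ℰ μ :=
  ⟨rankOneOp lam e₁ e₂, isMorphism_rankOneOp lam e₁ e₂, by
    obtain ⟨C, hC⟩ := exists_norm_rankOneOp_le lam e₁ e₂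
    exact ⟨C, by rintro _ ⟨u, rfl⟩; exact hC u⟩, isEquivariant_rankOneOp lam e₁ e₂⟩

/-- The morphisms `T(e₁, e₂)` are compact: approximating the translates of `e₁` by sections over the
units shows that the images of the unit balls are close to bounded sets in finite dimensional
subspaces. -/
theorem rankOne_mem_compactMorphisms (e₁ e₂ : gammaC ℰ μ) :
    rankOne lam e₁ e₂ ∈ compactMorphisms ℰ μ := by
  intro A hA
  obtain ⟨K₂, hK₂, hK₂0⟩ := e₂.2.2
  have hS := (Fact.out : 𝒢.IsProper).isFibrewiseCompact hK₂
  obtain ⟨K, hK, hSK⟩ := hS A hA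
  have hn : Continuous fun g => ‖e₂.1 (𝒢.s g)‖ :=
    (L2Bundle.continuous_norm e₂.2.1).comp 𝒢.continuous_s
  have hn0 : ∀ g ∉ 𝒢.s ⁻¹' K₂, ‖e₂.1 (𝒢.s g)‖ = 0 := fun g hg => by rw [hK₂0 _ hg, norm_zero]
  obtain ⟨B, hB⟩ := hA.bddAbove_image (lam.continuous_integral_real hn hS hn0).continuousOn
  refine L2Bundle.isCompact_closure_of_approx hA ?_ fun ε hε => ?_
  · rintro _ ⟨u, hu, ξ, -, rfl⟩
    exact hu
  have hpos : 0 < ε / (|B| + 1) := by positivity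
  obtain ⟨t, ρ, f, hρ0, hρc, hρ⟩ := exists_approx_orb e₁.2.1 hK hpos
  have hb : ∀ i, Continuous fun u => ∫ g : Fib 𝒢.r u, ‖e₂.1 (𝒢.s g.1)‖ * ρ i g.1 ∂(lam.meas u) :=
    fun i => lam.continuous_integral_real (φ := fun g => ‖e₂.1 (𝒢.s g)‖ * ρ i g)
      (hn.mul (ρ i).continuous) hS fun g hg => by rw [hn0 g hg, zero_mul]
  have hD : ∃ D : ℝ, ∀ i, ∀ u ∈ A,
      ∫ g : Fib 𝒢.r u, ‖e₂.1 (𝒢.s g.1)‖ * ρ i g.1 ∂(lam.meas u) ≤ D := by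
    choose D hD using fun i => hA.bddAbove_image (hb i).continuousOn
    refine ⟨∑ i, |D i|, fun i u hu => ?_⟩
    exact ((hD i (mem_image_of_mem _ hu)).trans (le_abs_self _)).trans
      (Finset.single_le_sum (f := fun i => |D i|) (fun _ _ => abs_nonneg _) (Finset.mem_univ i))
  obtain ⟨D, hD⟩ := hD
  have hcont : Continuous fun q : M × (t → ℂ) =>
      (⟨q.1, ∑ i, q.2 i • ℰ.field μ (f i) q.1⟩ : L2Bundle ℰ μ) :=
    L2Bundle.continuous_sum _ continuous_fst fun i _ => L2Bundle.continuous_smul_fun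
      (by fun_prop) ((L2Bundle.continuous_field (f i)).comp continuous_fst)
  refine ⟨_, (hA.prod (isCompact_univ_pi fun i : t => isCompact_closedBall (0 : ℂ) D)).image hcont, ?_⟩
  rintro _ ⟨u, hu, ξ, hξ, rfl⟩
  have hφ : Continuous fun g => (inner ℂ (orb e₂.1 u g) ξ : ℂ) :=
    Continuous.inner (𝕜 := ℂ) (continuous_orb e₂.2.1 u) continuous_const
  have hφc : HasCompactSupport fun g => (inner ℂ (orb e₂.1 u g) ξ : ℂ) :=
    (hasCompactSupport_orb e₂ u).comp_left (g := fun v => (inner ℂ v ξ : ℂ)) (inner_zero_left _)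
  have hφn : ∀ g, ‖(inner ℂ (orb e₂.1 u g) ξ : ℂ)‖ ≤ ‖e₂.1 (𝒢.s g.1)‖ := fun g => by
    refine (norm_inner_le_norm _ _).trans ?_
    rw [norm_orb]
    exact mul_le_of_le_one_right (norm_nonneg _) hξ
  have hnu : Continuous fun g : Fib 𝒢.r u => ‖e₂.1 (𝒢.s g.1)‖ := hn.comp continuous_subtype_val
  have hnc : HasCompactSupport fun g : Fib 𝒢.r u => ‖e₂.1 (𝒢.s g.1)‖ :=
    hS.hasCompactSupport_fib u fun g hg => hn0 _ hg
  refine ⟨∑ i, (∫ g, (inner ℂ (orb e₂.1 u g) ξ : ℂ) * ρ i g.1 ∂(lam.meas u)) • ℰ.field μ (f i) u,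
    ⟨(u, fun i => ∫ g, (inner ℂ (orb e₂.1 u g) ξ : ℂ) * ρ i g.1 ∂(lam.meas u)),
      ⟨hu, fun i _ => ?_⟩, rfl⟩, ?_⟩
  · rw [mem_closedBall_zero_iff]
    refine (norm_integral_le_of_norm_le (Continuous.integrable_of_hasCompactSupport
      (hnu.mul (by fun_prop)) hnc.mul_right) (ae_of_all _ fun g => ?_)).trans (hD i u hu)
    rw [norm_mul, Complex.norm_real, Real.norm_of_nonneg (hρ0 i g.1)]
    exact mul_le_mul_of_nonneg_right (hφn g) (hρ0 i g.1)
  · change ‖rankOneOp lam e₁ e₂ u ξ - _‖ ≤ ε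
    rw [rankOneOp_apply]
    refine (norm_integral_orb_sub_le lam e₁.2.1 (hρ u) hφ hφc fun g hg => ?_).trans ?_
    · have : 𝒢.s g.1 ∉ K₂ := fun h => hg (hSK ⟨h, by rw [mem_preimage, g.2]; exact hu⟩)
      rw [orb, hK₂0 _ this, map_zero, inner_zero_left]
    · have h1 : ∫ g, ‖(inner ℂ (orb e₂.1 u g) ξ : ℂ)‖ ∂(lam.meas u) ≤ B :=
        (integral_mono (hφ.norm.integrable_of_hasCompactSupport hφc.norm)
          (hnu.integrable_of_hasCompactSupport hnc) hφn).trans (hB (mem_image_of_mem _ hu))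
      rw [div_mul_eq_mul_div, div_le_iff₀ (by positivity)]
      exact mul_le_mul_of_nonneg_left (by linarith [le_abs_self B]) hε.le

theorem IsModuleCompletion.moduleMap_rankOne {lam : HaarSystem 𝒢} [HilbertModule lam.CRed Γ]
    (h : IsModuleCompletion lam ι) (e₁ e₂ : gammaC ℰ μ) (x : Γ) :
    IsModuleCompletion.moduleMap ι (rankOne lam e₁ e₂) x =
      HilbertModule.ract (ι e₁) (HilbertModule.ip (ι e₂) x : lam.CRed) := by
  refine h.ext_op fun u => ?_
  rw [h.realise_moduleMap, h.realise_ract, h.at_ip, h.realise_coe, h.realise_coe, op_synthesis,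
    op_synthesis, adjoint_synthesisOp]
  rfl

end RankOne

/-! ### Regularised projections -/

section RegularisedProjection

variable {H : Type*} [NormedAddCommGroup H] [InnerProductSpace ℂ H] {n : Type*} [Fintype n]
  [DecidableEq n]

/-- The coefficient matrix `(K + δ)⁻¹` of the regularised projection onto the span of vectors with
Gram matrix `K`. -/
def regCoeff (δ : ℝ) (K : Matrix n n ℂ) : Matrix n n ℂ := (K + (δ : ℂ) • 1)⁻¹

/-- The regularised projection `ζ ↦ ∑ ((K + δ)⁻¹)ᵢⱼ ⟪fⱼ, ζ⟫ fᵢ` onto the span of vectors `fᵢ` with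
Gram matrix `K`. Unlike the orthogonal projection it depends continuously on the vectors. -/
def regProj (δ : ℝ) (f : n → H) (ζ : H) : H :=
  ∑ j, ∑ i, (regCoeff δ (Matrix.gram ℂ f) i j * inner ℂ (f j) ζ) • f i

open scoped ComplexOrder in
theorem isUnit_det_gram_add {δ : ℝ} (hδ : 0 < δ) (f : n → H) :
    IsUnit (Matrix.gram ℂ f + (δ : ℂ) • 1).det := by
  have h1 : ((δ : ℂ) • (1 : Matrix n n ℂ)).PosDef :=
    Matrix.PosDef.one.smul (by exact_mod_cast hδ)
  exact ((Matrix.isUnit_iff_isUnit_det _).1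
    (Matrix.PosDef.posSemidef_add (Matrix.posSemidef_gram ℂ f) h1).isUnit)

/-- The coefficients `a = (K + δ)⁻¹ (⟪fᵢ, ζ⟫)ᵢ` of the regularised projection satisfy `(K + δ) a =
(⟪fᵢ, ζ⟫)ᵢ`, so that `δ a` measures how far the residual is from being orthogonal to the vectors. -/
theorem exists_coeff_regProj {δ : ℝ} (hδ : 0 < δ) (f : n → H) (ζ : H) :
    ∃ a : n → ℂ, regProj δ f ζ = ∑ i, a i • f i ∧
      ∀ i, (inner ℂ (f i) (ζ - regProj δ f ζ) : ℂ) = δ * a i := by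
  set K := Matrix.gram ℂ f + (δ : ℂ) • (1 : Matrix n n ℂ) with hK
  set b : n → ℂ := fun j => inner ℂ (f j) ζ with hb
  have hP : regProj δ f ζ = ∑ i, (K⁻¹.mulVec b) i • f i := by
    rw [regProj, Finset.sum_comm]
    refine Finset.sum_congr rfl fun i _ => ?_
    rw [Matrix.mulVec, dotProduct, Finset.sum_smul]
    rfl
  refine ⟨K⁻¹.mulVec b, hP, fun i => ?_⟩
  have h1 : K.mulVec (K⁻¹.mulVec b) = b := by
    rw [Matrix.mulVec_mulVec, Matrix.mul_nonsing_inv _ (isUnit_det_gram_add hδ f), Matrix.one_mulVec]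
  have h2 := congrFun h1 i
  rw [hK, Matrix.add_mulVec, Pi.add_apply, Matrix.smul_mulVec, Matrix.one_mulVec, ← hK] at h2
  have h3 : (Matrix.gram ℂ f).mulVec (K⁻¹.mulVec b) i = inner ℂ (f i) (regProj δ f ζ) := by
    rw [hP, inner_sum, Matrix.mulVec, dotProduct]
    refine Finset.sum_congr rfl fun j _ => ?_
    rw [Matrix.gram_apply, inner_smul_right, mul_comm]
  rw [h3, Pi.smul_apply, smul_eq_mul] at h2
  rw [inner_sub_right]
  linear_combination -h2

theorem re_inner_regProj {δ : ℝ} {f : n → H} {ζ : H} {a : n → ℂ}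
    (h1 : regProj δ f ζ = ∑ i, a i • f i)
    (h2 : ∀ i, (inner ℂ (f i) (ζ - regProj δ f ζ) : ℂ) = δ * a i) :
    (inner ℂ (regProj δ f ζ) (ζ - regProj δ f ζ) : ℂ).re = δ * ∑ i, ‖a i‖ ^ 2 := by
  have h3 : (inner ℂ (regProj δ f ζ) (ζ - regProj δ f ζ) : ℂ) = ((δ * ∑ i, ‖a i‖ ^ 2 : ℝ) : ℂ) := by
    nth_rewrite 1 [h1]
    rw [sum_inner]
    push_cast
    rw [Finset.mul_sum]
    refine Finset.sum_congr rfl fun i _ => ?_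
    rw [inner_smul_left, h2, ← Complex.conj_mul']
    ring
  rw [h3, Complex.ofReal_re]

theorem norm_sub_regProj_le {δ : ℝ} (hδ : 0 < δ) (f : n → H) (ζ : H) :
    ‖ζ - regProj δ f ζ‖ ≤ ‖ζ‖ := by
  obtain ⟨a, h1, h2⟩ := exists_coeff_regProj hδ f ζ
  have h3 := re_inner_regProj h1 h2
  have h4 := norm_add_sq (𝕜 := ℂ) (regProj δ f ζ) (ζ - regProj δ f ζ)
  rw [add_sub_cancel] at h4
  have h5 : RCLike.re (inner ℂ (regProj δ f ζ) (ζ - regProj δ f ζ) : ℂ) = δ * ∑ i, ‖a i‖ ^ 2 := h3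
  have h6 : 0 ≤ ∑ i, ‖a i‖ ^ 2 := Finset.sum_nonneg fun i _ => sq_nonneg _
  rw [h5] at h4
  refine le_of_sq_le_sq ?_ (norm_nonneg _)
  nlinarith [sq_nonneg ‖regProj δ f ζ‖, mul_nonneg hδ.le h6]

/-- The squared residual of the vector `f l` is `δ (Re a_l - ∑ |aᵢ|²) ≤ δ`. -/
theorem norm_sub_regProj_self_le {δ : ℝ} (hδ : 0 < δ) (f : n → H) (l : n) :
    ‖f l - regProj δ f (f l)‖ ^ 2 ≤ δ := by
  obtain ⟨a, h1, h2⟩ := exists_coeff_regProj hδ f (f l)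
  have h3 := re_inner_regProj h1 h2
  set r := f l - regProj δ f (f l) with hr
  have h4 : ‖r‖ ^ 2 = (δ * a l : ℂ).re - δ * ∑ i, ‖a i‖ ^ 2 := by
    rw [← h2 l, ← h3, ← Complex.sub_re, ← inner_sub_left, ← hr]
    exact (inner_self_eq_norm_sq (𝕜 := ℂ) r).symm
  have h5 : ‖a l‖ ^ 2 ≤ ∑ i, ‖a i‖ ^ 2 :=
    Finset.single_le_sum (f := fun i => ‖a i‖ ^ 2) (fun _ _ => sq_nonneg _) (Finset.mem_univ l)
  have h6 := Complex.re_le_norm (a l)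
  rw [Complex.re_ofReal_mul] at h4
  rw [h4, ← mul_sub]
  refine mul_le_of_le_one_right hδ.le ?_
  nlinarith [sq_nonneg (‖a l‖ - 1)]

theorem regProj_sub (δ : ℝ) (f : n → H) (ζ ζ' : H) :
    regProj δ f (ζ - ζ') = regProj δ f ζ - regProj δ f ζ' := by
  simp only [regProj, inner_sub_right, mul_sub, sub_smul, Finset.sum_sub_distrib]

/-- The regularised projection with parameter `ε²` moves a vector that is `ε`-close to one of the
spanning vectors by at most `2 ε`. -/
theorem norm_sub_regProj_le_of_near {ε : ℝ} (hε : 0 < ε) (f : n → H) {ζ : H} {l : n}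
    (h : ‖ζ - f l‖ ≤ ε) : ‖ζ - regProj (ε ^ 2) f ζ‖ ≤ 2 * ε := by
  have h1 : ζ - regProj (ε ^ 2) f ζ = ((ζ - f l) - regProj (ε ^ 2) f (ζ - f l)) +
      (f l - regProj (ε ^ 2) f (f l)) := by
    rw [regProj_sub]
    abel
  have h2 : ‖f l - regProj (ε ^ 2) f (f l)‖ ≤ ε :=
    le_of_sq_le_sq (norm_sub_regProj_self_le (by positivity) f l) hε.le
  rw [h1]
  refine (norm_add_le _ _).trans ?_
  linarith [norm_sub_regProj_le (δ := ε ^ 2) (by positivity) f (ζ - f l)]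

theorem continuous_regCoeff {Y : Type*} [TopologicalSpace Y] {δ : ℝ} (hδ : 0 < δ)
    {V : Y → Type*} [∀ y, NormedAddCommGroup (V y)] [∀ y, InnerProductSpace ℂ (V y)]
    {v : ∀ y, n → V y} (hv : ∀ i j, Continuous fun y => (inner ℂ (v y i) (v y j) : ℂ)) :
    Continuous fun y => regCoeff δ (Matrix.gram ℂ (v y)) := by
  have hK : Continuous fun y => Matrix.gram ℂ (v y) := continuous_matrix hv
  rw [continuous_iff_continuousAt]
  intro y
  have h1 : ContinuousAt Inv.inv (Matrix.gram ℂ (v y) + (δ : ℂ) • 1) := by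
    refine continuousAt_matrix_inv _ ?_
    rw [Ring.inverse_eq_inv']
    exact continuousAt_inv₀ (isUnit_det_gram_add hδ (v y)).ne_zero
  exact ContinuousAt.comp (g := Inv.inv) (f := fun y => Matrix.gram ℂ (v y) + (δ : ℂ) • 1) h1
    (hK.add continuous_const).continuousAt

end RegularisedProjection

section Compact

variable {m k d z : ℕ} {M : Type uM} {G : Type uG} {X : Type uX} {Z : Type uZ}
  [TopologicalSpace M] [ChartedSpace (EuclideanSpace ℝ (Fin m)) M]
  [TopologicalSpace G] [ChartedSpace (EuclideanSpace ℝ (Fin k)) G]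
  [TopologicalSpace X] [ChartedSpace (EuclideanSpace ℝ (Fin d)) X]
  [TopologicalSpace Z] [ChartedSpace (EuclideanSpace ℝ (Fin z)) Z]
  {𝒢 : LieGroupoid m k M G}
  {F : Type uF} [NormedAddCommGroup F] [NormedSpace ℂ F]
  {E : X → Type uE} [∀ x, NormedAddCommGroup (E x)] [∀ x, InnerProductSpace ℂ (E x)]
  [TopologicalSpace (TotalSpace F E)] [FiberBundle F E] [VectorBundle ℂ F E]
  [CompactSpace Z] [MeasurableSpace X] [BorelSpace X] {𝒳 : GFibreBundle 𝒢 d z X Z}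
  {ℰ : GHermitianBundle 𝒳 F E} {μ : InvariantMeasures 𝒳}
  [T2Space X] [SecondCountableTopology X] [FiniteDimensional ℂ F] [T2Space M]
  [LocallyCompactSpace M] [LocallyCompactSpace X]
  [MeasurableSpace G] [BorelSpace G] [T2Space G] [SecondCountableTopology G]
  [LocallyCompactSpace G] (lam : HaarSystem 𝒢)
  [Fact 𝒢.IsProper] [Fact 𝒢.IsGCompact]

/-! ### Compact morphisms -/

theorem compactMorphisms_smul (c : ℂ) {T : boundedMorphisms ℰ μ} (hT : T ∈ compactMorphisms ℰ μ) :
    c • T ∈ compactMorphisms ℰ μ := by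
  intro A hA
  refine ((hT A hA).image (L2Bundle.continuous_smul c
    (continuous_id (X := L2Bundle ℰ μ)))).closure_of_subset ?_
  rintro _ ⟨u, hu, ξ, hξ, rfl⟩
  exact ⟨_, subset_closure ⟨u, hu, ξ, hξ, rfl⟩, rfl⟩

theorem compactMorphisms_add {S T : boundedMorphisms ℰ μ} (hS : S ∈ compactMorphisms ℰ μ)
    (hT : T ∈ compactMorphisms ℰ μ) : S + T ∈ compactMorphisms ℰ μ := by
  intro A hA
  -- addition is continuous on the fibre product of two copies of the bundle
  let Y := {q : L2Bundle ℰ μ × L2Bundle ℰ μ // q.2.base = q.1.base}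
  have hY : Topology.IsClosedEmbedding (Subtype.val : Y → _) :=
    (isClosed_eq (L2Bundle.continuous_base.comp continuous_snd)
      (L2Bundle.continuous_base.comp continuous_fst)).isClosedEmbedding_subtypeVal
  let w : ∀ q : Y, L2Fibre ℰ μ q.1.1.base := fun q => q.2 ▸ q.1.2.vec
  have hw : ∀ q : Y, (⟨q.1.1.base, w q⟩ : L2Bundle ℰ μ) = q.1.2 := by
    rintro ⟨⟨⟨b, v⟩, ⟨b', v'⟩⟩, h⟩
    cases h
    rfl
  have hadd : Continuous fun q : Y => (⟨q.1.1.base, q.1.1.vec + w q⟩ : L2Bundle ℰ μ) := by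
    refine L2Bundle.continuous_add (continuous_fst.comp continuous_subtype_val) ?_
    simp_rw [hw]
    exact continuous_snd.comp continuous_subtype_val
  refine ((hY.isCompact_preimage ((hS A hA).prod (hT A hA))).image hadd).closure_of_subset ?_
  rintro _ ⟨u, hu, ξ, hξ, rfl⟩
  exact ⟨⟨(⟨u, S.1 u ξ⟩, ⟨u, T.1 u ξ⟩), rfl⟩,
    ⟨subset_closure ⟨u, hu, ξ, hξ, rfl⟩, subset_closure ⟨u, hu, ξ, hξ, rfl⟩⟩, rfl⟩

theorem compactMorphisms_of_approx {T : boundedMorphisms ℰ μ}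
    (h : ∀ ε > 0, ∃ S ∈ compactMorphisms ℰ μ, ∀ u, ‖T.1 u - S.1 u‖ ≤ ε) :
    T ∈ compactMorphisms ℰ μ := by
  intro A hA
  refine L2Bundle.isCompact_closure_of_approx hA ?_ fun ε hε => ?_
  · rintro _ ⟨u, hu, ξ, -, rfl⟩
    exact hu
  obtain ⟨S, hS, hST⟩ := h ε hε
  refine ⟨_, hS A hA, ?_⟩
  rintro _ ⟨u, hu, ξ, hξ, rfl⟩
  refine ⟨S.1 u ξ, subset_closure ⟨u, hu, ξ, hξ, rfl⟩, ?_⟩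
  change ‖T.1 u ξ - S.1 u ξ‖ ≤ ε
  rw [← sub_apply]
  exact ((T.1 u - S.1 u).le_of_opNorm_le (hST u) ξ).trans (mul_le_of_le_one_right hε.le hξ)

theorem continuous_of_approx_uniform {T : ∀ u, L2Fibre ℰ μ u →L[ℂ] L2Fibre ℰ μ u}
    (h : ∀ ε > 0, ∃ S : ∀ u, L2Fibre ℰ μ u →L[ℂ] L2Fibre ℰ μ u, (Continuous fun ξ : L2Bundle ℰ μ =>
      (⟨ξ.base, S ξ.base ξ.vec⟩ : L2Bundle ℰ μ)) ∧ ∀ u, ‖T u - S u‖ ≤ ε) :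
    Continuous fun ξ : L2Bundle ℰ μ => (⟨ξ.base, T ξ.base ξ.vec⟩ : L2Bundle ℰ μ) := by
  refine L2Bundle.continuous_of_locally_uniform L2Bundle.continuous_base fun ξ₀ ε hε => ?_
  have hpos : 0 < ε / (‖ξ₀.vec‖ + 1) := by positivity
  obtain ⟨S, hS, hST⟩ := h _ hpos
  refine ⟨fun ξ => S ξ.base ξ.vec, hS, ?_⟩
  filter_upwards [L2Bundle.continuous_norm_vec.continuousAt.eventually_lt continuousAt_const
    (lt_add_one ‖ξ₀.vec‖)] with ξ hξ
  rw [← sub_apply]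
  refine ((T ξ.base - S ξ.base).le_of_opNorm_le (hST _) ξ.vec).trans_lt ?_
  rw [div_mul_eq_mul_div, div_lt_iff₀ (by positivity)]
  exact mul_lt_mul_of_pos_left hξ hε

/-- The bounded equivariant morphisms are complete for the supremum norm. -/
theorem exists_uniform_limit {T : ℕ → boundedMorphisms ℰ μ}
    (h : ∀ ε > 0, ∃ N, ∀ i ≥ N, ∀ j ≥ N, ∀ u, ‖(T i).1 u - (T j).1 u‖ ≤ ε) :
    ∃ S : boundedMorphisms ℰ μ, ∀ ε > 0, ∃ N, ∀ i ≥ N, ∀ u, ‖S.1 u - (T i).1 u‖ ≤ ε := by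
  have hc : ∀ u, CauchySeq fun i => (T i).1 u := fun u => by
    refine Metric.cauchySeq_iff'.2 fun ε hε => ?_
    obtain ⟨N, hN⟩ := h (ε / 2) (half_pos hε)
    exact ⟨N, fun i hi => by
      rw [dist_eq_norm]
      exact (hN i hi N le_rfl u).trans_lt (half_lt_self hε)⟩
  choose S hS using fun u => cauchySeq_tendsto_of_complete (hc u)
  have hST : ∀ ε > 0, ∃ N, ∀ i ≥ N, ∀ u, ‖S u - (T i).1 u‖ ≤ ε := fun ε hε => by
    obtain ⟨N, hN⟩ := h ε hε
    refine ⟨N, fun i hi u => ?_⟩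
    refine le_of_tendsto ((hS u).sub_const _).norm ?_
    filter_upwards [Filter.eventually_ge_atTop N] with j hj
    exact hN j hj i hi u
  refine ⟨⟨S, ⟨continuous_of_approx_uniform fun ε hε => ?_,
    continuous_of_approx_uniform (T := fun u => star (S u)) fun ε hε => ?_⟩, ?_, fun g ξ => ?_⟩, hST⟩
  · obtain ⟨N, hN⟩ := hST ε hε
    exact ⟨(T N).1, (T N).2.1.1, hN N le_rfl⟩
  · obtain ⟨N, hN⟩ := hST ε hε
    refine ⟨fun u => star ((T N).1 u), (T N).2.1.2, fun u => ?_⟩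
    rw [← star_sub, norm_star]
    exact hN N le_rfl u
  · obtain ⟨N, hN⟩ := hST 1 one_pos
    obtain ⟨C, hC⟩ := (T N).2.2.1
    refine ⟨1 + C, ?_⟩
    rintro _ ⟨u, rfl⟩
    have h1 := norm_add_le (S u - (T N).1 u) ((T N).1 u)
    rw [sub_add_cancel] at h1
    exact h1.trans (add_le_add (hN N le_rfl u) (hC ⟨u, rfl⟩))
  · have h1 := (((ContinuousLinearMap.apply ℂ (L2Fibre ℰ μ (𝒢.r g))
      (L2Fibre.transl ℰ μ g rfl rfl ξ)).continuous.tendsto _).comp (hS (𝒢.r g)))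
    have h2 := ((((L2Fibre.transl ℰ μ g rfl rfl).continuous.comp
      (ContinuousLinearMap.apply ℂ (L2Fibre ℰ μ (𝒢.s g)) ξ).continuous).tendsto _).comp
        (hS (𝒢.s g)))
    refine tendsto_nhds_unique h1 (h2.congr fun i => ?_)
    exact ((T i).2.2.2 g ξ).symm

end Compact

section CompactApprox

variable {m k d z : ℕ} {M : Type uM} {G : Type uG} {X : Type uX} {Z : Type uZ}
  [TopologicalSpace M] [ChartedSpace (EuclideanSpace ℝ (Fin m)) M]
  [TopologicalSpace G] [ChartedSpace (EuclideanSpace ℝ (Fin k)) G]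
  [TopologicalSpace X] [ChartedSpace (EuclideanSpace ℝ (Fin d)) X]
  [TopologicalSpace Z] [ChartedSpace (EuclideanSpace ℝ (Fin z)) Z]
  {𝒢 : LieGroupoid m k M G}
  {F : Type uF} [NormedAddCommGroup F] [NormedSpace ℂ F]
  {E : X → Type uE} [∀ x, NormedAddCommGroup (E x)] [∀ x, InnerProductSpace ℂ (E x)]
  [TopologicalSpace (TotalSpace F E)] [FiberBundle F E] [VectorBundle ℂ F E]
  [CompactSpace Z] [MeasurableSpace X] [BorelSpace X] {𝒳 : GFibreBundle 𝒢 d z X Z}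
  {ℰ : GHermitianBundle 𝒳 F E} {μ : InvariantMeasures 𝒳}
  [T2Space X] [SecondCountableTopology X] [FiniteDimensional ℂ F] [T2Space M]
  [LocallyCompactSpace M] [LocallyCompactSpace X]
  [MeasurableSpace G] [BorelSpace G] [T2Space G] [SecondCountableTopology G]
  [LocallyCompactSpace G] (lam : HaarSystem 𝒢)
  [Fact 𝒢.IsProper] [Fact 𝒢.IsGCompact]

theorem L2Fibre.transl_surjective {u v : M} (g : G) (hs : 𝒢.s g = u) (hr : 𝒢.r g = v)
    (ξ : L2Fibre ℰ μ v) : ∃ η : L2Fibre ℰ μ u, L2Fibre.transl ℰ μ g hs hr η = ξ := by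
  refine ⟨L2Fibre.transl ℰ μ (𝒢.inv g) ((𝒢.s_inv g).trans hr) ((𝒢.r_inv g).trans hs) ξ, ?_⟩
  have h1 := L2Fibre.transl_transl (𝒢.inv g) ((𝒢.s_inv g).trans hr) ((𝒢.r_inv g).trans hs) ξ
  simpa only [𝒢.inv_inv] using h1

/-- The vector `T ξ` is close to its regularised projection onto the span of the translates by `g` of
finitely many sections which, over `s g`, approximate the image of the unit ball under `T`. -/
theorem norm_sub_regProj_orb_le (T : boundedMorphisms ℰ μ) {ε : ℝ} (hε : 0 < ε)
    {t : Finset ℰ.ccSec} [DecidableEq t] {u : M} (g : Fib 𝒢.r u)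
    (ht : ∀ η : L2Fibre ℰ μ (𝒢.s g.1), ‖η‖ ≤ 1 →
      ∃ l ∈ t, ‖T.1 (𝒢.s g.1) η - ℰ.field μ l (𝒢.s g.1)‖ ≤ ε)
    {ξ : L2Fibre ℰ μ u} (hξ : ‖ξ‖ ≤ 1) :
    ‖T.1 u ξ - regProj (ε ^ 2) (fun i : t => orb (ℰ.field μ i.1) u g) (T.1 u ξ)‖ ≤ 2 * ε := by
  obtain ⟨g, rfl⟩ := g
  obtain ⟨η, hη⟩ := L2Fibre.transl_surjective (ℰ := ℰ) (μ := μ) g rfl rfl ξ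
  obtain ⟨l, hl, hlt⟩ := ht η (by rwa [← L2Fibre.norm_transl g rfl rfl η, hη])
  refine norm_sub_regProj_le_of_near hε _ (l := ⟨l, hl⟩) ?_
  have h2 : T.1 (𝒢.r g) ξ - orb (ℰ.field μ l) (𝒢.r g) ⟨g, rfl⟩ =
      L2Fibre.transl ℰ μ g rfl rfl (T.1 (𝒢.s g) η - ℰ.field μ l (𝒢.s g)) := by
    rw [map_sub, ← T.2.2.2, hη]
    rfl
  rw [h2, L2Fibre.norm_transl]
  exact hlt

theorem sum_rankOne_apply {n : Type*} [Fintype n] (p q : n → gammaC ℰ μ) (u : M)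
    (ξ : L2Fibre ℰ μ u) : (∑ j, rankOne lam (p j) (q j)).1 u ξ =
      ∫ g, ∑ j, (inner ℂ (orb (q j).1 u g) ξ : ℂ) • orb (p j).1 u g ∂(lam.meas u) := by
  have h1 : (∑ j, rankOne lam (p j) (q j)).1 u ξ = ∑ j, rankOneOp lam (p j) (q j) u ξ := by
    rw [AddSubmonoidClass.coe_finsetSum, Finset.sum_apply, sum_apply]
    rfl
  rw [h1, integral_finsetSum _ fun j _ => integrable_rankOne lam (p j) (q j) u ξ]
  exact Finset.sum_congr rfl fun j _ => rankOneOp_apply lam (p j) (q j) u ξ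

/-- If the integrands of a sum of operators `T(p, q)` are averages with weight `c(s g)` of vectors
that are close to `T ξ`, then the sum is close to `T`. -/
theorem norm_sub_sum_rankOne_le {n : Type*} [Fintype n] (p q : n → gammaC ℰ μ) {c : C(M, ℝ)}
    (hcc : HasCompactSupport c) (hc0 : ∀ u, 0 ≤ c u) {u : M}
    (hc1 : ∫ g : Fib 𝒢.r u, c (𝒢.s g) ∂(lam.meas u) = 1) {ζ ξ : L2Fibre ℰ μ u} {C : ℝ}
    {P : Fib 𝒢.r u → L2Fibre ℰ μ u}
    (hP : ∀ g, ∑ j, (inner ℂ (orb (q j).1 u g) ξ : ℂ) • orb (p j).1 u g = (c (𝒢.s g.1) : ℂ) • P g)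
    (hC : ∀ g : Fib 𝒢.r u, 𝒢.s g.1 ∈ tsupport c → ‖ζ - P g‖ ≤ C) :
    ‖ζ - (∑ j, rankOne lam (p j) (q j)).1 u ξ‖ ≤ C := by
  have hcu : Continuous fun g : Fib 𝒢.r u => c (𝒢.s g.1) :=
    c.continuous.comp (𝒢.continuous_s.comp continuous_subtype_val)
  have hcs : HasCompactSupport fun g : Fib 𝒢.r u => c (𝒢.s g.1) :=
    ((Fact.out : 𝒢.IsProper).isFibrewiseCompact hcc).hasCompactSupport_fib u fun g hg =>
      image_eq_zero_of_notMem_tsupport hg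
  have hci : Integrable (fun g : Fib 𝒢.r u => c (𝒢.s g.1)) (lam.meas u) :=
    hcu.integrable_of_hasCompactSupport hcs
  have hI1 : Integrable (fun g : Fib 𝒢.r u => (c (𝒢.s g.1) : ℂ) • ζ) (lam.meas u) :=
    hci.ofReal.smul_const ζ
  have hI2 : Integrable (fun g => (c (𝒢.s g.1) : ℂ) • P g) (lam.meas u) := by
    simp_rw [← hP]
    exact integrable_finsetSum _ fun j _ => integrable_rankOne lam (p j) (q j) u ξ
  have hζc : ζ = ∫ g : Fib 𝒢.r u, (c (𝒢.s g.1) : ℂ) • ζ ∂(lam.meas u) := by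
    rw [integral_smul_const, integral_complex_ofReal, hc1, Complex.ofReal_one, one_smul]
  rw [sum_rankOne_apply]
  simp_rw [hP]
  nth_rewrite 1 [hζc]
  rw [← integral_sub hI1 hI2]
  have hb : ∀ g : Fib 𝒢.r u, ‖(c (𝒢.s g.1) : ℂ) • ζ - (c (𝒢.s g.1) : ℂ) • P g‖ ≤
      c (𝒢.s g.1) * C := fun g => by
    rw [← smul_sub, norm_smul, Complex.norm_real, Real.norm_of_nonneg (hc0 _)]
    by_cases hg : 𝒢.s g.1 ∈ tsupport c
    · exact mul_le_mul_of_nonneg_left (hC g hg) (hc0 _)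
    · rw [image_eq_zero_of_notMem_tsupport hg, zero_mul, zero_mul]
  refine (norm_integral_le_of_norm_le (hci.mul_const _) (ae_of_all _ hb)).trans ?_
  rw [integral_mul_const, hc1, one_mul]

open Classical in
theorem continuous_regCoeff_field (μ : InvariantMeasures 𝒳) (t : Finset ℰ.ccSec) {δ : ℝ}
    (hδ : 0 < δ) (i j : t) :
    Continuous fun u => regCoeff δ (Matrix.gram ℂ fun l : t => ℰ.field μ l.1 u) i j := by
  have h := continuous_regCoeff hδ (v := fun u (l : t) => ℰ.field μ l.1 u) fun i j =>
    L2Bundle.continuous_inner (L2Bundle.continuous_field i.1) (L2Bundle.continuous_field j.1)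
  exact h.matrix_elem i j

open Classical in
theorem continuous_sum_regCoeff (μ : InvariantMeasures 𝒳) (t : Finset ℰ.ccSec) {δ : ℝ}
    (hδ : 0 < δ) (c : C(M, ℝ)) (j : t) :
    Continuous fun u => (⟨u, ∑ i : t, (c u * regCoeff δ
      (Matrix.gram ℂ fun l : t => ℰ.field μ l.1 u) i j : ℂ) • ℰ.field μ i.1 u⟩ : L2Bundle ℰ μ) := by
  refine L2Bundle.continuous_sum _ continuous_id fun i _ => L2Bundle.continuous_smul_fun ?_
    (L2Bundle.continuous_field i.1)
  exact (Complex.continuous_ofReal.comp c.continuous).mul (continuous_regCoeff_field μ t hδ i j)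

open Classical in
/-- The section `u ↦ c(u) ∑ᵢ ((K(u) + δ)⁻¹)ᵢⱼ fᵢ(u)`, where `K(u)` is the Gram matrix of the vectors
`fᵢ(u)`. -/
def regSection (μ : InvariantMeasures 𝒳) (t : Finset ℰ.ccSec) {δ : ℝ} (hδ : 0 < δ) {c : C(M, ℝ)}
    (hcc : HasCompactSupport c) (j : t) : gammaC ℰ μ :=
  ⟨fun u => ∑ i : t, (c u * regCoeff δ (Matrix.gram ℂ fun l : t => ℰ.field μ l.1 u) i j : ℂ) •
      ℰ.field μ i.1 u, continuous_sum_regCoeff μ t hδ c j, tsupport c, hcc, fun u hu => by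
        simp [image_eq_zero_of_notMem_tsupport hu]⟩

open Classical in
theorem orb_regSection (t : Finset ℰ.ccSec) {δ : ℝ} (hδ : 0 < δ) {c : C(M, ℝ)}
    (hcc : HasCompactSupport c) (j : t) (u : M) (g : Fib 𝒢.r u) :
    orb (regSection μ t hδ hcc j).1 u g = ∑ i, (c (𝒢.s g.1) * regCoeff δ
      (Matrix.gram ℂ fun l : t => orb (ℰ.field μ l.1) u g) i j : ℂ) • orb (ℰ.field μ i.1) u g := by
  have hgram : (Matrix.gram ℂ fun l : t => orb (ℰ.field μ l.1) u g) =
      Matrix.gram ℂ fun l : t => ℰ.field μ l.1 (𝒢.s g.1) := by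
    ext i j
    exact L2Fibre.inner_transl _ _ _ _ _
  rw [hgram]
  have h1 : orb (regSection μ t hδ hcc j).1 u g = L2Fibre.transl ℰ μ g.1 rfl g.2
    (∑ i, (c (𝒢.s g.1) * regCoeff δ (Matrix.gram ℂ fun l : t => ℰ.field μ l.1 (𝒢.s g.1)) i j : ℂ) •
      ℰ.field μ i.1 (𝒢.s g.1)) := rfl
  rw [h1, map_sum]
  exact Finset.sum_congr rfl fun i _ => map_smul _ _ _

open Classical in
/-- The operators `T(p_j, T⋆ f_j)`, with `p_j` the sections `regSection`, have as the sum of their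
integrands the regularised projections of `T ξ`, weighted by `c(s g)`. -/
theorem sum_inner_smul_orb_regSection (T : boundedMorphisms ℰ μ) (t : Finset ℰ.ccSec) {δ : ℝ}
    (hδ : 0 < δ) {c : C(M, ℝ)} (hcc : HasCompactSupport c) (u : M) (g : Fib 𝒢.r u)
    (ξ : L2Fibre ℰ μ u) :
    ∑ j : t, (inner ℂ (orb (applySection (star T) (ℰ.toGammaC μ j.1)).1 u g) ξ : ℂ) •
      orb (regSection μ t hδ hcc j).1 u g =
        (c (𝒢.s g.1) : ℂ) • regProj δ (fun i : t => orb (ℰ.field μ i.1) u g) (T.1 u ξ) := by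
  rw [regProj, Finset.smul_sum]
  refine Finset.sum_congr rfl fun j _ => ?_
  have h1 : (inner ℂ (orb (applySection (star T) (ℰ.toGammaC μ j.1)).1 u g) ξ : ℂ) =
      inner ℂ (orb (ℰ.field μ j.1) u g) (T.1 u ξ) := by
    rw [orb_applySection]
    exact ContinuousLinearMap.adjoint_inner_left _ _ _
  rw [h1, orb_regSection, Finset.smul_sum, Finset.smul_sum]
  refine Finset.sum_congr rfl fun i _ => ?_
  rw [smul_smul, smul_smul]
  congr 1
  ring

/-- A compact equivariant morphism is a uniform limit of sums of morphisms `T(p, q)`: the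
regularised projections onto the span of finitely many sections that approximate the images of the
unit balls over the support of a cut-off function `c` are averaged over the groupoid, with weights
`c(s g)`. -/
theorem exists_rankOne_approx {T : boundedMorphisms ℰ μ} (hT : T ∈ compactMorphisms ℰ μ) {ε : ℝ}
    (hε : 0 < ε) : ∃ (t : Finset ℰ.ccSec) (p q : t → gammaC ℰ μ),
      ∀ u, ‖T.1 u - (∑ j, rankOne lam (p j) (q j)).1 u‖ ≤ 2 * ε := by
  classical
  obtain ⟨c, hcc, hc0, hc1⟩ := lam.exists_cutoff Fact.out Fact.out
  -- finitely many sections approximate the images of the unit balls over the support of `c`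
  obtain ⟨t, ht⟩ := (hT _ hcc).elim_finite_subcover
    (fun f : ℰ.ccSec => {ζ : L2Bundle ℰ μ | ζ.base ∈ univ ∧ ‖ζ.vec - ℰ.field μ f ζ.base‖ < ε})
    (fun f => L2Bundle.isOpen_tube f isOpen_univ ε) fun ζ _ => by
      obtain ⟨f, hf⟩ := ℰ.exists_field_near ζ.vec hε
      exact mem_iUnion.2 ⟨f, mem_univ _, hf⟩
  have hδ : 0 < ε ^ 2 := by positivity
  refine ⟨t, regSection μ t hδ hcc, fun j => applySection (star T) (ℰ.toGammaC μ j.1), fun u =>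
    ContinuousLinearMap.opNorm_le_of_unit_norm (by positivity) fun ξ hξ => ?_⟩
  refine norm_sub_sum_rankOne_le lam _ _ hcc hc0 (hc1 u)
    (fun g => sum_inner_smul_orb_regSection T t hδ hcc u g ξ) fun g hg => ?_
  refine norm_sub_regProj_orb_le T hε g (fun η hη => ?_) hξ.le
  obtain ⟨l, hl, -, hlt⟩ := mem_iUnion₂.1 (ht (subset_closure ⟨_, hg, η, hη, rfl⟩))
  exact ⟨l, hl, hlt.le⟩

/-! ### Compact operators on the module -/

variable {Γ : Type uV} [NormedAddCommGroup Γ] [NormedSpace ℂ Γ] [CompleteSpace Γ]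
  [HilbertModule lam.CRed Γ] {ι : gammaC ℰ μ →ₗ[ℂ] Γ}
namespace IsModuleCompletion

open HilbertModule

variable {lam}

theorem norm_ract_le (h : IsModuleCompletion lam ι) (x : Γ) (a : lam.CRed) :
    ‖ract x a‖ ≤ ‖x‖ * ‖a‖ := by
  rw [← h.norm_realise]
  refine SynthesisSpace.norm_le (by positivity) fun u => ?_
  rw [h.realise_ract]
  refine (ContinuousLinearMap.opNorm_comp_le _ _).trans ?_
  rw [← h.norm_realise x]
  exact mul_le_mul (SynthesisSpace.norm_op_le _ u) (HaarSystem.RegularProduct.norm_at_le a.1 u)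
    (norm_nonneg _) (norm_nonneg _)

theorem repr_add (h : IsModuleCompletion lam ι) (S T : boundedMorphisms ℰ μ) :
    h.repr (S + T) = h.repr S + h.repr T := map_add h.repr.toAlgHom S T

theorem repr_smul (h : IsModuleCompletion lam ι) (c : ℂ) (T : boundedMorphisms ℰ μ) :
    h.repr (c • T) = c • h.repr T := map_smul h.repr.toAlgHom c T

theorem dist_repr (h : IsModuleCompletion lam ι) (S T : boundedMorphisms ℰ μ) :
    dist (h.repr S) (h.repr T) = ⨆ u, ‖(S - T).1 u‖ := by
  have h1 : h.repr S - h.repr T = h.repr (S - T) := (map_sub h.repr.toAlgHom S T).symm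
  have h2 : dist (h.repr S) (h.repr T) = ‖h.repr S - h.repr T‖ := dist_eq_norm _ _
  rw [h2, h1, h.norm_repr]

theorem dist_repr_le (h : IsModuleCompletion lam ι) {S T : boundedMorphisms ℰ μ} {C : ℝ}
    (hC : 0 ≤ C) (hST : ∀ u, ‖S.1 u - T.1 u‖ ≤ C) : dist (h.repr S) (h.repr T) ≤ C := by
  rw [h.dist_repr]
  exact Real.iSup_le hST hC

/-- The compact morphisms act by compact operators. -/
theorem repr_mem_compacts (h : IsModuleCompletion lam ι) {T : boundedMorphisms ℰ μ}
    (hT : T ∈ compactMorphisms ℰ μ) : h.repr T ∈ compacts lam.CRed Γ := by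
  refine Metric.mem_closure_iff.2 fun ε hε => ?_
  obtain ⟨t, p, q, hpq⟩ := exists_rankOne_approx lam hT (show 0 < ε / 4 by positivity)
  refine ⟨h.repr (∑ j, rankOne lam (p j) (q j)), ?_, ?_⟩
  · rw [map_sum]
    exact Submodule.sum_mem _ fun j _ => Submodule.subset_span
      ⟨ι (p j), ι (q j), h.moduleMap_rankOne (p j) (q j)⟩
  · exact (h.dist_repr_le (by positivity) hpq).trans_lt (by linarith)

/-- The image of the compact morphisms is closed, because the representation is isometric and the
compact morphisms are complete. -/
theorem isClosed_repr_image (h : IsModuleCompletion lam ι) :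
    IsClosed (h.repr '' compactMorphisms ℰ μ) := by
  refine isClosed_of_closure_subset fun y hy => ?_
  obtain ⟨z, hz, hzy⟩ := mem_closure_iff_seq_limit.1 hy
  choose T hT hTz using hz
  obtain ⟨S, hS⟩ := exists_uniform_limit (T := T) fun ε hε => by
    obtain ⟨N, hN⟩ := Metric.cauchySeq_iff.1 hzy.cauchySeq ε hε
    refine ⟨N, fun i hi j hj u => ?_⟩
    have h1 := hN i hi j hj
    rw [← hTz, ← hTz, h.dist_repr] at h1
    exact (norm_le_iSup (T i - T j) u).trans h1.le
  refine ⟨S, compactMorphisms_of_approx fun ε hε => ?_, ?_⟩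
  · obtain ⟨N, hN⟩ := hS ε hε
    exact ⟨T N, hT N, hN N le_rfl⟩
  · have h1 : Filter.Tendsto z Filter.atTop (𝓝 (h.repr S)) := Metric.tendsto_atTop.2 fun ε hε => by
      obtain ⟨N, hN⟩ := hS (ε / 2) (half_pos hε)
      refine ⟨N, fun i hi => ?_⟩
      rw [dist_comm, ← hTz]
      exact (h.dist_repr_le (half_pos hε).le (hN i hi)).trans_lt (half_lt_self hε)
    exact tendsto_nhds_unique h1 hzy

/-- Every operator `θ_{x, y}` is a limit of operators induced by morphisms `T(e₁, e₂)`. -/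
theorem mem_repr_image_of_rankOne (h : IsModuleCompletion lam ι) {S : adjointable lam.CRed Γ}
    {x y : Γ} (hS : ∀ z, S.1 z = ract x (ip y z : lam.CRed)) :
    S ∈ h.repr '' compactMorphisms ℰ μ := by
  refine h.isClosed_repr_image.closure_subset (Metric.mem_closure_iff.2 fun ε hε => ?_)
  set η : ℝ := min 1 (ε / (2 * (‖x‖ + ‖y‖ + 1))) with hη
  have hη0 : 0 < η := lt_min one_pos (by positivity)
  obtain ⟨e₁, h₁⟩ := Metric.denseRange_iff.1 h.dense x η hη0
  obtain ⟨e₂, h₂⟩ := Metric.denseRange_iff.1 h.dense y η hη0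
  rw [dist_eq_norm] at h₁ h₂
  refine ⟨_, mem_image_of_mem _ (rankOne_mem_compactMorphisms lam e₁ e₂), ?_⟩
  have h3 : ‖ι e₁‖ ≤ ‖x‖ + 1 := by
    have := norm_sub_le x (x - ι e₁)
    rw [sub_sub_cancel] at this
    linarith [min_le_left 1 (ε / (2 * (‖x‖ + ‖y‖ + 1)))]
  have h4 : ‖S.1 - moduleMap ι (rankOne lam e₁ e₂)‖ ≤ η * (‖x‖ + ‖y‖ + 1) := by
    refine ContinuousLinearMap.opNorm_le_bound _ (by positivity) fun z => ?_
    have h5 : (S.1 - moduleMap ι (rankOne lam e₁ e₂)) z =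
        ract (x - ι e₁) (ip y z : lam.CRed) + ract (ι e₁) (ip (y - ι e₂) z : lam.CRed) := by
      have h6 : (ip y z : lam.CRed) = ip (y - ι e₂) z + ip (ι e₂) z := by
        rw [← ip_add_left, sub_add_cancel]
      rw [sub_apply, hS, h.moduleMap_rankOne, map_sub, LinearMap.sub_apply, h6, map_add, map_add]
      abel
    rw [h5]
    have h6 := (h.norm_ract_le (x - ι e₁) (ip y z)).trans
      (mul_le_mul h₁.le (h.norm_ip_le y z) (norm_nonneg _) hη0.le)
    have h7 := (h.norm_ract_le (ι e₁) (ip (y - ι e₂) z)).trans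
      (mul_le_mul h3 ((h.norm_ip_le (y - ι e₂) z).trans
        (mul_le_mul_of_nonneg_right h₂.le (norm_nonneg z))) (norm_nonneg _) (by positivity))
    refine (norm_add_le _ _).trans ((add_le_add h6 h7).trans_eq (by ring))
  have h5 : dist S (h.repr (rankOne lam e₁ e₂)) = ‖S.1 - moduleMap ι (rankOne lam e₁ e₂)‖ :=
    dist_eq_norm S.1 (h.repr (rankOne lam e₁ e₂)).1
  rw [h5]
  refine h4.trans_lt ?_
  have h6 := min_le_right 1 (ε / (2 * (‖x‖ + ‖y‖ + 1)))
  rw [← hη, le_div_iff₀ (by positivity)] at h6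
  linarith

theorem repr_image_compactMorphisms (h : IsModuleCompletion lam ι) :
    h.repr '' compactMorphisms ℰ μ = compacts lam.CRed Γ := by
  refine Subset.antisymm ?_ (closure_minimal (fun S hS => ?_) h.isClosed_repr_image)
  · rintro _ ⟨T, hT, rfl⟩
    exact h.repr_mem_compacts hT
  · induction hS using Submodule.span_induction with
    | mem S hS =>
      obtain ⟨x, y, hxy⟩ := hS
      exact h.mem_repr_image_of_rankOne hxy
    | zero =>
      exact h.mem_repr_image_of_rankOne (x := 0) (y := 0) fun z => by rw [map_zero]; rfl
    | add S S' _ _ hS hS' =>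
      obtain ⟨T, hT, rfl⟩ := hS
      obtain ⟨T', hT', rfl⟩ := hS'
      exact ⟨T + T', compactMorphisms_add hT hT', h.repr_add _ _⟩
    | smul c S _ hS =>
      obtain ⟨T, hT, rfl⟩ := hS
      exact ⟨c • T, compactMorphisms_smul c hT, h.repr_smul _ _⟩

end IsModuleCompletion
end CompactApprox

/-! ### Operators with continuous kernels of compact support -/

section KernelOperator

variable {Y : Type*} [TopologicalSpace Y] [T2Space Y] [SecondCountableTopology Y]
  [LocallyCompactSpace Y] [MeasurableSpace Y] [BorelSpace Y] {ν : Measure Y} [ν.Regular]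
  {κ : Y × Y → ℂ}

theorem memLp_kernel_slice (hκ : Continuous κ) (hc : HasCompactSupport κ) (x : Y) :
    MemLp (fun y => κ (x, y)) 2 ν := by
  have h1 : HasCompactSupport fun y => κ (x, y) :=
    HasCompactSupport.intro (IsCompact.image hc continuous_snd) fun y hy =>
      image_eq_zero_of_notMem_tsupport fun h => hy ⟨_, h, rfl⟩
  exact Continuous.memLp_of_hasCompactSupport (by fun_prop) h1

theorem norm_integral_kernel_sq_le (hκ : Continuous κ) (hc : HasCompactSupport κ) (η : Lp ℂ 2 ν)
    (x : Y) : ‖∫ y, κ (x, y) * η y ∂ν‖ ^ 2 ≤ (∫ y, ‖κ (x, y)‖ ^ 2 ∂ν) * ‖η‖ ^ 2 := by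
  have hm : MemLp (fun y => star (κ (x, y))) 2 ν := (memLp_kernel_slice hκ hc x).star
  have h1 : (inner ℂ (hm.toLp _) η : ℂ) = ∫ y, κ (x, y) * η y ∂ν := by
    rw [L2.inner_def]
    refine integral_congr_ae ?_
    filter_upwards [hm.coeFn_toLp] with y hy
    rw [hy, RCLike.inner_apply, RCLike.star_def, RingHomCompTriple.comp_apply, RingHom.id_apply,
      mul_comm]
  have h2 : ‖hm.toLp _‖ ^ 2 = ∫ y, ‖κ (x, y)‖ ^ 2 ∂ν := by
    rw [norm_sq_Lp_two]
    refine integral_congr_ae ?_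
    filter_upwards [hm.coeFn_toLp] with y hy
    rw [hy, norm_star]
  rw [← h1, ← h2, ← mul_pow]
  exact pow_le_pow_left₀ (norm_nonneg _) (norm_inner_le_norm _ _) 2

theorem integrable_norm_sq_kernel (hκ : Continuous κ) (hc : HasCompactSupport κ) :
    Integrable (fun p => ‖κ p‖ ^ 2) (ν.prod ν) := by
  have h1 : HasCompactSupport fun p => ‖κ p‖ ^ 2 :=
    hc.comp_left (g := fun v => ‖v‖ ^ 2) (by simp)
  have h2 : Continuous fun p => ‖κ p‖ ^ 2 := hκ.norm.pow 2
  exact h2.integrable_of_hasCompactSupport h1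

theorem memLp_integral_kernel (hκ : Continuous κ) (hc : HasCompactSupport κ) (η : Lp ℂ 2 ν) :
    MemLp (fun x => ∫ y, κ (x, y) * η y ∂ν) 2 ν := by
  have hm : AEStronglyMeasurable (fun x => ∫ y, κ (x, y) * η y ∂ν) ν :=
    AEStronglyMeasurable.integral_prod_right' (f := fun p : Y × Y => κ p * η p.2)
      (hκ.aestronglyMeasurable.mul (Lp.aestronglyMeasurable η).comp_snd)
  refine (memLp_two_iff_integrable_sq_norm hm).2 ?_
  refine ((integrable_norm_sq_kernel hκ hc).integral_prod_left.mul_const (‖η‖ ^ 2)).mono'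
    (hm.norm.pow 2) (ae_of_all _ fun x => ?_)
  rw [Real.norm_of_nonneg (sq_nonneg _)]
  exact norm_integral_kernel_sq_le hκ hc η x

theorem integrable_kernel_mul (hκ : Continuous κ) (hc : HasCompactSupport κ) (η : Lp ℂ 2 ν)
    (x : Y) : Integrable (fun y => κ (x, y) * η y) ν :=
  (memLp_kernel_slice hκ hc x).integrable_mul (Lp.memLp η)

theorem norm_toLp_integral_kernel_le (hκ : Continuous κ) (hc : HasCompactSupport κ)
    (η : Lp ℂ 2 ν) : ‖(memLp_integral_kernel hκ hc η).toLp _‖ ≤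
      √(∫ x, ∫ y, ‖κ (x, y)‖ ^ 2 ∂ν ∂ν) * ‖η‖ := by
  have hD : 0 ≤ ∫ x, ∫ y, ‖κ (x, y)‖ ^ 2 ∂ν ∂ν :=
    integral_nonneg fun _ => integral_nonneg fun _ => sq_nonneg _
  refine le_of_sq_le_sq ?_ (mul_nonneg (Real.sqrt_nonneg _) (norm_nonneg _))
  rw [mul_pow, Real.sq_sqrt hD, norm_sq_Lp_two, ← integral_mul_const]
  have h1 : ∀ᵐ x ∂ν, ‖(memLp_integral_kernel hκ hc η).toLp _ x‖ ^ 2 ≤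
      (∫ y, ‖κ (x, y)‖ ^ 2 ∂ν) * ‖η‖ ^ 2 := by
    filter_upwards [(memLp_integral_kernel hκ hc η).coeFn_toLp] with x hx
    rw [hx]
    exact norm_integral_kernel_sq_le hκ hc η x
  refine integral_mono_ae ?_ ((integrable_norm_sq_kernel hκ hc).integral_prod_left.mul_const _) h1
  exact (memLp_two_iff_integrable_sq_norm (Lp.aestronglyMeasurable _)).1 (Lp.memLp _)

/-- The Hilbert-Schmidt operator on `L²` with a continuous kernel of compact support. -/
def kernelOp (hκ : Continuous κ) (hc : HasCompactSupport κ) : Lp ℂ 2 ν →L[ℂ] Lp ℂ 2 ν :=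
  LinearMap.mkContinuous
    { toFun := fun η => (memLp_integral_kernel hκ hc η).toLp _
      map_add' := fun η η' => by
        rw [← MemLp.toLp_add]
        refine MemLp.toLp_congr _ _ (ae_of_all _ fun x => ?_)
        rw [Pi.add_apply, ← integral_add (integrable_kernel_mul hκ hc η x)
          (integrable_kernel_mul hκ hc η' x)]
        refine integral_congr_ae ?_
        filter_upwards [Lp.coeFn_add η η'] with y hy
        rw [hy, Pi.add_apply, mul_add]
      map_smul' := fun c η => by
        rw [RingHom.id_apply, ← MemLp.toLp_const_smul]
        refine MemLp.toLp_congr _ _ (ae_of_all _ fun x => ?_)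
        rw [Pi.smul_apply, ← integral_smul]
        refine integral_congr_ae ?_
        filter_upwards [Lp.coeFn_smul c η] with y hy
        rw [hy, Pi.smul_apply, smul_eq_mul, smul_eq_mul]
        ring } _ (norm_toLp_integral_kernel_le hκ hc)

theorem norm_kernelOp_le (hκ : Continuous κ) (hc : HasCompactSupport κ) :
    ‖(kernelOp hκ hc : Lp ℂ 2 ν →L[ℂ] Lp ℂ 2 ν)‖ ≤ √(∫ x, ∫ y, ‖κ (x, y)‖ ^ 2 ∂ν ∂ν) :=
  LinearMap.mkContinuous_norm_le _ (Real.sqrt_nonneg _) _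

theorem coeFn_kernelOp (hκ : Continuous κ) (hc : HasCompactSupport κ) {η : Lp ℂ 2 ν} {φ : Y → ℂ}
    (hφ : η =ᵐ[ν] φ) : kernelOp hκ hc η =ᵐ[ν] fun x => ∫ y, κ (x, y) * φ y ∂ν := by
  refine (memLp_integral_kernel hκ hc η).coeFn_toLp.trans (ae_of_all _ fun x => ?_)
  refine integral_congr_ae ?_
  filter_upwards [hφ] with y hy
  rw [hy]

theorem adjoint_kernelOp (hκ : Continuous κ) (hc : HasCompactSupport κ) {κ' : Y × Y → ℂ}
    (hκ' : Continuous κ') (hc' : HasCompactSupport κ') (h : ∀ x y, κ' (y, x) = star (κ (x, y))) :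
    ContinuousLinearMap.adjoint (kernelOp hκ hc : Lp ℂ 2 ν →L[ℂ] Lp ℂ 2 ν) = kernelOp hκ' hc' := by
  symm
  rw [ContinuousLinearMap.eq_adjoint_iff]
  intro ζ η
  have hsq : ∀ ξ : Lp ℂ 2 ν, Integrable (fun x => ‖ξ x‖ ^ 2) ν := fun ξ =>
    (memLp_two_iff_integrable_sq_norm (Lp.aestronglyMeasurable ξ)).1 (Lp.memLp ξ)
  have hm : AEStronglyMeasurable (fun p : Y × Y => star (ζ p.1) * η p.2) (ν.prod ν) :=
    (Lp.aestronglyMeasurable ζ).comp_fst.star.mul (Lp.aestronglyMeasurable η).comp_snd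
  have hmem : MemLp (fun p : Y × Y => star (ζ p.1) * η p.2) 2 (ν.prod ν) := by
    refine (memLp_two_iff_integrable_sq_norm hm).2 (((hsq ζ).mul_prod (hsq η)).congr ?_)
    exact ae_of_all _ fun p => by simp only [norm_mul, norm_star, mul_pow]
  have hi : Integrable (fun p : Y × Y => κ p * (star (ζ p.1) * η p.2)) (ν.prod ν) :=
    (show MemLp κ 2 (ν.prod ν) from hκ.memLp_of_hasCompactSupport hc).integrable_mul hmem
  have h1 : (inner ℂ (kernelOp hκ' hc' ζ) η : ℂ) =
      ∫ y, ∫ x, κ (x, y) * (star (ζ x) * η y) ∂ν ∂ν := by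
    rw [L2.inner_def]
    refine integral_congr_ae ?_
    filter_upwards [coeFn_kernelOp hκ' hc' (η := ζ) Filter.EventuallyEq.rfl] with y hy
    rw [hy, RCLike.inner_apply', ← integral_conj, ← integral_mul_const]
    refine integral_congr_ae (ae_of_all _ fun x => ?_)
    simp only [h, map_mul, RCLike.star_def, Complex.conj_conj]
    ring
  have h2 : (inner ℂ ζ (kernelOp hκ hc η) : ℂ) =
      ∫ x, ∫ y, κ (x, y) * (star (ζ x) * η y) ∂ν ∂ν := by
    rw [L2.inner_def]
    refine integral_congr_ae ?_
    filter_upwards [coeFn_kernelOp hκ hc (η := η) Filter.EventuallyEq.rfl] with x hx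
    rw [hx, RCLike.inner_apply', ← integral_const_mul]
    refine integral_congr_ae (ae_of_all _ fun y => ?_)
    simp only [RCLike.star_def]
    ring
  rw [h1, h2]
  exact (integral_integral_swap hi).symm

end KernelOperator

section RegularRepresentation

variable {m k : ℕ} {M : Type uM} {G : Type uG}
  [TopologicalSpace M] [ChartedSpace (EuclideanSpace ℝ (Fin m)) M]
  [TopologicalSpace G] [ChartedSpace (EuclideanSpace ℝ (Fin k)) G]
  {𝒢 : LieGroupoid m k M G} [MeasurableSpace G] [BorelSpace G]
  [T2Space M] [T2Space G] [SecondCountableTopology G] [LocallyCompactSpace G]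
  [LocallyCompactSpace M] (lam : HaarSystem 𝒢) [Fact 𝒢.IsProper] [Fact 𝒢.IsGCompact]

/-! ### The regular representations of a proper groupoid -/

instance secondCountableTopology_fib_s (𝒢 : LieGroupoid m k M G) (u : M) :
    SecondCountableTopology (Fib 𝒢.s u) :=
  TopologicalSpace.Subtype.secondCountableTopology {g | 𝒢.s g = u}

/-- The kernel `(k, l) ↦ f(k l⁻¹)` on `G_u` of the convolution with `f`. -/
def convKernel (𝒢 : LieGroupoid m k M G) (f : C_c(G, ℂ)) (u : M) (q : Fib 𝒢.s u × Fib 𝒢.s u) : ℂ :=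
  f (𝒢.mul q.1.1 (𝒢.inv q.2.1))

theorem continuous_convKernel (f : C_c(G, ℂ)) (u : M) : Continuous (convKernel 𝒢 f u) :=
  f.continuous.comp (𝒢.continuous_mul_of_composable (continuous_subtype_val.comp continuous_fst)
    (𝒢.continuous_inv.comp (continuous_subtype_val.comp continuous_snd))
    fun q => by rw [𝒢.r_inv, q.1.2, q.2.2])

/-- As the groupoid is proper, the kernels have compact support. -/
theorem hasCompactSupport_convKernel (f : C_c(G, ℂ)) (u : M) :
    HasCompactSupport (convKernel 𝒢 f u) := by
  have hf : IsCompact (tsupport f) := f.hasCompactSupport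
  have key : ∀ B : Set M, IsCompact B → IsCompact {k : Fib 𝒢.s u | 𝒢.r k.1 ∈ B} := fun B hB => by
    have h1 := (𝒢.isClosedEmbedding_fib_s u).isCompact_preimage
      ((Fact.out : 𝒢.IsProper) (B ×ˢ {u}) (hB.prod isCompact_singleton))
    convert h1 using 1
    ext k
    simp [k.2]
  refine HasCompactSupport.intro ((key _ (hf.image 𝒢.continuous_r)).prod
    (key _ (hf.image 𝒢.continuous_s))) fun q hq => ?_
  have hcomp : 𝒢.s q.1.1 = 𝒢.r (𝒢.inv q.2.1) := by rw [𝒢.r_inv, q.1.2, q.2.2]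
  by_contra h0
  have h1 : 𝒢.mul q.1.1 (𝒢.inv q.2.1) ∈ tsupport f := subset_tsupport f h0
  exact hq ⟨⟨_, h1, 𝒢.r_mul _ _ hcomp⟩, ⟨_, h1, by rw [𝒢.s_mul _ _ hcomp, 𝒢.s_inv]⟩⟩

/-- The operator of convolution with `f` on `L²(G_u, λ_u)`. -/
def convOp (f : C_c(G, ℂ)) (u : M) : Lp ℂ 2 (lam.measSource u) →L[ℂ] Lp ℂ 2 (lam.measSource u) :=
  kernelOp (continuous_convKernel f u) (hasCompactSupport_convKernel f u)

theorem coeFn_convOp (f : C_c(G, ℂ)) (u : M) {η : Lp ℂ 2 (lam.measSource u)} {φ : Fib 𝒢.s u → ℂ}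
    (hφ : η =ᵐ[lam.measSource u] φ) : convOp lam f u η =ᵐ[lam.measSource u] fun k =>
      ∫ h, f (𝒢.mul k.1 h.1) * φ (𝒢.invFib u h) ∂(lam.meas u) := by
  refine (coeFn_kernelOp _ _ hφ).trans (ae_of_all _ fun k => ?_)
  refine (lam.integral_measSource _).trans (integral_congr_ae (ae_of_all _ fun h => ?_))
  simp only [convKernel, 𝒢.invFib_coe, 𝒢.inv_inv]

theorem convOp_isRegular (f : C_c(G, ℂ)) (u : M) (ξ : C_c(G, ℂ)) (η : Lp ℂ 2 (lam.measSource u))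
    (hη : (η : Fib 𝒢.s u → ℂ) =ᵐ[lam.measSource u] fun g => ξ g.1) :
    convOp lam f u η =ᵐ[lam.measSource u] fun g => lam.conv f ξ g.1 := by
  refine (coeFn_convOp lam f u hη).trans (ae_of_all _ fun k => ?_)
  have h1 := lam.conv_inv f ξ ((𝒢.invFib u).symm k)
  rw [𝒢.invFib_symm_coe, 𝒢.inv_inv] at h1
  exact h1.symm

/-- The Hilbert-Schmidt norms of the convolution operators are bounded: their squares
`∫ ∫ |f(l⁻¹ h)|²` are a continuous invariant function on the units. -/
theorem exists_norm_convOp_le (f : C_c(G, ℂ)) : ∃ C, ∀ u, ‖convOp lam f u‖ ≤ C := by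
  have hf : IsCompact (tsupport f) := f.hasCompactSupport
  have hf0 : ∀ g ∉ tsupport f, ‖f g‖ ^ 2 = 0 := fun g hg => by
    simp [image_eq_zero_of_notMem_tsupport hg]
  set Φ : M → ℝ := fun v => ∫ h : Fib 𝒢.r v, ‖f h.1‖ ^ 2 ∂(lam.meas v) with hΦ
  have hΦc : Continuous Φ := lam.continuous_integral_real (f.continuous.norm.pow 2)
    (𝒢.isFibrewiseCompact_of_isCompact hf) hf0
  have hΦ0 : ∀ v ∉ 𝒢.r '' tsupport f, Φ v = 0 := fun v hv =>
    integral_eq_zero_of_ae (ae_of_all _ fun h => hf0 _ fun hh => hv ⟨_, hh, h.2⟩)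
  obtain ⟨C, -, hC⟩ := lam.exists_bound_of_invariant Fact.out
    (lam.continuous_integral_real (hΦc.comp 𝒢.continuous_s)
      ((Fact.out : 𝒢.IsProper).isFibrewiseCompact (hf.image 𝒢.continuous_r))
      fun g hg => hΦ0 _ hg) fun g => lam.integral_comp_s Φ g
  refine ⟨√C, fun u => (norm_kernelOp_le _ _).trans (Real.sqrt_le_sqrt ((le_of_eq ?_).trans (hC u)))⟩
  rw [lam.integral_measSource]
  refine integral_congr_ae (ae_of_all _ fun l => ?_)
  have hl : 𝒢.s (𝒢.inv l.1) = u := (𝒢.s_inv _).trans l.2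
  have h1 := lam.integral_leftMul (𝒢.inv l.1) hl (𝒢.r_inv l.1)
    fun h : Fib 𝒢.r (𝒢.s l.1) => ‖f h.1‖ ^ 2
  refine Eq.trans ?_ h1
  refine (lam.integral_measSource _).trans (integral_congr_ae (ae_of_all _ fun h => ?_))
  simp only [convKernel, 𝒢.invFib_coe, 𝒢.inv_inv, 𝒢.leftMul_coe]

/-- The element of the product of the algebras of operators that is given by `f ∈ C_c(G)`. -/
def regularRep (f : C_c(G, ℂ)) : lam.RegularProduct :=
  ⟨fun u => convOp lam f u, by
    obtain ⟨C, hC⟩ := exists_norm_convOp_le lam f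
    exact memℓp_infty ⟨C, by rintro _ ⟨u, rfl⟩; exact hC u⟩⟩

theorem isRegularRep_regularRep (f : C_c(G, ℂ)) : lam.IsRegularRep f (regularRep lam f) :=
  convOp_isRegular lam f

theorem HaarSystem.IsRegularRep.eq_regularRep {f : C_c(G, ℂ)} {a : lam.RegularProduct}
    (ha : lam.IsRegularRep f a) : a = regularRep lam f :=
  HaarSystem.RegularProduct.ext fun u =>
    HaarSystem.IsRegularRep.at_eq lam ha u (convOp_isRegular lam f u)

/-- The involution `f⋆(g) = conj f(g⁻¹)` of `C_c(G)`. -/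
def ccStar (𝒢 : LieGroupoid m k M G) (f : C_c(G, ℂ)) : C_c(G, ℂ) where
  toFun g := star (f (𝒢.inv g))
  continuous_toFun := (f.continuous.comp 𝒢.continuous_inv).star
  hasCompactSupport' := by
    refine HasCompactSupport.intro (IsCompact.image f.hasCompactSupport 𝒢.continuous_inv)
      fun g hg => ?_
    have h1 : f (𝒢.inv g) = 0 :=
      image_eq_zero_of_notMem_tsupport fun h => hg ⟨_, h, 𝒢.inv_inv g⟩
    rw [h1, star_zero]

theorem ccStar_apply (f : C_c(G, ℂ)) (g : G) : ccStar 𝒢 f g = star (f (𝒢.inv g)) := rfl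

theorem adjoint_convOp (f : C_c(G, ℂ)) (u : M) :
    ContinuousLinearMap.adjoint (convOp lam f u) = convOp lam (ccStar 𝒢 f) u :=
  adjoint_kernelOp _ _ _ _ fun k l => by
    have hkl : 𝒢.s l.1 = 𝒢.r (𝒢.inv k.1) := by rw [𝒢.r_inv, k.2, l.2]
    rw [convKernel, convKernel, ccStar_apply, 𝒢.inv_mul_rev _ _ hkl, 𝒢.inv_inv]

theorem star_regularRep (f : C_c(G, ℂ)) :
    star (regularRep lam f) = regularRep lam (ccStar 𝒢 f) :=
  HaarSystem.RegularProduct.ext fun u => adjoint_convOp lam f u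

/-- The reduced algebra is the closed subalgebra generated by the elements `regularRep lam f`, since
these are stable under the involution. -/
theorem redAlgebra_induction {P : lam.RegularProduct → Prop} (hP : IsClosed {a | P a})
    (h_mem : ∀ f, P (regularRep lam f)) (h_add : ∀ a b, P a → P b → P (a + b)) (h_zero : P 0)
    (h_smul : ∀ (c : ℂ) a, P a → P (c • a)) (h_mul : ∀ a b, P a → P b → P (a * b))
    {a : lam.RegularProduct} (ha : a ∈ lam.redAlgebra) : P a := by
  refine closure_minimal (fun b hb => ?_) hP ha
  have hb' : b ∈ NonUnitalAlgebra.adjoin ℂ ({a | ∃ f : C_c(G, ℂ), lam.IsRegularRep f a} ∪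
    star {a | ∃ f : C_c(G, ℂ), lam.IsRegularRep f a}) := hb
  clear hb
  induction hb' using NonUnitalAlgebra.adjoin_induction with
  | mem b hb =>
    rcases hb with ⟨f, hf⟩ | ⟨f, hf⟩
    · rw [hf.eq_regularRep]
      exact h_mem f
    · rw [← star_star b, hf.eq_regularRep, star_regularRep]
      exact h_mem _
  | add a b _ _ ha hb => exact h_add a b ha hb
  | zero => exact h_zero
  | mul a b _ _ ha hb => exact h_mul a b ha hb
  | smul c a _ ha => exact h_smul c a ha

theorem regularRep_mem (f : C_c(G, ℂ)) : regularRep lam f ∈ lam.redAlgebra :=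
  subset_closure (NonUnitalStarAlgebra.subset_adjoin ℂ _ ⟨f, isRegularRep_regularRep lam f⟩)

end RegularRepresentation

section Existence

variable {m k d z : ℕ} {M : Type uM} {G : Type uG} {X : Type uX} {Z : Type uZ}
  [TopologicalSpace M] [ChartedSpace (EuclideanSpace ℝ (Fin m)) M]
  [TopologicalSpace G] [ChartedSpace (EuclideanSpace ℝ (Fin k)) G]
  [TopologicalSpace X] [ChartedSpace (EuclideanSpace ℝ (Fin d)) X]
  [TopologicalSpace Z] [ChartedSpace (EuclideanSpace ℝ (Fin z)) Z]
  {𝒢 : LieGroupoid m k M G}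
  {F : Type uF} [NormedAddCommGroup F] [NormedSpace ℂ F]
  {E : X → Type uE} [∀ x, NormedAddCommGroup (E x)] [∀ x, InnerProductSpace ℂ (E x)]
  [TopologicalSpace (TotalSpace F E)] [FiberBundle F E] [VectorBundle ℂ F E]
  [CompactSpace Z] [MeasurableSpace X] [BorelSpace X] {𝒳 : GFibreBundle 𝒢 d z X Z}
  {ℰ : GHermitianBundle 𝒳 F E} {μ : InvariantMeasures 𝒳}
  [T2Space X] [SecondCountableTopology X] [FiniteDimensional ℂ F] [T2Space M]
  [LocallyCompactSpace M] [LocallyCompactSpace X]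
  [MeasurableSpace G] [BorelSpace G] [T2Space G] [SecondCountableTopology G]
  [LocallyCompactSpace G] (lam : HaarSystem 𝒢)
  [Fact 𝒢.IsProper] [Fact 𝒢.IsGCompact]

/-! ### The action of `C_c(G)` on sections -/

theorem conj_integral_inner {Y : Type*} [MeasurableSpace Y] {ν : Measure Y} {H : Type*}
    [NormedAddCommGroup H] [InnerProductSpace ℂ H] [CompleteSpace H] {φ : Y → H}
    (hφ : Integrable φ ν) (η : H) : (inner ℂ (∫ y, φ y ∂ν) η : ℂ) = ∫ y, inner ℂ (φ y) η ∂ν := by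
  rw [← inner_conj_symm, ← integral_inner hφ, ← integral_conj]
  simp only [inner_conj_symm]

/-- The section `u ↦ ∫ f(g⁻¹) L_g e(s g) dλ^u(g)`. -/
def actSection (e : gammaC ℰ μ) (f : C_c(G, ℂ)) : gammaC ℰ μ :=
  ⟨fun u => ∫ g : Fib 𝒢.r u, f (𝒢.inv g.1) • orb e.1 u g ∂(lam.meas u), by
    have hf : IsCompact (𝒢.inv '' tsupport f) :=
      IsCompact.image f.hasCompactSupport 𝒢.continuous_inv
    refine continuous_integral_orb lam e.2.1 (φ := fun g => f (𝒢.inv g))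
      (f.continuous.comp 𝒢.continuous_inv) (𝒢.isFibrewiseCompact_of_isCompact hf) fun g hg => ?_
    exact image_eq_zero_of_notMem_tsupport fun h => hg ⟨_, h, 𝒢.inv_inv g⟩,
    𝒢.s '' tsupport f, IsCompact.image f.hasCompactSupport 𝒢.continuous_s, fun u hu => by
      refine integral_eq_zero_of_ae (ae_of_all _ fun g => ?_)
      have h1 : f (𝒢.inv g.1) = 0 := image_eq_zero_of_notMem_tsupport fun h =>
        hu ⟨_, h, (𝒢.s_inv _).trans g.2⟩
      simp [h1]⟩

theorem integrable_smul_orb (e : gammaC ℰ μ) {u : M} {φ : Fib 𝒢.r u → ℂ} (hφ : Continuous φ) :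
    Integrable (fun g => φ g • orb e.1 u g) (lam.meas u) := by
  have hc : HasCompactSupport fun g => φ g • orb e.1 u g := by
    obtain ⟨K, hK, heK⟩ := e.2.2
    refine ((Fact.out : 𝒢.IsProper).isFibrewiseCompact hK).hasCompactSupport_fib u fun g hg => ?_
    rw [orb, heK _ hg, map_zero, smul_zero]
  exact (hφ.smul (continuous_orb e.2.1 u)).integrable_of_hasCompactSupport hc

theorem orb_actSection (e : gammaC ℰ μ) (f : C_c(G, ℂ)) {u : M} (l : Fib 𝒢.r u) :
    orb (actSection lam e f).1 u l =
      ∫ h, f (𝒢.mul (𝒢.inv h.1) l.1) • orb e.1 u h ∂(lam.meas u) := by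
  have h1 : orb (actSection lam e f).1 u l = L2Fibre.transl ℰ μ l.1 rfl l.2
    (∫ g : Fib 𝒢.r (𝒢.s l.1), f (𝒢.inv g.1) • orb e.1 _ g ∂(lam.meas (𝒢.s l.1))) := rfl
  rw [h1, ← ContinuousLinearMap.integral_comp_comm _ (integrable_smul_orb lam e
    (φ := fun g => f (𝒢.inv g.1)) (f.continuous.comp (𝒢.continuous_inv.comp continuous_subtype_val))),
    ← lam.integral_leftMul l.1 rfl l.2]
  refine integral_congr_ae (ae_of_all _ fun g => ?_)
  simp only [map_smul, transl_orb, 𝒢.leftMul_coe]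
  have key : ∀ a : G, 𝒢.r a = 𝒢.s l.1 → 𝒢.mul (𝒢.inv (𝒢.mul l.1 a)) l.1 = 𝒢.inv a := fun a ha => by
    rw [𝒢.inv_mul_rev _ _ ha.symm, 𝒢.mul_assoc _ _ _ (by rw [𝒢.s_inv, 𝒢.r_inv, ha])
      (𝒢.s_inv _), 𝒢.inv_mul, ← ha, ← 𝒢.s_inv, 𝒢.mul_unit]
  rw [key g.1 g.2]

theorem analysisOp_actSection (e : gammaC ℰ μ) (f : C_c(G, ℂ)) (u : M) (η : L2Fibre ℰ μ u) :
    analysisOp lam (actSection lam e f) u η =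
      convOp lam (ccStar 𝒢 f) u (analysisOp lam e u η) := by
  refine Lp.ext ((coeFn_analysisOp lam _ u η).trans (Filter.EventuallyEq.trans ?_
    (coeFn_convOp lam (ccStar 𝒢 f) u (coeFn_analysisOp lam e u η)).symm))
  refine ae_of_all _ fun k => ?_
  have hk : 𝒢.s k.1 = u := k.2
  have hφ : Continuous fun h : Fib 𝒢.r u =>
      f (𝒢.mul (𝒢.inv h.1) ((𝒢.invFib u).symm k).1) :=
    f.continuous.comp (𝒢.continuous_mul_of_composable
      (𝒢.continuous_inv.comp continuous_subtype_val) continuous_const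
      fun h => by rw [𝒢.s_inv, h.2, ((𝒢.invFib u).symm k).2])
  rw [orbCoeff, orb_actSection, conj_integral_inner (integrable_smul_orb lam e hφ)]
  refine integral_congr_ae (ae_of_all _ fun h => ?_)
  simp only [inner_smul_left, ccStar_apply, orbCoeff, Homeomorph.symm_apply_apply,
    𝒢.invFib_symm_coe]
  rw [𝒢.inv_mul_rev _ _ (hk.trans h.2.symm)]
  rfl

/-- The action of `C_c(G)` on sections corresponds to the composition with the regular
representation. -/
theorem synthesisOp_actSection (e : gammaC ℰ μ) (f : C_c(G, ℂ)) (u : M) :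
    synthesisOp lam (actSection lam e f) u = (synthesisOp lam e u).comp (convOp lam f u) := by
  have h1 : analysisOp lam (actSection lam e f) u =
      (ContinuousLinearMap.adjoint (convOp lam f u)).comp (analysisOp lam e u) := by
    rw [adjoint_convOp]
    exact ContinuousLinearMap.ext fun η => analysisOp_actSection lam e f u η
  rw [synthesisOp, h1, ContinuousLinearMap.adjoint_comp, ContinuousLinearMap.adjoint_adjoint]
  rfl

/-! ### The operations on families of operators -/

namespace SynthesisSpace

variable {lam}

/-- The composition of a family of operators with an element of the product. -/
def ract (x : SynthesisSpace ℰ μ lam) (a : lam.RegularProduct) : SynthesisSpace ℰ μ lam :=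
  .of (fun u => (x.op u).comp (a.at u)) ⟨‖x‖ * ‖a‖, fun u =>
    (ContinuousLinearMap.opNorm_comp_le _ _).trans (mul_le_mul (norm_op_le x u)
      (HaarSystem.RegularProduct.norm_at_le a u) (norm_nonneg _) (norm_nonneg _))⟩

theorem norm_ract_le (x : SynthesisSpace ℰ μ lam) (a : lam.RegularProduct) :
    ‖x.ract a‖ ≤ ‖x‖ * ‖a‖ :=
  norm_le (by positivity) fun u => (ContinuousLinearMap.opNorm_comp_le _ _).trans
    (mul_le_mul (norm_op_le x u) (HaarSystem.RegularProduct.norm_at_le a u) (norm_nonneg _)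
      (norm_nonneg _))

variable (ℰ μ lam) in
/-- `ract` as a continuous bilinear map. -/
def ractL : SynthesisSpace ℰ μ lam →L[ℂ] lam.RegularProduct →L[ℂ] SynthesisSpace ℰ μ lam :=
  LinearMap.mkContinuous₂ (LinearMap.mk₂ ℂ ract
    (fun x y a => ext fun u => ContinuousLinearMap.add_comp _ _ _)
    (fun c x a => ext fun u => ContinuousLinearMap.smul_comp _ _ _)
    (fun x a b => ext fun u => ContinuousLinearMap.comp_add _ _ _)
    (fun c x a => ext fun u => ContinuousLinearMap.comp_smul _ _ _)) 1
    fun x a => by rw [one_mul]; exact norm_ract_le x a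

/-- The family of operators `x_u⋆ y_u`. -/
def ip (x y : SynthesisSpace ℰ μ lam) : lam.RegularProduct :=
  ⟨fun u => (ContinuousLinearMap.adjoint (x.op u)).comp (y.op u), memℓp_infty ⟨‖x‖ * ‖y‖, by
    rintro _ ⟨u, rfl⟩
    refine (ContinuousLinearMap.opNorm_comp_le _ _).trans ?_
    rw [LinearIsometryEquiv.norm_map]
    exact mul_le_mul (norm_op_le x u) (norm_op_le y u) (norm_nonneg _) (norm_nonneg _)⟩⟩

theorem at_ip (x y : SynthesisSpace ℰ μ lam) (u : M) :
    (x.ip y).at u = (ContinuousLinearMap.adjoint (x.op u)).comp (y.op u) := rfl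

theorem norm_ip_le (x y : SynthesisSpace ℰ μ lam) : ‖x.ip y‖ ≤ ‖x‖ * ‖y‖ := by
  refine HaarSystem.RegularProduct.norm_le (by positivity) fun u => ?_
  rw [at_ip]
  refine (ContinuousLinearMap.opNorm_comp_le _ _).trans ?_
  rw [LinearIsometryEquiv.norm_map]
  exact mul_le_mul (norm_op_le x u) (norm_op_le y u) (norm_nonneg _) (norm_nonneg _)

theorem ip_add_right (x y z : SynthesisSpace ℰ μ lam) : x.ip (y + z) = x.ip y + x.ip z :=
  HaarSystem.RegularProduct.ext fun _ => ContinuousLinearMap.comp_add _ _ _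

theorem ip_smul_right (c : ℂ) (x y : SynthesisSpace ℰ μ lam) : x.ip (c • y) = c • x.ip y :=
  HaarSystem.RegularProduct.ext fun _ => ContinuousLinearMap.comp_smul _ _ _

theorem star_ip (x y : SynthesisSpace ℰ μ lam) : star (x.ip y) = y.ip x :=
  HaarSystem.RegularProduct.ext fun u => by
    rw [HaarSystem.RegularProduct.at_star, at_ip, at_ip, ContinuousLinearMap.star_eq_adjoint,
      ContinuousLinearMap.adjoint_comp, ContinuousLinearMap.adjoint_adjoint]

theorem ip_ract_right (x y : SynthesisSpace ℰ μ lam) (a : lam.RegularProduct) :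
    x.ip (y.ract a) = x.ip y * a :=
  HaarSystem.RegularProduct.ext fun _ => (ContinuousLinearMap.comp_assoc _ _ _).symm

theorem ract_mul (x : SynthesisSpace ℰ μ lam) (a b : lam.RegularProduct) :
    x.ract (a * b) = (x.ract a).ract b :=
  ext fun _ => (ContinuousLinearMap.comp_assoc _ _ _).symm

theorem continuous_ip_right (x : SynthesisSpace ℰ μ lam) : Continuous fun y => x.ip y := by
  let L : SynthesisSpace ℰ μ lam →ₗ[ℂ] lam.RegularProduct :=
    { toFun := fun y => x.ip y
      map_add' := ip_add_right x
      map_smul' := fun c y => ip_smul_right c x y }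
  exact (L.mkContinuous ‖x‖ (norm_ip_le x)).continuous

theorem continuous_ip_left (y : SynthesisSpace ℰ μ lam) :
    Continuous fun x : SynthesisSpace ℰ μ lam => x.ip y := by
  have h : Continuous fun x : SynthesisSpace ℰ μ lam => star (y.ip x) := (continuous_ip_right y).star
  simpa only [star_ip] using h

end SynthesisSpace

end Existence

/-! ### Positivity -/

section Positivity

/-- A self-adjoint element of a C⋆-algebra is of the form `b⋆ b - d⋆ d` with self-adjoint `b` and
`d`, such that `d p d = -(d d)(d d)`. -/
theorem exists_sub_of_isSelfAdjoint {A : Type*} [NonUnitalCStarAlgebra A] {p : A}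
    (hp : IsSelfAdjoint p) : ∃ b d : A, IsSelfAdjoint b ∧ IsSelfAdjoint d ∧
      p = b * b - d * d ∧ d * p * d = -((d * d) * (d * d)) := by
  have hb : Continuous fun t : ℝ => √(max t 0) := by fun_prop
  have hd : Continuous fun t : ℝ => √(max (-t) 0) := by fun_prop
  have hb2 : ∀ t : ℝ, √(max t 0) * √(max t 0) = max t 0 := fun t =>
    Real.mul_self_sqrt (le_max_right _ _)
  have hd2 : ∀ t : ℝ, √(max (-t) 0) * √(max (-t) 0) = max (-t) 0 := fun t =>
    Real.mul_self_sqrt (le_max_right _ _)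
  refine ⟨cfcₙ (fun t : ℝ => √(max t 0)) p, cfcₙ (fun t : ℝ => √(max (-t) 0)) p,
    cfcₙ_predicate _ _, cfcₙ_predicate _ _, ?_, ?_⟩
  · rw [← cfcₙ_mul _ _ p hb.continuousOn (by simp) hb.continuousOn (by simp),
      ← cfcₙ_mul _ _ p hd.continuousOn (by simp) hd.continuousOn (by simp),
      ← cfcₙ_sub _ _ p (by fun_prop) (by simp) (by fun_prop) (by simp)]
    conv_lhs => rw [← cfcₙ_id ℝ p]
    refine cfcₙ_congr fun t _ => ?_
    simp only [hb2, id]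
    rcases le_total 0 t with h | h
    · rw [max_eq_left h, max_eq_right (by linarith), sub_zero]
    · rw [max_eq_right h, max_eq_left (by linarith)]
      ring
  · have h1 : cfcₙ (fun t : ℝ => √(max (-t) 0)) p * p * cfcₙ (fun t : ℝ => √(max (-t) 0)) p =
        cfcₙ (fun t : ℝ => √(max (-t) 0) * t * √(max (-t) 0)) p := by
      rw [cfcₙ_mul (fun t : ℝ => √(max (-t) 0) * t) _ p (by fun_prop) (by simp) hd.continuousOn
        (by simp), cfcₙ_mul _ (fun t : ℝ => t) p hd.continuousOn (by simp) (by fun_prop) (by simp),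
        cfcₙ_id' ℝ p]
    rw [h1, ← cfcₙ_mul _ _ p hd.continuousOn (by simp) hd.continuousOn (by simp),
      ← cfcₙ_mul _ _ p (by fun_prop) (by simp) (by fun_prop) (by simp), ← cfcₙ_neg]
    refine cfcₙ_congr fun t _ => ?_
    simp only [hd2]
    rw [mul_right_comm, hd2]
    rcases le_total 0 t with h | h
    · rw [max_eq_right (by linarith)]
      ring
    · rw [max_eq_left (by linarith)]
      ring

/-- If `D` is self-adjoint and `D X⋆ X D = -(D D)(D D)`, then both sides vanish, because the left
one is positive and the right one negative. -/
theorem apply_apply_eq_zero_of_conj_eq_neg {H K : Type*} [NormedAddCommGroup H]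
    [InnerProductSpace ℂ H] [CompleteSpace H] [NormedAddCommGroup K] [InnerProductSpace ℂ K]
    [CompleteSpace K] {D : H →L[ℂ] H} {T : H →L[ℂ] K} (hD : ContinuousLinearMap.adjoint D = D)
    (h : ∀ ξ, D (ContinuousLinearMap.adjoint T (T (D ξ))) = -D (D (D (D ξ)))) (ξ : H) :
    D (D ξ) = 0 := by
  have hs : ∀ v w, (inner ℂ v (D w) : ℂ) = inner ℂ (D v) w := fun v w => by
    rw [← ContinuousLinearMap.adjoint_inner_left, hD]
  have h1 : (inner ℂ ξ (D (ContinuousLinearMap.adjoint T (T (D ξ)))) : ℂ) =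
      inner ℂ (T (D ξ)) (T (D ξ)) := by
    rw [hs, ContinuousLinearMap.adjoint_inner_right]
  rw [h, inner_neg_right, hs, hs] at h1
  have h2 := congrArg Complex.re h1
  rw [Complex.neg_re] at h2
  have h3 : 0 ≤ (inner ℂ (T (D ξ)) (T (D ξ)) : ℂ).re := inner_self_nonneg (𝕜 := ℂ)
  have h4 : 0 ≤ (inner ℂ (D (D ξ)) (D (D ξ)) : ℂ).re := inner_self_nonneg (𝕜 := ℂ)
  exact (re_inner_self_nonpos (𝕜 := ℂ)).1 (show (inner ℂ (D (D ξ)) (D (D ξ)) : ℂ).re ≤ 0 by linarith)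

end Positivity

section Module

variable {m k d z : ℕ} {M : Type uM} {G : Type uG} {X : Type uX} {Z : Type uZ}
  [TopologicalSpace M] [ChartedSpace (EuclideanSpace ℝ (Fin m)) M]
  [TopologicalSpace G] [ChartedSpace (EuclideanSpace ℝ (Fin k)) G]
  [TopologicalSpace X] [ChartedSpace (EuclideanSpace ℝ (Fin d)) X]
  [TopologicalSpace Z] [ChartedSpace (EuclideanSpace ℝ (Fin z)) Z]
  {𝒢 : LieGroupoid m k M G}
  {F : Type uF} [NormedAddCommGroup F] [NormedSpace ℂ F]
  {E : X → Type uE} [∀ x, NormedAddCommGroup (E x)] [∀ x, InnerProductSpace ℂ (E x)]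
  [TopologicalSpace (TotalSpace F E)] [FiberBundle F E] [VectorBundle ℂ F E]
  [CompactSpace Z] [MeasurableSpace X] [BorelSpace X] {𝒳 : GFibreBundle 𝒢 d z X Z}
  {ℰ : GHermitianBundle 𝒳 F E} {μ : InvariantMeasures 𝒳}
  [T2Space X] [SecondCountableTopology X] [FiniteDimensional ℂ F] [T2Space M]
  [LocallyCompactSpace M] [LocallyCompactSpace X]
  [MeasurableSpace G] [BorelSpace G] [T2Space G] [SecondCountableTopology G]
  [LocallyCompactSpace G] (lam : HaarSystem 𝒢)
  [Fact 𝒢.IsProper] [Fact 𝒢.IsGCompact]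
  {Γ : Type uV} [NormedAddCommGroup Γ] [NormedSpace ℂ Γ] [CompleteSpace Γ]
  {ι : gammaC ℰ μ →ₗ[ℂ] Γ}

/-! ### The Hilbert module structure of a completion -/

/-- The operator-valued inner product of a family of operators is positive in every C⋆-subalgebra
that contains it: for self-adjoint `b, d` as in `exists_sub_of_isSelfAdjoint`, the operators
`(x_u d_u)⋆ (x_u d_u) = -(d_u d_u)⋆ (d_u d_u)` vanish. -/
theorem SynthesisSpace.exists_ip_eq {x : SynthesisSpace ℰ μ lam} {p : lam.CRed}
    (hp : p.1 = x.ip x) : ∃ b : lam.CRed, p = star b * b := by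
  have hsa : IsSelfAdjoint p := Subtype.ext (by
    change star p.1 = p.1
    rw [hp, SynthesisSpace.star_ip])
  obtain ⟨b, d, hb, hd, h1, h2⟩ := exists_sub_of_isSelfAdjoint hsa
  have hdd : d * d = 0 := by
    refine Subtype.ext (HaarSystem.RegularProduct.ext fun u => ContinuousLinearMap.ext fun ξ => ?_)
    have hda : ContinuousLinearMap.adjoint (d.1.at u) = d.1.at u :=
      congrArg (fun a : lam.CRed => a.1.at u) hd.star_eq
    have h3 := congrArg (fun a : lam.CRed => a.1.at u) h2
    have h4 : ∀ ξ, (d * p * d : lam.CRed).1.at u ξ = d.1.at u (p.1.at u (d.1.at u ξ)) :=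
      fun ξ => rfl
    have h5 : ∀ ξ, (-((d * d) * (d * d)) : lam.CRed).1.at u ξ =
      -d.1.at u (d.1.at u (d.1.at u (d.1.at u ξ))) := fun ξ => rfl
    refine apply_apply_eq_zero_of_conj_eq_neg (T := x.op u) hda (fun ξ => ?_) ξ
    rw [← h5, ← h3, h4, hp, SynthesisSpace.at_ip]
    rfl
  refine ⟨b, ?_⟩
  rw [hb.star_eq, h1, hdd, sub_zero]

namespace IsNormCompletion

variable {lam}

theorem isClosed_range_realise (h : IsNormCompletion lam ι) : IsClosed (range (realise lam ι)) :=
  h.isometry_realise.isClosedEmbedding.isClosed_range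

theorem ip_coe_mem (h : IsNormCompletion lam ι) (e₁ e₂ : gammaC ℰ μ) : ∃ f : C_c(G, ℂ),
    (∀ g, f g = inner ℂ (e₁.1 (𝒢.r g)) (L2Fibre.transl ℰ μ g rfl rfl (e₂.1 (𝒢.s g)))) ∧
    lam.IsRegularRep f ((realise lam ι (ι e₁)).ip (realise lam ι (ι e₂))) := by
  obtain ⟨f, hf⟩ := exists_inner_cc e₁ e₂
  refine ⟨f, hf, fun u ξ η hη => ?_⟩
  rw [SynthesisSpace.at_ip, h.realise_coe, h.realise_coe, op_synthesis, op_synthesis,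
    adjoint_synthesisOp]
  exact analysisOp_synthesisOp_isRegular lam e₁ e₂ hf u ξ η hη

theorem ip_mem (h : IsNormCompletion lam ι) (x y : Γ) :
    (realise lam ι x).ip (realise lam ι y) ∈ lam.redAlgebra := by
  have hcl : IsClosed (lam.redAlgebra : Set lam.RegularProduct) := inferInstance
  refine h.dense.induction (fun x' hx => ?_) (hcl.preimage
    ((SynthesisSpace.continuous_ip_left _).comp (realise lam ι).continuous)) x
  obtain ⟨e₁, rfl⟩ := hx
  refine h.dense.induction (fun y' hy => ?_) (hcl.preimage
    ((SynthesisSpace.continuous_ip_right _).comp (realise lam ι).continuous)) y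
  obtain ⟨e₂, rfl⟩ := hy
  obtain ⟨f, -, hf⟩ := h.ip_coe_mem e₁ e₂
  exact subset_closure (NonUnitalStarAlgebra.subset_adjoin ℂ _ ⟨f, hf⟩)

theorem realise_actSection (h : IsNormCompletion lam ι) (e : gammaC ℰ μ) (f : C_c(G, ℂ)) :
    realise lam ι (ι (actSection lam e f)) = (realise lam ι (ι e)).ract (regularRep lam f) := by
  rw [h.realise_coe, h.realise_coe]
  exact SynthesisSpace.ext fun u => synthesisOp_actSection lam e f u

/-- The realisation of a completion is stable under the reduced algebra: its range is closed, and
stable under the generators by `realise_actSection`. -/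
theorem exists_realise_eq_ract (h : IsNormCompletion lam ι) (a : lam.CRed) (x : Γ) :
    ∃ y, realise lam ι y = (realise lam ι x).ract a.1 := by
  have hcl := h.isClosed_range_realise
  refine redAlgebra_induction lam
    (P := fun a => ∀ x, (realise lam ι x).ract a ∈ range (realise lam ι)) ?_ (fun f x => ?_)
    (fun a b ha hb x => ?_) (fun x => ?_) (fun c a ha x => ?_) (fun a b ha hb x => ?_) a.2 x
  · simp only [ofPred_forall]
    exact isClosed_iInter fun x =>
      hcl.preimage (SynthesisSpace.ractL ℰ μ lam (realise lam ι x)).continuous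
  · refine h.dense.induction (fun x' hx => ?_) (hcl.preimage
      (((SynthesisSpace.ractL ℰ μ lam).flip (regularRep lam f)).continuous.comp
        (realise lam ι).continuous)) x
    obtain ⟨e, rfl⟩ := hx
    exact ⟨_, h.realise_actSection e f⟩
  · obtain ⟨y, hy⟩ := ha x
    obtain ⟨z, hz⟩ := hb x
    refine ⟨y + z, ?_⟩
    rw [map_add, hy, hz]
    exact ((SynthesisSpace.ractL ℰ μ lam (realise lam ι x)).map_add a b).symm
  · refine ⟨0, ?_⟩
    rw [map_zero]
    exact ((SynthesisSpace.ractL ℰ μ lam (realise lam ι x)).map_zero).symm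
  · obtain ⟨y, hy⟩ := ha x
    refine ⟨c • y, ?_⟩
    rw [map_smul, hy]
    exact ((SynthesisSpace.ractL ℰ μ lam (realise lam ι x)).map_smul c a).symm
  · obtain ⟨y, hy⟩ := ha x
    rw [SynthesisSpace.ract_mul, ← hy]
    exact hb y

/-- The action of an element of `C⋆_red(G)` on a completion: it corresponds to the composition of
families of operators. -/
def ractElt (h : IsNormCompletion lam ι) (x : Γ) (a : lam.CRed) : Γ :=
  (h.exists_realise_eq_ract a x).choose

theorem realise_ractElt (h : IsNormCompletion lam ι) (x : Γ) (a : lam.CRed) :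
    realise lam ι (h.ractElt x a) = SynthesisSpace.ractL ℰ μ lam (realise lam ι x) a.1 :=
  (h.exists_realise_eq_ract a x).choose_spec

/-- The module structure that a completion inherits from the families of operators. -/
@[reducible]
def hilbertModule (h : IsNormCompletion lam ι) : HilbertModule lam.CRed Γ where
  ract := LinearMap.mk₂ ℂ h.ractElt
    (fun x y a => h.realise_injective (by
      rw [map_add, h.realise_ractElt, h.realise_ractElt, h.realise_ractElt, map_add, map_add]
      rfl))
    (fun c x a => h.realise_injective (by
      rw [map_smul, h.realise_ractElt, h.realise_ractElt, map_smul, map_smul]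
      rfl))
    (fun x a b => h.realise_injective (by
      rw [map_add, h.realise_ractElt, h.realise_ractElt, h.realise_ractElt]
      exact (SynthesisSpace.ractL ℰ μ lam _).map_add a.1 b.1))
    (fun c x a => h.realise_injective (by
      rw [map_smul, h.realise_ractElt, h.realise_ractElt]
      exact (SynthesisSpace.ractL ℰ μ lam _).map_smul c a.1))
  ip x y := ⟨(realise lam ι x).ip (realise lam ι y), h.ip_mem x y⟩
  ract_mul x a b := h.realise_injective (by
    simp only [LinearMap.mk₂_apply]
    rw [h.realise_ractElt, h.realise_ractElt, h.realise_ractElt]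
    exact SynthesisSpace.ract_mul _ _ _)
  ip_add_right x y z := Subtype.ext (by
    simp only [map_add]
    exact SynthesisSpace.ip_add_right _ _ _)
  ip_smul_right c x y := Subtype.ext (by
    simp only [map_smul]
    exact SynthesisSpace.ip_smul_right _ _ _)
  ip_ract_right x y a := Subtype.ext (by
    simp only [LinearMap.mk₂_apply]
    rw [h.realise_ractElt]
    exact SynthesisSpace.ip_ract_right _ _ _)
  star_ip x y := Subtype.ext (SynthesisSpace.star_ip _ _)
  ip_self_nonneg x := SynthesisSpace.exists_ip_eq lam rfl
  norm_sq_eq x := by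
    rw [← h.norm_realise]
    exact SynthesisSpace.norm_sq_eq fun u => rfl

theorem isModuleCompletion (h : IsNormCompletion lam ι) :
    letI := h.hilbertModule
    IsModuleCompletion lam ι := by
  let := h.hilbertModule
  refine ⟨h.dense, h.ip_coe_mem, fun e f => ⟨⟨_, regularRep_mem lam f⟩,
    isRegularRep_regularRep lam f, actSection lam e f, fun u => rfl, h.realise_injective ?_⟩⟩
  rw [h.realise_actSection]
  exact (h.realise_ractElt (ι e) ⟨_, regularRep_mem lam f⟩).symm

end IsNormCompletion

/-! ### The completion -/

variable (ℰ μ) in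
/-- A copy of the space `Γ_c(𝔥)`, to be equipped with the norm of the Hilbert module. The Haar system
is an argument because this norm depends on it. -/
def PreModule (_ : HaarSystem 𝒢) : Type _ := gammaC ℰ μ

instance : AddCommGroup (PreModule ℰ μ lam) := inferInstanceAs (AddCommGroup (gammaC ℰ μ))
instance : Module ℂ (PreModule ℰ μ lam) := inferInstanceAs (Module ℂ (gammaC ℰ μ))

variable (ℰ μ) in
/-- The identity, as a map from `Γ_c(𝔥)` to `PreModule`. -/
def toPreModule : gammaC ℰ μ →ₗ[ℂ] PreModule ℰ μ lam := LinearMap.id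

instance : SeminormedAddCommGroup (PreModule ℰ μ lam) :=
  SeminormedAddCommGroup.induced (PreModule ℰ μ lam) (SynthesisSpace ℰ μ lam)
    (show PreModule ℰ μ lam →ₗ[ℂ] SynthesisSpace ℰ μ lam from synthesis ℰ μ lam)

instance : NormedSpace ℂ (PreModule ℰ μ lam) :=
  NormedSpace.induced ℂ (PreModule ℰ μ lam) (SynthesisSpace ℰ μ lam)
    (show PreModule ℰ μ lam →ₗ[ℂ] SynthesisSpace ℰ μ lam from synthesis ℰ μ lam)

variable (ℰ μ) in
/-- The inclusion of `Γ_c(𝔥)` into its completion. -/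
def toCompletion : gammaC ℰ μ →ₗ[ℂ] UniformSpace.Completion (PreModule ℰ μ lam) :=
  (UniformSpace.Completion.toComplₗᵢ (𝕜 := ℂ) (E := PreModule ℰ μ lam)).toLinearMap.comp
    (toPreModule ℰ μ lam)

theorem isNormCompletion_toCompletion : IsNormCompletion lam (toCompletion ℰ μ lam) where
  dense := UniformSpace.Completion.denseRange_coe (α := PreModule ℰ μ lam)
  norm_coe e := UniformSpace.Completion.norm_coe (toPreModule ℰ μ lam e)

end Module

end EquivariantHilbert

end

theorem theorem5p7 {m k d z : ℕ} {M : Type uM} {G : Type uG} {X : Type uX} {Z : Type uZ}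
    [TopologicalSpace M] [ChartedSpace (EuclideanSpace ℝ (Fin m)) M] [IsManifold (𝓡 m) ∞ M]
    [T2Space M] [SecondCountableTopology M]
    [TopologicalSpace G] [ChartedSpace (EuclideanSpace ℝ (Fin k)) G] [IsManifold (𝓡 k) ∞ G]
    [T2Space G] [SecondCountableTopology G] [MeasurableSpace G] [BorelSpace G]
    [TopologicalSpace X] [ChartedSpace (EuclideanSpace ℝ (Fin d)) X] [IsManifold (𝓡 d) ∞ X]
    [T2Space X] [SecondCountableTopology X] [MeasurableSpace X] [BorelSpace X]
    [TopologicalSpace Z] [ChartedSpace (EuclideanSpace ℝ (Fin z)) Z] [IsManifold (𝓡 z) ∞ Z]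
    [T2Space Z] [CompactSpace Z]
    {F : Type uF} [NormedAddCommGroup F] [NormedSpace ℂ F] [FiniteDimensional ℂ F]
    {E : X → Type uE} [∀ x, NormedAddCommGroup (E x)] [∀ x, InnerProductSpace ℂ (E x)]
    [TopologicalSpace (TotalSpace F E)] [FiberBundle F E] [VectorBundle ℂ F E]
    [VectorBundle ℝ F E] [ContMDiffVectorBundle ∞ F E (𝓡 d)]
    (𝒢 : LieGroupoid m k M G) (hproper : 𝒢.IsProper) (hcompact : 𝒢.IsGCompact)
    (lam : HaarSystem 𝒢) (𝒳 : GFibreBundle 𝒢 d z X Z) (ℰ : GHermitianBundle 𝒳 F E)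
    (μ : InvariantMeasures 𝒳) :
    (∃ (Γ : Type (max uM uX uE)) (_ : NormedAddCommGroup Γ) (_ : NormedSpace ℂ Γ)
      (_ : CompleteSpace Γ) (_ : HilbertModule lam.CRed Γ) (ι : gammaC ℰ μ →ₗ[ℂ] Γ),
      IsModuleCompletion lam ι) ∧
    ∀ (Γ : Type uV) [NormedAddCommGroup Γ] [NormedSpace ℂ Γ] [CompleteSpace Γ]
      [HilbertModule lam.CRed Γ] (ι : gammaC ℰ μ →ₗ[ℂ] Γ), IsModuleCompletion lam ι →
      ∃ Φ : boundedMorphisms ℰ μ →⋆ₐ[ℂ] HilbertModule.adjointable lam.CRed Γ,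
        (∀ (T : boundedMorphisms ℰ μ) (e : gammaC ℰ μ), (Φ T).1 (ι e) = ι (applySection T e)) ∧
        Function.Injective Φ ∧
        (∀ T : boundedMorphisms ℰ μ, ‖Φ T‖ = ⨆ u, ‖T.1 u‖) ∧
        Φ '' compactMorphisms ℰ μ = HilbertModule.compacts lam.CRed Γ ∧
        ∀ e₁ e₂ : ℰ.ccSec, ∃ T ∈ compactMorphisms ℰ μ, IsRankOneMorphism lam e₁ e₂ T ∧
          ∀ x : Γ, (Φ T).1 x = HilbertModule.ract (ι (ℰ.toGammaC μ e₁))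
            (HilbertModule.ip (ι (ℰ.toGammaC μ e₂)) x : lam.CRed) := by
  have : LocallyCompactSpace M := ChartedSpace.locallyCompactSpace (EuclideanSpace ℝ (Fin m)) M
  have : LocallyCompactSpace G := ChartedSpace.locallyCompactSpace (EuclideanSpace ℝ (Fin k)) G
  have : LocallyCompactSpace X := ChartedSpace.locallyCompactSpace (EuclideanSpace ℝ (Fin d)) X
  have : Fact 𝒢.IsProper := ⟨hproper⟩
  have : Fact 𝒢.IsGCompact := ⟨hcompact⟩
  refine ⟨?_, ?_⟩
  · have h := isNormCompletion_toCompletion (ℰ := ℰ) (μ := μ) lam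
    exact ⟨UniformSpace.Completion (PreModule ℰ μ lam), inferInstance, inferInstance,
      inferInstance, h.hilbertModule, toCompletion ℰ μ lam, h.isModuleCompletion⟩
  · intro Γ _ _ _ _ ι h
    refine ⟨h.repr, h.moduleMap_coe, h.repr_injective, h.norm_repr,
      h.repr_image_compactMorphisms, fun e₁ e₂ => ?_⟩
    refine ⟨rankOne lam (ℰ.toGammaC μ e₁) (ℰ.toGammaC μ e₂), rankOne_mem_compactMorphisms lam _ _,
      fun u ξ => ⟨integrable_rankOne lam (ℰ.toGammaC μ e₁) (ℰ.toGammaC μ e₂) u ξ,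
        rankOneOp_apply lam (ℰ.toGammaC μ e₁) (ℰ.toGammaC μ e₂) u ξ⟩,
      fun x => h.moduleMap_rankOne _ _ x⟩
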